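/- Let $n\ge 3$. A \emph{generalized $n$-gon} is a bipartite graph of diameter $n$ and girth $2n$ in which every vertex has valency at least $3$. A \emph{loose end} of a graph is a vertex of valency at most $1$; a \emph{clean arc} is given by a path $(x_0,\dots,x_{n-1})$ all of whose interior vertices $x_1,\dots,x_{n-2}$ have valency $2$. A generalized $n$-gon is \emph{open} if every nonempty finite subgraph contains a loose end or a clean arc (valencies being computed in the subgraph). Let $T_n$ be the first-order theory of open generalized $n$-gons in the language of graphs expanded by predicates for the bipartition. The \emph{free $n$-completion} of a graph $\Gamma_0$ is $\bigcup_{i<\omega}\Gamma_i$, where $\Gamma_{i+1}$ is obtained from $\Gamma_i$ by adding, between every two vertices at distance $n+1$ in $\Gamma_i$, a new path of length $n-1$ whose interior vertices are new and have valency $2$ in $\Gamma_{i+1}$. A \emph{hat-rack} of length $k$ is a path $(x_0,\dots,x_k)$ together with further vertices, each having exactly one neighbour, which is one of $x_1,\dots,x_{k-1}$. A generalized $n$-gon is \emph{free} if it is isomorphic to the free $n$-completion of a hat-rack of length at least $n+3$. Let $\Gamma^{n+3}$ be the free $n$-completion of the path $(x_0,\dots,x_{n+3})$. Finally, let $\Gamma'$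 denote any union $\bigcup_{i<\omega}\Gamma_i$ of a strictly increasing chain $\Gamma_0\subsetneq\Gamma_1\subsetneq\cdots$ of copies of $\Gamma^{n+3}$. Then: \begin{enumerate} \item $T_n$ has no prime model, i.e. no model of $T_n$ embeds elementarily into every model of $T_n$. \item $\Gamma^{n+3}$ is an open generalized $n$-gon and, with either choice of bipartition predicates, it is a minimal model of $T_n$, i.e. a model without proper elementary substructures. \item Chains as in the definition of $\Gamma'$ exist. Every $\Gamma'$ obtained from such a chain is an open generalized $n$-gon which is not free, is (with either choice of bipartition predicates) a minimal model of $T_n$, and is not isomorphic to $\Gamma^{n+3}$, not even as a graph. \end{enumerate} -/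

import Mathlib

open FirstOrder

universe u

namespace OpenPolygon

/-! ### Generalized polygons -/

section Polygons

variable {V : Type u}

/-- A generalized `n`-gon: a bipartite graph of diameter `n` and girth `2 n` which is thick, that
is, all of whose vertices have valency at least `3`. -/
structure IsGeneralizedPolygon (n : ℕ) (G : SimpleGraph V) : Prop where
  bipartite : G.IsBipartite
  diameter : G.ediam = (n : ℕ∞)
  girth : G.egirth = ((2 * n : ℕ) : ℕ∞)
  thick : ∀ v : V, 3 ≤ (G.neighborSet v).encard

/-- The graph `G` contains a loose end: a vertex of valency at most `1`. -/
def HasLooseEnd (G : SimpleGraph V) : Prop :=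
  ∃ v : V, (G.neighborSet v).encard ≤ 1

/-- The graph `G` contains a clean arc: a path `(x₀, …, xₙ₋₁)` in `G` all of whose interior
vertices `x₁, …, xₙ₋₂` have valency exactly `2` in `G`. -/
def HasCleanArc (n : ℕ) (G : SimpleGraph V) : Prop :=
  ∃ (x y : V) (p : G.Walk x y), p.IsPath ∧ p.length + 1 = n ∧
    ∀ z ∈ p.support, z ≠ x → z ≠ y → (G.neighborSet z).encard = 2

/-- A graph is open if every nonempty finite (induced) subgraph contains a loose end or a clean
arc, valencies being computed in that subgraph. -/
def IsOpenGraph (n : ℕ) (G : SimpleGraph V) : Prop :=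
  ∀ A : Finset V, A.Nonempty →
    HasLooseEnd (G.induce (A : Set V)) ∨ HasCleanArc n (G.induce (A : Set V))

/-- An open generalized `n`-gon. -/
def IsOpenPolygon (n : ℕ) (G : SimpleGraph V) : Prop :=
  IsGeneralizedPolygon n G ∧ IsOpenGraph n G

end Polygons

/-! ### The free `n`-completion -/

/-- Names for the vertices of the free completion of a graph on `V`: the vertices of `V`, and, for
vertices `x`, `y` with names already given, the `j`-th vertex of the arc added from `x` to `y`. -/
inductive FreeVertex (V : Type u) : Type u
  | base (v : V) : FreeVertex V
  | arc (x y : FreeVertex V) (j : ℕ) : FreeVertex V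

section FreeCompletion

variable {V : Type u}

theorem FreeVertex.ne_arc_left (x y : FreeVertex V) (j : ℕ) : x ≠ .arc x y j := by
  intro h
  have := congrArg sizeOf h
  simp at this
  omega

theorem FreeVertex.ne_arc_right (x y : FreeVertex V) (j : ℕ) : y ≠ .arc x y j := by
  intro h
  have := congrArg sizeOf h
  simp at this
  omega

/-- The `j`-th vertex (`0 ≤ j ≤ n - 1`) of the path `(x, arc x y 1, …, arc x y (n - 2), y)`. -/
def arcVertex (n : ℕ) (x y : FreeVertex V) (j : ℕ) : FreeVertex V :=
  if j = 0 then x else if j + 1 = n then y else .arc x y j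

/-- `x` and `y` have distance `n + 1` in `H`. The condition `WellOrderingRel x y`, for a fixed
well-ordering, selects exactly one of the ordered pairs `(x, y)`, `(y, x)`. -/
def NeedsArc (n : ℕ) (H : (⊤ : SimpleGraph (FreeVertex V)).Subgraph) (x y : FreeVertex V) : Prop :=
  H.spanningCoe.dist x y = n + 1 ∧ WellOrderingRel x y

theorem NeedsArc.ne {n : ℕ} {H : (⊤ : SimpleGraph (FreeVertex V)).Subgraph} {x y : FreeVertex V}
    (h : NeedsArc n H x y) : x ≠ y := by
  rintro rfl
  have := h.1
  simp at this

theorem NeedsArc.mem {n : ℕ} {H : (⊤ : SimpleGraph (FreeVertex V)).Subgraph} {x y : FreeVertex V}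
    (h : NeedsArc n H x y) : x ∈ H.verts ∧ y ∈ H.verts := by
  have hr : H.spanningCoe.Reachable x y :=
    SimpleGraph.Reachable.of_dist_ne_zero (by rw [h.1]; omega)
  have key : ∀ {a b : FreeVertex V}, H.spanningCoe.Reachable a b → a ≠ b → a ∈ H.verts := by
    rintro a b ⟨p⟩ hab
    cases p with
    | nil => exact absurd rfl hab
    | cons e _ => exact H.edge_vert e
  exact ⟨key hr h.ne, key hr.symm h.ne.symm⟩

theorem arcVertex_ne {n : ℕ} {x y : FreeVertex V} (hxy : x ≠ y) (j : ℕ) :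
    arcVertex n x y j ≠ arcVertex n x y (j + 1) := by
  unfold arcVertex
  have h1 := FreeVertex.ne_arc_left x y
  have h2 := FreeVertex.ne_arc_right x y
  have h3 : x.arc y j ≠ x.arc y (j + 1) := by
    intro h
    injection h
    omega
  rw [if_neg (Nat.succ_ne_zero j)]
  by_cases hc : j + 1 + 1 = n
  · rw [if_pos hc]
    by_cases ha : j = 0
    · rwa [if_pos ha]
    · rw [if_neg ha, if_neg (by omega)]
      exact (h2 _).symm
  · rw [if_neg hc]
    by_cases ha : j = 0
    · rw [if_pos ha]
      exact h1 _
    · rw [if_neg ha]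
      by_cases hb : j + 1 = n
      · rw [if_pos hb]
        exact h2 _
      · rw [if_neg hb]
        exact h3

/-- Adding to the graph `H` a clean arc between every two vertices of `H` which have distance
`n + 1` in `H`. -/
def addArcs (n : ℕ) (H : (⊤ : SimpleGraph (FreeVertex V)).Subgraph) :
    (⊤ : SimpleGraph (FreeVertex V)).Subgraph where
  verts := H.verts ∪ {z | ∃ x y j, NeedsArc n H x y ∧ 0 < j ∧ j + 1 < n ∧ z = .arc x y j}
  Adj a b := H.Adj a b ∨ ∃ x y j, NeedsArc n H x y ∧ j + 1 < n ∧
    ((a = arcVertex n x y j ∧ b = arcVertex n x y (j + 1)) ∨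
      (b = arcVertex n x y j ∧ a = arcVertex n x y (j + 1)))
  adj_sub := by
    rintro a b (h | ⟨x, y, j, h, -, ⟨rfl, rfl⟩ | ⟨rfl, rfl⟩⟩)
    · exact H.adj_sub h
    · exact arcVertex_ne h.ne j
    · exact (arcVertex_ne h.ne j).symm
  edge_vert := by
    have key : ∀ {x y : FreeVertex V} (j : ℕ), NeedsArc n H x y → j < n →
        arcVertex n x y j ∈ H.verts ∪
          {z | ∃ x y j, NeedsArc n H x y ∧ 0 < j ∧ j + 1 < n ∧ z = .arc x y j} := by
      intro x y j h hj
      unfold arcVertex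
      split_ifs with h0 h1
      · exact Or.inl h.mem.1
      · exact Or.inl h.mem.2
      · exact Or.inr ⟨x, y, j, h, by omega, by omega, rfl⟩
    rintro a b (h | ⟨x, y, j, h, hj, ⟨rfl, rfl⟩ | ⟨rfl, rfl⟩⟩)
    · exact Or.inl (H.edge_vert h)
    · exact key j h (by omega)
    · exact key (j + 1) h hj
  symm := ⟨by
    rintro a b (h | ⟨x, y, j, h, hj, h' | h'⟩)
    · exact Or.inl h.symm
    · exact Or.inr ⟨x, y, j, h, hj, Or.inr h'⟩
    · exact Or.inr ⟨x, y, j, h, hj, Or.inl h'⟩⟩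

/-- The stages of the free `n`-completion: stage `0` is a copy of `G`, and each next stage arises
by adding clean arcs between all vertices at distance `n + 1`. -/
def freeStage (n : ℕ) (G : SimpleGraph V) : ℕ → (⊤ : SimpleGraph (FreeVertex V)).Subgraph
  | 0 =>
    { verts := Set.range FreeVertex.base
      Adj := fun a b => ∃ v w, G.Adj v w ∧ a = .base v ∧ b = .base w
      adj_sub := by
        rintro a b ⟨v, w, h, rfl, rfl⟩ e
        injection e with e
        exact h.ne e
      edge_vert := by
        rintro a b ⟨v, w, h, rfl, rfl⟩
        exact ⟨v, rfl⟩
      symm := ⟨by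
        rintro a b ⟨v, w, h, rfl, rfl⟩
        exact ⟨w, v, h.symm, rfl, rfl⟩⟩ }
  | i + 1 => addArcs n (freeStage n G i)

/-- The vertices of the free `n`-completion of `G`. -/
abbrev FreeCompletionVertex (n : ℕ) (G : SimpleGraph V) : Type u :=
  ((⨆ i, freeStage n G i : (⊤ : SimpleGraph (FreeVertex V)).Subgraph)).verts

/-- The free `n`-completion of `G`: the union of the stages. -/
def freeCompletion (n : ℕ) (G : SimpleGraph V) : SimpleGraph (FreeCompletionVertex n G) :=
  (⨆ i, freeStage n G i : (⊤ : SimpleGraph (FreeVertex V)).Subgraph).coe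

/-- `G` is a hat-rack of length `k`: a path `(x₀, …, x_k)` together with further vertices, each of
which has exactly one neighbour, this neighbour being one of `x₁, …, x_{k-1}`. -/
def IsHatRack (k : ℕ) (G : SimpleGraph V) : Prop :=
  ∃ x : SimpleGraph.pathGraph (k + 1) ↪g G,
    ∀ v ∉ Set.range x, ∃ i : Fin (k + 1), 0 < (i : ℕ) ∧ (i : ℕ) < k ∧
      ∀ w, G.Adj v w ↔ w = x i

/-- A generalized `n`-gon is free if it is the free `n`-completion of a hat-rack of length at
least `n + 3`. -/
def IsFreePolygon (n : ℕ) (G : SimpleGraph V) : Prop :=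
  ∃ k : ℕ, n + 3 ≤ k ∧ ∃ (W : Type u) (H : SimpleGraph W), IsHatRack k H ∧
    Nonempty (G ≃g freeCompletion n H)

end FreeCompletion

/-- The vertices of `Γ^k`. -/
abbrev GammaVertex (n k : ℕ) : Type := FreeCompletionVertex n (SimpleGraph.pathGraph (k + 1))

/-- `Γ^k`, the free `n`-completion of a path `(x₀, …, x_k)` with `k` edges. -/
def Gamma (n k : ℕ) : SimpleGraph (GammaVertex n k) :=
  freeCompletion n (SimpleGraph.pathGraph (k + 1))

/-- `G` is the union of a strictly increasing chain `Γ₀ ⊊ Γ₁ ⊊ …` of subgraphs, all of which are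
copies of `Γ^{n+3}`. -/
def IsGammaPrime {V : Type u} (n : ℕ) (G : SimpleGraph V) : Prop :=
  ∃ S : ℕ → Set V, (∀ i, S i ⊂ S (i + 1)) ∧ (⋃ i, S i) = Set.univ ∧
    ∀ i, Nonempty (G.induce (S i) ≃g Gamma n (n + 3))

/-! ### The theory of open generalized polygons -/

/-- The relation symbols: incidence, and the two predicates for the bipartition. -/
inductive PolygonRel : ℕ → Type
  | adj : PolygonRel 2
  | point : PolygonRel 1
  | line : PolygonRel 1

/-- The language of graphs expanded by predicates for the bipartition. -/
def polygonLang : FirstOrder.Language.{0, 0} := ⟨fun _ => Empty, PolygonRel⟩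

/-- A graph with a bipartition (given as a proper colouring by two colours) as a structure. -/
@[reducible] def polygonStructure {V : Type u} (G : SimpleGraph V) (c : G.Coloring Bool) :
    polygonLang.Structure V where
  funMap := fun f => f.elim
  RelMap
    | .adj => fun x => G.Adj (x 0) (x 1)
    | .point => fun x => c (x 0) = true
    | .line => fun x => c (x 0) = false

/-- The theory `T_n` of open generalized `n`-gons: all sentences that hold in every open generalized
`n`-gon. -/
def openPolygonTheory (n : ℕ) : polygonLang.Theory :=
  {φ | ∀ (V : Type) (G : SimpleGraph V) (c : G.Coloring Bool), IsOpenPolygon n G →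
    @FirstOrder.Language.Sentence.Realize polygonLang V (polygonStructure G c) φ}

/-- `M` is a prime model of `T`: a model of `T` that embeds elementarily into every model of `T`. -/
def IsPrimeModel {L : FirstOrder.Language.{0, 0}} (T : L.Theory) (M : Type u) [L.Structure M] : Prop :=
  M ⊨ T ∧ ∀ (N : Type u) [L.Structure N], N ⊨ T → Nonempty (M ↪ₑ[L] N)

/-- `M` is a minimal model of `T`: a model of `T` without proper elementary substructures. -/
def IsMinimalModel {L : FirstOrder.Language.{0, 0}} (T : L.Theory) (M : Type u) [L.Structure M] : Prop :=
  M ⊨ T ∧ ∀ S : L.ElementarySubstructure M, S = ⊤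

end OpenPolygon

/-! Everything rests on the predimension δ(A) = (n-1)|A| - (n-2)|E(A)| of finite vertex sets;
`defect` is 2δ, and 2|E(A)| is `e2`. Adding a clean arc (n-2 vertices, n-1 edges) leaves δ
unchanged, adding a loose end raises it, and further edges lower it. A path of length n+3 has δ =
2n+2. Hence every finite subset of Γ^{n+3} lies in a finite set with δ ≤ 2n+2
(`gamma_exists_superset`), and the same holds in every Γ'. Conversely, call |E(A)| - |A| the surplus
of A: in an open graph of girth at least 2n, every finite set having a subset of surplus at least 2
satisfies δ ≥ 2n+2 (`defect_ge_of_subset`).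

Minimality. Finite configurations over finite parts of an elementary substructure S have copies in
S. Three copies of C \ S over its neighbours in S, together with openness, yield a loose end or a
clean arc of C outside S. Such pieces are stripped until C ∩ S is left; the last piece cannot be an
arc with both ends in S, because S already contains the unique short path between them. So δ(C ∩ S)
< δ(C) for every finite C not contained in S (`CopiesPatterns.defect_filter_lt`). If S were proper,
a set of surplus at least 2 could be copied into S, and the copy together with a point outside S
enlarged to a set C with δ(C) ≤ 2n+2; then δ(C ∩ S) < 2n+2 violates the lower bound.

Chains. If every finite set containing a path y of length n+3 has δ ≥ 2n+2, then the arcs of the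
free completion, realized stage by stage in the polygon, are clean, so y generates a copy of Γ^{n+3}
(`exists_gamma_embedding`). Let Z be y together with its three first arcs. If some finite C not
contained in Z has no loose end and no clean arc outside Z, this copy is a proper subset, since
Γ^{n+3} is open over its first stage. Suitable y and C inside Γ^{n+3} are given by explicit
configurations, one uniform in n ≥ 4 and one for n = 3. Iterating the resulting proper
self-embedding gives a chain.

Γ' is not free. If Γ' were the free completion of a hat-rack H, the bound on δ would leave H at most
n+4 vertices, so H would lie in some Γ_m. As Γ_m contains all paths of length n-1 between its
vertices, Γ_m would be everything. Since Γ^{n+3} is free, it is not isomorphic to Γ'. A prime model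
would embed elementarily into both minimal models, hence onto both, and make them isomorphic. -/

namespace OpenPolygon

/-! ### Counting edges in finite sets of vertices -/

section Counting

variable {V : Type*} {G : SimpleGraph V}

open Classical in
/-- The number of neighbours of `v` in the finite set `A`. -/
noncomputable def dg (G : SimpleGraph V) (A : Finset V) (v : V) : ℕ := (A.filter (G.Adj v)).card

/-- Twice the number of edges inside the finite set `A`. -/
noncomputable def e2 (G : SimpleGraph V) (A : Finset V) : ℕ := ∑ a ∈ A, dg G A a

/-- Twice the value of `(n - 1) |A| - (n - 2) |E(A)|`. -/
noncomputable def defect (n : ℕ) (G : SimpleGraph V) (A : Finset V) : ℤ :=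
  2 * ((n : ℤ) - 1) * A.card - ((n : ℤ) - 2) * e2 G A

theorem dg_mono {A B : Finset V} (h : A ⊆ B) (v : V) : dg G A v ≤ dg G B v := by
  classical
  exact Finset.card_le_card (Finset.filter_subset_filter _ h)

open Classical in
theorem dg_insert_self (A : Finset V) (v : V) : dg G (insert v A) v = dg G A v := by
  simp [dg, Finset.filter_insert]

open Classical in
theorem dg_insert {A : Finset V} {v : V} (hv : v ∉ A) (w : V) :
    dg G (insert v A) w = dg G A w + if G.Adj w v then 1 else 0 := by
  unfold dg
  rw [Finset.filter_insert]
  split_ifs with h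
  · rw [Finset.card_insert_of_notMem (by simp [hv])]
  · simp

open Classical in
theorem e2_insert {A : Finset V} {v : V} (hv : v ∉ A) :
    e2 G (insert v A) = e2 G A + 2 * dg G A v := by
  unfold e2
  rw [Finset.sum_insert hv, dg_insert_self, Finset.sum_congr rfl (fun w _ => dg_insert hv w),
    Finset.sum_add_distrib]
  have : (∑ x ∈ A, if G.Adj x v then 1 else 0) = dg G A v := by
    rw [dg, Finset.card_filter]
    exact Finset.sum_congr rfl fun x _ => by simp [G.adj_comm]
  omega

open Classical in
theorem e2_erase {A : Finset V} {v : V} (hv : v ∈ A) :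
    e2 G A = e2 G (A.erase v) + 2 * dg G A v := by
  conv_lhs => rw [← Finset.insert_erase hv]
  rw [e2_insert (Finset.notMem_erase v A), ← dg_insert_self, Finset.insert_erase hv]

theorem e2_empty : e2 G (∅ : Finset V) = 0 := by simp [e2]

theorem even_e2 (A : Finset V) : Even (e2 G A) := by
  classical
  induction A using Finset.induction with
  | empty => simp [e2_empty]
  | insert v A hv ih => rw [e2_insert hv]; exact ih.add (even_two_mul _)

open Classical in
theorem e2_union {A B : Finset V} (hd : Disjoint A B) (h : ∀ a ∈ A, ∀ b ∈ B, ¬ G.Adj a b) :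
    e2 G (A ∪ B) = e2 G A + e2 G B := by
  unfold e2
  rw [Finset.sum_union hd]
  congr 1 <;> refine Finset.sum_congr rfl fun x hx => ?_ <;> unfold dg <;> congr 1 <;> ext y <;>
    simp only [Finset.mem_filter, Finset.mem_union]
  · constructor
    · rintro ⟨h1 | h1, h2⟩
      · exact ⟨h1, h2⟩
      · exact absurd h2 (h x hx y h1)
    · rintro ⟨h1, h2⟩; exact ⟨Or.inl h1, h2⟩
  · constructor
    · rintro ⟨h1 | h1, h2⟩
      · exact absurd h2.symm (h y h1 x hx)
      · exact ⟨h1, h2⟩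
    · rintro ⟨h1, h2⟩; exact ⟨Or.inr h1, h2⟩

theorem one_le_dg {A : Finset V} {v a : V} (ha : a ∈ A) (h : G.Adj v a) : 1 ≤ dg G A v := by
  classical
  exact Finset.card_pos.2 ⟨a, by simp [ha, h]⟩

theorem two_le_dg {A : Finset V} {v a b : V} (ha : a ∈ A) (hb : b ∈ A) (hab : a ≠ b)
    (h : G.Adj v a) (h' : G.Adj v b) : 2 ≤ dg G A v := by
  classical
  exact Finset.one_lt_card.2 ⟨a, by simp [ha, h], b, by simp [hb, h'], hab⟩

theorem three_le_dg {A : Finset V} {v a b c : V} (ha : a ∈ A) (hb : b ∈ A) (hc : c ∈ A)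
    (hab : a ≠ b) (hac : a ≠ c) (hbc : b ≠ c)
    (h : G.Adj v a) (h' : G.Adj v b) (h'' : G.Adj v c) : 3 ≤ dg G A v := by
  classical
  exact Finset.two_lt_card.2
    ⟨a, by simp [ha, h], b, by simp [hb, h'], c, by simp [hc, h''], hab, hac, hbc⟩

theorem exists_of_two_le_dg {A : Finset V} {v : V} (h : 2 ≤ dg G A v) (a : V) :
    ∃ b ∈ A, b ≠ a ∧ G.Adj v b := by
  classical
  obtain ⟨b, hb, hba⟩ := Finset.exists_mem_ne (show 1 < _ from h) a
  rw [Finset.mem_filter] at hb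
  exact ⟨b, hb.1, hba, hb.2⟩

theorem eq_or_eq_of_dg_le_two {A : Finset V} {v a b w : V} (h2 : dg G A v ≤ 2) (ha : a ∈ A)
    (hb : b ∈ A) (hw : w ∈ A) (hab : a ≠ b) (h : G.Adj v a) (h' : G.Adj v b) (h'' : G.Adj v w) :
    w = a ∨ w = b := by
  by_contra! hc
  have := three_le_dg ha hb hw hab hc.1.symm hc.2.symm h h' h''
  omega

open Classical in
theorem defect_insert (n : ℕ) {A : Finset V} {v : V} (hv : v ∉ A) :
    defect n G (insert v A) = defect n G A + 2 * ((n : ℤ) - 1) - 2 * ((n : ℤ) - 2) * dg G A v := by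
  unfold defect
  rw [e2_insert hv, Finset.card_insert_of_notMem hv]
  push_cast
  ring

open Classical in
theorem defect_erase_lt {n : ℕ} (hn : 3 ≤ n) {A : Finset V} {v : V} (hv : v ∈ A)
    (h : dg G A v ≤ 1) : defect n G (A.erase v) < defect n G A := by
  have h1 := defect_insert (G := G) n (Finset.notMem_erase v A)
  rw [Finset.insert_erase hv] at h1
  have h2 : dg G (A.erase v) v ≤ 1 := (dg_mono (Finset.erase_subset _ _) v).trans h
  have h3 : ((dg G (A.erase v) v : ℕ) : ℤ) ≤ 1 := by exact_mod_cast h2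
  have h4 : (3 : ℤ) ≤ n := by exact_mod_cast hn
  nlinarith

/-! ### Paths given by sequences of vertices -/

/-- The first `m + 1` members of `p` form a path of length `m` in `G`. -/
structure IsPathSeq (G : SimpleGraph V) (m : ℕ) (p : ℕ → V) : Prop where
  adj : ∀ i < m, G.Adj (p i) (p (i + 1))
  inj : Set.InjOn p (Set.Iic m)

namespace IsPathSeq

variable {m : ℕ} {p : ℕ → V}

theorem eq_iff (h : IsPathSeq G m p) {i j : ℕ} (hi : i ≤ m) (hj : j ≤ m) :
    p i = p j ↔ i = j :=
  ⟨fun e => h.inj hi hj e, fun e => e ▸ rfl⟩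

theorem sub (h : IsPathSeq G m p) {i k : ℕ} (hk : i + k ≤ m) :
    IsPathSeq G k (fun t => p (i + t)) where
  adj t ht := h.adj (i + t) (by omega)
  inj := by
    intro a ha b hb e
    simp only [Set.mem_Iic] at ha hb
    have := (h.eq_iff (by omega) (by omega)).1 e
    omega

theorem reverse (h : IsPathSeq G m p) : IsPathSeq G m (fun t => p (m - t)) where
  adj t ht := by
    have := (h.adj (m - (t + 1)) (by omega)).symm
    rwa [show m - (t + 1) + 1 = m - t by omega] at this
  inj := by
    intro a ha b hb e
    simp only [Set.mem_Iic] at ha hb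
    have := (h.eq_iff (by omega) (by omega)).1 e
    omega

end IsPathSeq

-- Every new vertex of the chain is adjacent to its predecessor and so brings at least one edge.
open Classical in
theorem e2_union_chain {A : Finset V} {p : ℕ → V} (h0 : p 0 ∈ A) :
    ∀ j : ℕ, (∀ i < j, G.Adj (p i) (p (i + 1))) → (∀ i, 1 ≤ i → i ≤ j → p i ∉ A) →
      Set.InjOn p (Set.Icc 1 j) →
      e2 G A + 2 * j ≤ e2 G (A ∪ (Finset.Icc 1 j).image p) ∧
        (A ∪ (Finset.Icc 1 j).image p).card = A.card + j := by
  intro j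
  induction j with
  | zero => intro _ _ _; simp
  | succ j ih =>
    intro hadj hA hinj
    obtain ⟨ih1, ih2⟩ := ih (fun i hi => hadj i (by omega)) (fun i h1 h2 => hA i h1 (by omega))
      (hinj.mono (Set.Icc_subset_Icc le_rfl (by omega)))
    have e1 : A ∪ (Finset.Icc 1 (j + 1)).image p
        = insert (p (j + 1)) (A ∪ (Finset.Icc 1 j).image p) := by
      rw [← Finset.insert_Icc_right_eq_Icc_add_one (by omega), Finset.image_insert, Finset.union_insert]
    have hnot : p (j + 1) ∉ A ∪ (Finset.Icc 1 j).image p := by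
      rw [Finset.mem_union, not_or]
      refine ⟨hA _ (by omega) le_rfl, ?_⟩
      simp only [Finset.mem_image, Finset.mem_Icc, not_exists, not_and]
      intro i hi e
      have := hinj (by simp; omega) (by simp) e
      omega
    have hmem : p j ∈ A ∪ (Finset.Icc 1 j).image p := by
      rcases Nat.eq_zero_or_pos j with rfl | hj
      · simp [h0]
      · exact Finset.mem_union_right _ (Finset.mem_image.2 ⟨j, by simp; omega, rfl⟩)
    have hd := one_le_dg hmem (hadj j (by omega)).symm
    rw [e1, e2_insert hnot, Finset.card_insert_of_notMem hnot]
    omega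

-- The ear is built from both ends towards `p k`, and `p k` is inserted last. Thus its full valency
-- in the union is counted, besides one edge for each of the other m-2 interior vertices.
open Classical in
theorem e2_union_ear {A : Finset V} {p : ℕ → V} {m k : ℕ} (hp : IsPathSeq G m p) (h0 : p 0 ∈ A)
    (hm : p m ∈ A) (hA : ∀ i, 0 < i → i < m → p i ∉ A) (hk0 : 0 < k) (hkm : k < m) :
    e2 G A + 2 * (m - 2) + 2 * dg G (A ∪ (Finset.Ioo 0 m).image p) (p k)
        ≤ e2 G (A ∪ (Finset.Ioo 0 m).image p) ∧
      (A ∪ (Finset.Ioo 0 m).image p).card = A.card + (m - 1) := by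
  set A1 := A ∪ (Finset.Icc 1 (k - 1)).image p with hA1
  obtain ⟨h1, h1'⟩ := e2_union_chain h0 (k - 1) (fun i hi => hp.adj i (by omega))
    (fun i h1 h2 => hA i (by omega) (by omega))
    (hp.inj.mono (fun x hx => by simp at hx ⊢; omega))
  rw [← hA1] at h1 h1'
  have hr := hp.reverse
  obtain ⟨h2, h2'⟩ := e2_union_chain (G := G) (A := A1) (p := fun t => p (m - t))
    (by simp [hA1, hm]) (m - 1 - k) (fun i hi => hr.adj i (by omega))
    (fun i h1 h2 => by
      rw [hA1, Finset.mem_union, not_or]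
      refine ⟨hA _ (by omega) (by omega), ?_⟩
      simp only [Finset.mem_image, Finset.mem_Icc, not_exists, not_and]
      intro l hl e
      have := (hp.eq_iff (by omega) (by omega)).1 e
      omega)
    (hr.inj.mono (fun x hx => by simp at hx ⊢; omega))
  set A2 := A1 ∪ (Finset.Icc 1 (m - 1 - k)).image (fun t => p (m - t)) with hA2
  have e : A ∪ (Finset.Ioo 0 m).image p = insert (p k) A2 := by
    ext x
    simp only [hA2, hA1, Finset.mem_union, Finset.mem_image, Finset.mem_Ioo, Finset.mem_Icc,
      Finset.mem_insert]
    constructor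
    · rintro (h | ⟨i, hi, rfl⟩)
      · exact Or.inr (Or.inl (Or.inl h))
      · rcases lt_trichotomy i k with h | rfl | h
        · exact Or.inr (Or.inl (Or.inr ⟨i, by omega, rfl⟩))
        · exact Or.inl rfl
        · exact Or.inr (Or.inr ⟨m - i, by omega, by congr 1; omega⟩)
    · rintro (rfl | (h | ⟨i, hi, rfl⟩) | ⟨i, hi, rfl⟩)
      · exact Or.inr ⟨k, ⟨hk0, hkm⟩, rfl⟩
      · exact Or.inl h
      · exact Or.inr ⟨i, by omega, rfl⟩
      · exact Or.inr ⟨m - i, by omega, rfl⟩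
  have hnot : p k ∉ A2 := by
    simp only [hA2, hA1, Finset.mem_union, Finset.mem_image, Finset.mem_Icc]
    rintro ((h | ⟨i, hi, e⟩) | ⟨i, hi, e⟩)
    · exact hA k hk0 hkm h
    · have := (hp.eq_iff (by omega) (by omega)).1 e
      omega
    · have := (hp.eq_iff (by omega) (by omega)).1 e
      omega
  rw [e, e2_insert hnot, dg_insert_self, Finset.card_insert_of_notMem hnot]
  omega

open Classical in
theorem two_le_dg_ear {A : Finset V} {p : ℕ → V} {m k : ℕ} (hp : IsPathSeq G m p) (h0 : p 0 ∈ A)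
    (hm : p m ∈ A) (hk0 : 0 < k) (hkm : k < m) :
    2 ≤ dg G (A ∪ (Finset.Ioo 0 m).image p) (p k) := by
  have key : ∀ i ≤ m, p i ∈ A ∪ (Finset.Ioo 0 m).image p := by
    intro i hi
    rcases Nat.eq_zero_or_pos i with rfl | h1
    · exact Finset.mem_union_left _ h0
    rcases hi.eq_or_lt with rfl | h2
    · exact Finset.mem_union_left _ hm
    exact Finset.mem_union_right _ (Finset.mem_image.2 ⟨i, by simp; omega, rfl⟩)
  have h1 := (hp.adj (k - 1) (by omega)).symm
  rw [show k - 1 + 1 = k by omega] at h1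
  refine two_le_dg (key (k - 1) (by omega)) (key (k + 1) (by omega)) ?_ h1 (hp.adj k hkm)
  intro e
  have := (hp.eq_iff (by omega) (by omega)).1 e
  omega

-- An ear with m-1 interior vertices and m edges changes δ by m-(n-1); the extra term on the left
-- accounts for further edges at `p k`.
open Classical in
theorem defect_union_ear {n : ℕ} (hn : 3 ≤ n) {A : Finset V} {p : ℕ → V} {m k : ℕ}
    (hp : IsPathSeq G m p) (h0 : p 0 ∈ A)
    (hm : p m ∈ A) (hA : ∀ i, 0 < i → i < m → p i ∉ A) (hk0 : 0 < k) (hkm : k < m) :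
    defect n G (A ∪ (Finset.Ioo 0 m).image p) + 2 * ((n : ℤ) - 2) *
      (dg G (A ∪ (Finset.Ioo 0 m).image p) (p k) - 2) ≤ defect n G A + 2 * ((m : ℤ) - (n - 1)) := by
  obtain ⟨h1, h2⟩ := e2_union_ear hp h0 hm hA hk0 hkm
  unfold defect
  rw [h2]
  have h4 : (3 : ℤ) ≤ n := by exact_mod_cast hn
  have h3 : ((e2 G A : ℕ) : ℤ) + 2 * (m - 2) + 2 * (dg G (A ∪ (Finset.Ioo 0 m).image p) (p k))
      ≤ e2 G (A ∪ (Finset.Ioo 0 m).image p) := by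
    have : ((m - 2 : ℕ) : ℤ) = m - 2 := by push_cast [show 2 ≤ m by omega]; ring
    rw [← this]
    exact_mod_cast h1
  have h5 : ((A.card + (m - 1) : ℕ) : ℤ) = A.card + (m - 1) := by
    push_cast [show 1 ≤ m by omega]; ring
  rw [h5]
  nlinarith [mul_le_mul_of_nonneg_left h3 (show (0 : ℤ) ≤ n - 2 by linarith)]

/-- A path that starts and ends in `A` and leaves `A` has a segment with ends in `A` and interior
outside `A`. -/
theorem exists_segment {A : Finset V} {p : ℕ → V} {m k : ℕ} (h0 : p 0 ∈ A) (hm : p m ∈ A)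
    (hkm : k ≤ m) (hk : p k ∉ A) : ∃ i j, i < k ∧ k < j ∧ j ≤ m ∧ p i ∈ A ∧ p j ∈ A ∧
      ∀ l, i < l → l < j → p l ∉ A := by
  classical
  have hk0 : k ≠ 0 := fun e => hk (e ▸ h0)
  have hex : ∃ j, k ≤ j ∧ p j ∈ A := ⟨m, hkm, hm⟩
  set j := Nat.find hex with hj
  have hj1 := Nat.find_spec hex
  set i := Nat.findGreatest (fun t => p t ∈ A) k with hi
  have hi1 : p i ∈ A := Nat.findGreatest_spec (P := fun t => p t ∈ A) (Nat.zero_le k) h0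
  have hik : i ≤ k := Nat.findGreatest_le k
  refine ⟨i, j, ?_, ?_, Nat.find_min' hex ⟨hkm, hm⟩, hi1, hj1.2, ?_⟩
  · exact lt_of_le_of_ne hik fun e => hk (e ▸ hi1)
  · exact lt_of_le_of_ne hj1.1 fun e => hk (e ▸ hj1.2)
  · intro l h1 h2 hl
    rcases le_total l k with h | h
    · exact Nat.findGreatest_is_greatest (P := fun t => p t ∈ A) h1 h hl
    · exact Nat.find_min hex h2 ⟨h, hl⟩

-- The path is absorbed ear by ear: a segment with ends in `A` and interior outside is an ear of
-- length at most n-1, which cannot raise the defect.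
open Classical in
theorem defect_union_path_le {n : ℕ} (hn : 3 ≤ n) {p : ℕ → V} {m : ℕ} (hm : m + 1 ≤ n)
    (hp : IsPathSeq G m p) (A : Finset V) (h0 : p 0 ∈ A) (h1 : p m ∈ A) :
    defect n G (A ∪ (Finset.range (m + 1)).image p) ≤ defect n G A := by
  induction hc : ((Finset.range (m + 1)).image p \ A).card using Nat.strong_induction_on
    generalizing A with
  | _ c ih =>
    by_cases hsub : (Finset.range (m + 1)).image p ⊆ A
    · rw [Finset.union_eq_left.2 hsub]
    · obtain ⟨x, hx, hxA⟩ := Finset.not_subset.1 hsub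
      obtain ⟨k, hk, rfl⟩ := Finset.mem_image.1 hx
      rw [Finset.mem_range] at hk
      obtain ⟨i, j, hik, hkj, hjm, hi, hj, hl⟩ := exists_segment h0 h1 (by omega) hxA
      have hq := hp.sub (i := i) (k := j - i) (by omega)
      have hear := defect_union_ear (n := n) (k := k - i) hn hq (A := A) (by simpa using hi)
        (by simpa [show i + (j - i) = j by omega] using hj)
        (fun l h1 h2 => hl _ (by omega) (by omega)) (by omega) (by omega)
      have hd := two_le_dg_ear (k := k - i) hq (A := A) (by simpa using hi)
        (by simpa [show i + (j - i) = j by omega] using hj) (by omega) (by omega)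
      set B := A ∪ (Finset.Ioo 0 (j - i)).image (fun t => p (i + t)) with hB
      have hBsub : B ⊆ A ∪ (Finset.range (m + 1)).image p := by
        refine Finset.union_subset Finset.subset_union_left ?_
        intro y hy
        obtain ⟨t, ht, rfl⟩ := Finset.mem_image.1 hy
        rw [Finset.mem_Ioo] at ht
        exact Finset.mem_union_right _ (Finset.mem_image.2 ⟨i + t, by simp; omega, rfl⟩)
      have hkB : p k ∈ B := Finset.mem_union_right _ (Finset.mem_image.2
        ⟨k - i, by simp; omega, by congr 1; omega⟩)
      have hlt : ((Finset.range (m + 1)).image p \ B).card < c := by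
        rw [← hc]
        refine Finset.card_lt_card (Finset.ssubset_iff_subset_ne.2
          ⟨Finset.sdiff_subset_sdiff subset_rfl Finset.subset_union_left, fun e => ?_⟩)
        have : p k ∈ (Finset.range (m + 1)).image p \ B := by
          rw [e]; exact Finset.mem_sdiff.2 ⟨hx, hxA⟩
        exact (Finset.mem_sdiff.1 this).2 hkB
      have := ih _ hlt B (Finset.mem_union_left _ h0) (Finset.mem_union_left _ h1) rfl
      have he : B ∪ (Finset.range (m + 1)).image p = A ∪ (Finset.range (m + 1)).image p := by
        apply Finset.Subset.antisymm
        · exact Finset.union_subset hBsub Finset.subset_union_right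
        · exact Finset.union_subset_union Finset.subset_union_left subset_rfl
      rw [he] at this
      have h4 : (3 : ℤ) ≤ n := by exact_mod_cast hn
      have h5 : ((j - i : ℕ) : ℤ) ≤ n - 1 := by omega
      have h6 : (2 : ℤ) ≤ (dg G B ((fun t => p (i + t)) (k - i)) : ℕ) := by exact_mod_cast hd
      nlinarith

open Classical in
/-- If the defect of `A` is minimal among the finite sets containing `A`, then every path of length
at most `n - 1` between members of `A` either stays in `A` or is a clean arc with respect to `A`. -/
theorem clean_of_minimal {n : ℕ} (hn : 3 ≤ n) {p : ℕ → V} {m : ℕ} (hm : m + 1 ≤ n)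
    (hp : IsPathSeq G m p) {A : Finset V} (h0 : p 0 ∈ A) (h1 : p m ∈ A)
    (hmin : ∀ A', A ⊆ A' → defect n G A ≤ defect n G A') {k : ℕ} (hkm : k ≤ m) (hk : p k ∉ A) :
    m + 1 = n ∧ ∀ i, 0 < i → i < m →
      p i ∉ A ∧ dg G (A ∪ (Finset.range (m + 1)).image p) (p i) ≤ 2 := by
  obtain ⟨i, j, hik, hkj, hjm, hi, hj, hl⟩ := exists_segment h0 h1 hkm hk
  have hq := hp.sub (i := i) (k := j - i) (by omega)
  have hear : ∀ t, 0 < t → t < j - i → _ := fun t ht ht' =>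
    defect_union_ear (n := n) (k := t) hn hq (A := A) (by simpa using hi)
    (by simpa [show i + (j - i) = j by omega] using hj)
    (fun l h1 h2 => hl _ (by omega) (by omega)) ht ht'
  have hd : ∀ t, 0 < t → t < j - i → _ := fun t ht ht' =>
    two_le_dg_ear (k := t) hq (A := A) (by simpa using hi)
    (by simpa [show i + (j - i) = j by omega] using hj) ht ht'
  set B := A ∪ (Finset.Ioo 0 (j - i)).image (fun t => p (i + t)) with hB
  have hAB := hmin B Finset.subset_union_left
  have h4 : (3 : ℤ) ≤ n := by exact_mod_cast hn
  -- An ear shorter than n-1 would lower the defect strictly, so the ear is the whole path.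
  have hji : n - 1 ≤ j - i := by
    have a1 := hear (k - i) (by omega) (by omega)
    have a2 := hd (k - i) (by omega) (by omega)
    have h6 : (2 : ℤ) ≤ (dg G B ((fun t => p (i + t)) (k - i)) : ℕ) := by exact_mod_cast a2
    have : (n : ℤ) - 1 ≤ ((j - i : ℕ) : ℤ) := by nlinarith
    omega
  have hi0 : i = 0 := by omega
  have hjm' : j = m := by omega
  subst hi0 hjm'
  refine ⟨by omega, fun t ht ht' => ⟨hl t ht ht', ?_⟩⟩
  have a1 := hear t ht (by omega)
  have hBeq : B = A ∪ (Finset.range (j + 1)).image p := by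
    ext x
    simp only [hB, Finset.mem_union, Finset.mem_image, Finset.mem_Ioo, Finset.mem_range]
    constructor
    · rintro (h | ⟨a, ha, rfl⟩)
      · exact Or.inl h
      · exact Or.inr ⟨a, by omega, by simp⟩
    · rintro (h | ⟨a, ha, rfl⟩)
      · exact Or.inl h
      · rcases Nat.eq_zero_or_pos a with rfl | h2
        · exact Or.inl h0
        rcases (show a ≤ j by omega).eq_or_lt with rfl | h3
        · exact Or.inl h1
        exact Or.inr ⟨a, by omega, by simp⟩
  rw [hBeq] at a1 hAB
  simp only [Nat.zero_add, Nat.sub_zero] at a1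
  -- A third neighbour of an interior vertex would lower the defect as well.
  by_contra! hc
  have hc' : (3 : ℤ) ≤ (dg G (A ∪ (Finset.range (j + 1)).image p) (p t) : ℕ) := by exact_mod_cast hc
  have : (j : ℤ) = n - 1 := by omega
  nlinarith

/-! ### Removing loose ends and clean arcs -/

/-- The finite set `C` contains a loose end outside `T` or a clean arc whose interior lies outside
`T`. -/
def HasPiece (n : ℕ) (G : SimpleGraph V) (T : Set V) (C : Finset V) : Prop :=
  (∃ z ∈ C, z ∉ T ∧ dg G C z ≤ 1) ∨
    ∃ p : ℕ → V, IsPathSeq G (n - 1) p ∧ (∀ i ≤ n - 1, p i ∈ C) ∧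
      ∀ i, 0 < i → i < n - 1 → p i ∉ T ∧ dg G C (p i) ≤ 2

-- The first vertex removed takes at most two edges with it. Each later one has already lost the
-- edge to its predecessor and takes at most one, which makes j+1 edges for j vertices.
open Classical in
theorem e2_sdiff_chain {A : Finset V} {p : ℕ → V} {m : ℕ} (hp : IsPathSeq G m p) :
    ∀ j, j < m → (∀ i, 0 < i → i ≤ j → p i ∈ A ∧ dg G A (p i) ≤ 2) →
      e2 G A ≤ e2 G (A \ (Finset.Icc 1 j).image p) + 2 * (j + 1) ∧
        A.card = (A \ (Finset.Icc 1 j).image p).card + j := by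
  intro j
  induction j with
  | zero => intro _ _; simp
  | succ j ih =>
    intro hj hA
    obtain ⟨ih1, ih2⟩ := ih (by omega) (fun i h1 h2 => hA i h1 (by omega))
    set B := A \ (Finset.Icc 1 j).image p with hB
    have e1 : A \ (Finset.Icc 1 (j + 1)).image p = B.erase (p (j + 1)) := by
      rw [← Finset.insert_Icc_right_eq_Icc_add_one (by omega), Finset.image_insert, Finset.sdiff_insert]
    have hmem : p (j + 1) ∈ B := by
      rw [hB, Finset.mem_sdiff]
      refine ⟨(hA _ (by omega) le_rfl).1, ?_⟩
      simp only [Finset.mem_image, Finset.mem_Icc, not_exists, not_and]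
      intro i hi e
      have := (hp.eq_iff (by omega) (by omega)).1 e
      omega
    have h2 := (hA (j + 1) (by omega) le_rfl).2
    rw [e1, Finset.card_erase_of_mem hmem]
    have h3 := e2_erase (G := G) hmem
    have h4 : dg G B (p (j + 1)) ≤ 2 := (dg_mono Finset.sdiff_subset _).trans h2
    have h6 : 0 < B.card := Finset.card_pos.2 ⟨_, hmem⟩
    have h5 : j = 0 ∧ B = A ∨ 0 < j ∧ dg G B (p (j + 1)) ≤ 1 := by
      rcases Nat.eq_zero_or_pos j with h | h
      · exact Or.inl ⟨h, by simp [hB, h]⟩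
      · refine Or.inr ⟨h, ?_⟩
        have hj1 := (hA j h (by omega)).1
        have hnB : p j ∉ B := by
          rw [hB, Finset.mem_sdiff, not_and_not_right]
          intro _
          exact Finset.mem_image.2 ⟨j, by simp; omega, rfl⟩
        have : dg G (insert (p j) B) (p (j + 1)) ≤ 2 :=
          (dg_mono (Finset.insert_subset hj1 Finset.sdiff_subset) _).trans h2
        rw [dg_insert hnB, if_pos (hp.adj j (by omega)).symm] at this
        omega
    rcases h5 with ⟨h, h'⟩ | ⟨h, h'⟩
    · rw [h'] at h3 h6 h4 ih2 ⊢
      subst h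
      omega
    · omega

-- Deleting n-2 vertices together with at most n-1 edges cannot raise δ.
open Classical in
theorem sdiff_arc {n : ℕ} (hn : 3 ≤ n) {A : Finset V} {p : ℕ → V} (hp : IsPathSeq G (n - 1) p)
    (hA : ∀ i, 0 < i → i < n - 1 → p i ∈ A ∧ dg G A (p i) ≤ 2) :
    e2 G A ≤ e2 G (A \ (Finset.Ioo 0 (n - 1)).image p) + 2 * (n - 1) ∧
      A.card = (A \ (Finset.Ioo 0 (n - 1)).image p).card + (n - 2) ∧
      defect n G (A \ (Finset.Ioo 0 (n - 1)).image p) ≤ defect n G A := by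
  have e : Finset.Ioo 0 (n - 1) = Finset.Icc 1 (n - 2) := by
    ext x; simp only [Finset.mem_Ioo, Finset.mem_Icc]; omega
  obtain ⟨h1, h2⟩ := e2_sdiff_chain hp (n - 2) (by omega) (fun i h1 h2 => hA i h1 (by omega))
  rw [e]
  refine ⟨by omega, h2, ?_⟩
  unfold defect
  rw [h2]
  have h3 : (e2 G A : ℤ) ≤ e2 G (A \ (Finset.Icc 1 (n - 2)).image p) + 2 * (n - 1) := by
    have : ((n - 2 + 1 : ℕ) : ℤ) = n - 1 := by omega
    rw [← this]
    exact_mod_cast h1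
  have h5 : (((A \ (Finset.Icc 1 (n - 2)).image p).card + (n - 2) : ℕ) : ℤ)
      = (A \ (Finset.Icc 1 (n - 2)).image p).card + ((n : ℤ) - 2) := by
    push_cast [show 2 ≤ n by omega]; ring
  rw [h5]
  have h4 : (3 : ℤ) ≤ n := by exact_mod_cast hn
  nlinarith [mul_le_mul_of_nonneg_left h3 (show (0 : ℤ) ≤ n - 2 by linarith)]

open Classical in
/-- Removing pieces outside `T` step by step does not increase the defect. -/
theorem defect_filter_le {n : ℕ} (hn : 3 ≤ n) {T : Set V} (C : Finset V)
    (h : ∀ C' ⊆ C, ¬ (C' : Set V) ⊆ T → HasPiece n G T C') :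
    defect n G (C.filter (· ∈ T)) ≤ defect n G C := by
  induction hc : C.card using Nat.strong_induction_on generalizing C with
  | _ c ih =>
    by_cases hT : (C : Set V) ⊆ T
    · rw [Finset.filter_true_of_mem (fun x hx => hT hx)]
    · rcases h C subset_rfl hT with ⟨z, hz, hzT, hd⟩ | ⟨p, hp, hpC, hpi⟩
      · have h1 := ih (C.erase z).card (by rw [← hc]; exact Finset.card_erase_lt_of_mem hz) (C.erase z)
          (fun C' hC' => h C' (hC'.trans (Finset.erase_subset _ _))) rfl
        have h2 := defect_erase_lt hn hz hd
        rw [show (C.erase z).filter (· ∈ T) = C.filter (· ∈ T) by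
          ext x; simp only [Finset.mem_filter, Finset.mem_erase]
          constructor
          · rintro ⟨⟨-, h1⟩, h2⟩; exact ⟨h1, h2⟩
          · rintro ⟨h1, h2⟩; exact ⟨⟨fun e => hzT (e ▸ h2), h1⟩, h2⟩] at h1
        exact h1.trans h2.le
      · obtain ⟨-, h2, h3⟩ := sdiff_arc hn hp (A := C)
          (fun i h1 h2 => ⟨hpC i (by omega), (hpi i h1 h2).2⟩)
        have h1 := ih (C \ (Finset.Ioo 0 (n - 1)).image p).card (by omega) _
          (fun C' hC' => h C' (hC'.trans Finset.sdiff_subset)) rfl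
        rw [show (C \ (Finset.Ioo 0 (n - 1)).image p).filter (· ∈ T) = C.filter (· ∈ T) by
          ext x; simp only [Finset.mem_filter, Finset.mem_sdiff, Finset.mem_image, Finset.mem_Ioo]
          constructor
          · rintro ⟨⟨h1, -⟩, h2⟩; exact ⟨h1, h2⟩
          · rintro ⟨h1, h2⟩
            refine ⟨⟨h1, ?_⟩, h2⟩
            rintro ⟨i, hi, rfl⟩
            exact (hpi i hi.1 hi.2).1 h2] at h1
        exact h1.trans h3

end Counting

/-! ### Short paths in graphs of large girth -/

section Girth

variable {V : Type*} {G : SimpleGraph V}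

/-- Where the two paths first diverge, the edge of `p` is not used by the rest of `p` or by the rest
of `q`. A path extracted from these rests closes this edge to a cycle. -/
theorem exists_cycle_of_ne {x y : V} (p q : G.Walk x y) (hp : p.IsPath) (hq : q.IsPath)
    (hne : p ≠ q) : ∃ (a : V) (w : G.Walk a a), w.IsCycle ∧ w.length ≤ p.length + q.length := by
  classical
  induction p with
  | nil => exact absurd (SimpleGraph.Walk.isPath_iff_nil.1 hq).eq_nil.symm hne
  | @cons x z y h p' ih =>
    cases q with
    | nil => exact absurd (SimpleGraph.Walk.isPath_iff_nil.1 hp).eq_nil hne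
    | @cons _ z' _ h' q' =>
      rw [SimpleGraph.Walk.cons_isPath_iff] at hp hq
      by_cases hz : z = z'
      · subst hz
        obtain ⟨a, w, hw, hl⟩ := ih q' hp.1 hq.1 (fun e => hne (by rw [e]))
        exact ⟨a, w, hw, by simp only [SimpleGraph.Walk.length_cons]; omega⟩
      · have he : s(x, z) ∉ (p'.append (SimpleGraph.Walk.cons h' q').reverse).edges := by
          simp only [SimpleGraph.Walk.edges_append, SimpleGraph.Walk.edges_reverse,
            SimpleGraph.Walk.edges_cons, List.mem_append, List.mem_reverse, List.mem_cons, not_or]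
          refine ⟨fun e => hp.2 (SimpleGraph.Walk.fst_mem_support_of_mem_edges _ e), ?_,
            fun e => hq.2 (SimpleGraph.Walk.fst_mem_support_of_mem_edges _ e)⟩
          intro e
          rw [Sym2.eq_iff] at e
          rcases e with e | e
          · exact hz e.2
          · exact h.ne e.2.symm
        refine ⟨x, SimpleGraph.Walk.cons h
          (p'.append (SimpleGraph.Walk.cons h' q').reverse).bypass, ?_, ?_⟩
        · rw [SimpleGraph.Walk.cons_isCycle_iff]
          exact ⟨SimpleGraph.Walk.bypass_isPath _,
            fun e => he (SimpleGraph.Walk.edges_bypass_subset_edges _ e)⟩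
        · have := (p'.append (SimpleGraph.Walk.cons h' q').reverse).length_bypass_le_length
          simp only [SimpleGraph.Walk.length_append, SimpleGraph.Walk.length_reverse,
            SimpleGraph.Walk.length_cons] at this ⊢
          omega

/-- All cycles of `G` have length at least `2 n`. -/
def LargeGirth (n : ℕ) (G : SimpleGraph V) : Prop :=
  ∀ (a : V) (w : G.Walk a a), w.IsCycle → 2 * n ≤ w.length

theorem LargeGirth.path_unique {n : ℕ} (hg : LargeGirth n G) {x y : V} {p q : G.Walk x y}
    (hp : p.IsPath) (hq : q.IsPath) (hl : p.length + q.length < 2 * n) : p = q := by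
  by_contra hne
  obtain ⟨a, w, hw, hwl⟩ := exists_cycle_of_ne p q hp hq hne
  have := hg a w hw
  omega

theorem exists_walk_of_adj (m : ℕ) (p : ℕ → V) (h : ∀ i < m, G.Adj (p i) (p (i + 1))) :
    ∃ w : G.Walk (p 0) (p m), w.length = m ∧ ∀ i ≤ m, w.getVert i = p i := by
  induction m generalizing p with
  | zero => exact ⟨.nil, rfl, fun i hi => by simp [Nat.le_zero.1 hi]⟩
  | succ m ih =>
    obtain ⟨w, hw, hv⟩ := ih (fun i => p (i + 1)) (fun i hi => h (i + 1) (by omega))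
    refine ⟨.cons (h 0 (by omega)) w, by simp [hw], fun i hi => ?_⟩
    cases i with
    | zero => simp
    | succ i => simpa using hv i (by omega)

theorem IsPathSeq.exists_walk {m : ℕ} {p : ℕ → V} (hp : IsPathSeq G m p) :
    ∃ w : G.Walk (p 0) (p m), w.IsPath ∧ w.length = m ∧ ∀ i ≤ m, w.getVert i = p i := by
  obtain ⟨w, hw, hv⟩ := exists_walk_of_adj m p hp.adj
  refine ⟨w, ?_, hw, hv⟩
  rw [← SimpleGraph.Walk.IsPath.getVert_injOn_iff]
  intro i hi j hj e
  simp only [Set.mem_ofPred_eq, hw] at hi hj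
  rw [hv i hi, hv j hj] at e
  exact hp.inj hi hj e

theorem isPathSeq_getVert {x y : V} {w : G.Walk x y} (hw : w.IsPath) :
    IsPathSeq G w.length w.getVert where
  adj _ hi := w.adj_getVert_succ hi
  inj := hw.getVert_injOn

theorem LargeGirth.pathSeq_unique {n : ℕ} (hg : LargeGirth n G) {m k : ℕ} {p q : ℕ → V}
    (hp : IsPathSeq G m p) (hq : IsPathSeq G k q) (h0 : p 0 = q 0) (h1 : p m = q k)
    (hl : m + k < 2 * n) : m = k ∧ ∀ i ≤ m, p i = q i := by
  obtain ⟨w, hw, hwl, hwv⟩ := hp.exists_walk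
  obtain ⟨w', hw', hwl', hwv'⟩ := hq.exists_walk
  have e := hg.path_unique (p := w) (q := w'.copy h0.symm h1.symm) hw (by simpa using hw')
    (by simp [hwl, hwl', hl])
  have hmk : m = k := by rw [← hwl, ← hwl', e]; simp
  refine ⟨hmk, fun i hi => ?_⟩
  rw [← hwv i hi, ← hwv' i (by omega), e]
  simp

/-- Non-backtracking walks of length less than the girth are paths. -/
theorem LargeGirth.isPathSeq {n : ℕ} (hg : LargeGirth n G) (m : ℕ) (f : ℕ → V)
    (hadj : ∀ i < m, G.Adj (f i) (f (i + 1))) (hnb : ∀ i, i + 2 ≤ m → f i ≠ f (i + 2))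
    (hm : m < 2 * n) : IsPathSeq G m f := by
  induction m generalizing f with
  | zero => exact ⟨hadj, fun a ha b hb _ => by simp at ha hb; omega⟩
  | succ m ih =>
    have h1 := ih f (fun i hi => hadj i (by omega)) (fun i hi => hnb i (by omega)) (by omega)
    have h2 := ih (fun i => f (i + 1)) (fun i hi => hadj (i + 1) (by omega))
      (fun i hi => hnb (i + 1) (by omega)) (by omega)
    -- If the sequence closed up, its first m steps and its last edge reversed would be two paths
    -- with the same ends and total length m+1 < 2n. Uniqueness forces m = 1, which is backtracking.
    have key : f 0 ≠ f (m + 1) := by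
      intro e
      have ha := hadj m (by omega)
      rw [← e] at ha
      have hq : IsPathSeq G 1 (fun i => if i = 0 then f 0 else f m) := by
        refine ⟨fun i hi => ?_, fun a ha' b hb' e' => ?_⟩
        · obtain rfl : i = 0 := by omega
          simpa using ha.symm
        · simp only [Set.mem_Iic] at ha' hb'
          by_cases h : a = 0 <;> by_cases h' : b = 0 <;> simp only [h, h', if_true, if_false] at e' ⊢
          · exact absurd e' ha.ne'
          · exact absurd e' ha.ne
          · omega
      have h3 := hg.pathSeq_unique h1 hq (by simp) (by simp) (by omega)
      have := hnb 0 (by omega)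
      exact this (by rw [e, h3.1])
    refine ⟨hadj, fun a ha b hb e => ?_⟩
    simp only [Set.mem_Iic] at ha hb
    rcases Nat.eq_zero_or_pos a with rfl | ha0
    · rcases hb.eq_or_lt with rfl | hb'
      · exact absurd e key
      · exact h1.inj (by simp) (by simp; omega) e
    · rcases Nat.eq_zero_or_pos b with rfl | hb0
      · rcases ha.eq_or_lt with rfl | ha'
        · exact absurd e.symm key
        · exact h1.inj (by simp; omega) (by simp) e
      · have := (h2.eq_iff (i := a - 1) (j := b - 1) (by omega) (by omega)).1
          (by simpa [Nat.sub_add_cancel ha0, Nat.sub_add_cancel hb0] using e)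
        omega

/-- Iterate (u, v) ↦ (v, w) on pairs of consecutive vertices, with w a neighbour of v in `A` other
than u. -/
theorem exists_nonbacktracking {A : Set V} (hA : ∀ a ∈ A, ∀ b, ∃ c ∈ A, c ≠ b ∧ G.Adj a c)
    {u v : V} (hu : u ∈ A) (hv : v ∈ A) (huv : G.Adj u v) :
    ∃ f : ℕ → V, f 0 = u ∧ f 1 = v ∧ (∀ i, f i ∈ A) ∧ (∀ i, G.Adj (f i) (f (i + 1))) ∧
      ∀ i, f i ≠ f (i + 2) := by
  choose! g hg using hA
  let s : ℕ → V × V := fun i => Nat.rec (u, v) (fun _ x => (x.2, g x.2 x.1)) i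
  have hs : ∀ i, (s i).1 ∈ A ∧ (s i).2 ∈ A ∧ G.Adj (s i).1 (s i).2 := by
    intro i
    induction i with
    | zero => exact ⟨hu, hv, huv⟩
    | succ i ih =>
      have := hg _ ih.2.1 (s i).1
      exact ⟨ih.2.1, this.1, this.2.2⟩
  refine ⟨fun i => (s i).1, rfl, rfl, fun i => (hs i).1, fun i => (hs i).2.2, fun i => ?_⟩
  exact (hg _ (hs i).2.1 (s i).1).2.1.symm

end Girth

/-! ### A lower bound for the defect -/

section LowerBound

variable {V : Type*} {G : SimpleGraph V}

open Classical in
/-- A finite graph of girth at least `2 n` and minimal valency at least `2` which has a vertex of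
valency at least `3` and at most `3 n - 1` vertices consists of three paths of length `n` with
common ends. -/
theorem theta_graph {n : ℕ} (hn : 3 ≤ n) (hg : LargeGirth n G) {A : Finset V}
    (hdeg : ∀ v ∈ A, 2 ≤ dg G A v) {u : V} (hu : u ∈ A) (hu3 : 3 ≤ dg G A u)
    (hcard : A.card ≤ 3 * n - 1) :
    A.card = 3 * n - 1 ∧ ∀ x ∈ A, ∀ y ∈ A, ∃ w : G.Walk x y, w.length ≤ n ∧
      ∀ z ∈ w.support, z ∈ A := by
  obtain ⟨a, b, c, ha, hb, hc, hab, hac, hbc⟩ := Finset.two_lt_card_iff.1 hu3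
  rw [Finset.mem_filter] at ha hb hc
  have hv : ∃ v : Fin 3 → V, Function.Injective v ∧ ∀ k, v k ∈ A ∧ G.Adj u (v k) := by
    refine ⟨![a, b, c], ?_, ?_⟩
    · intro i j h
      fin_cases i <;> fin_cases j <;> simp_all
    · intro k
      fin_cases k <;> simp [ha, hb, hc]
  obtain ⟨v, hvinj, hvA⟩ := hv
  have hex : ∀ k, ∃ f : ℕ → V, f 0 = u ∧ f 1 = v k ∧ (∀ i, f i ∈ A) ∧
      (∀ i, G.Adj (f i) (f (i + 1))) ∧ ∀ i, f i ≠ f (i + 2) := fun k =>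
    exists_nonbacktracking (A := (A : Set V))
      (fun x hx y => by simpa using exists_of_two_le_dg (hdeg x hx) y) hu (hvA k).1 (hvA k).2
  choose F hF0 hF1 hFA hFadj hFnb using hex
  have hp : ∀ k, IsPathSeq G (2 * n - 1) (F k) := fun k =>
    hg.isPathSeq _ _ (fun i _ => hFadj k i) (fun i _ => hFnb k i) (by omega)
  -- Two branches cannot meet early: running back along branch k to `u` and out along branch l is
  -- nonbacktracking, hence a path as long as i + j < 2n.
  have hd : ∀ k l i j, k ≠ l → i + j < 2 * n → F k i = F l j → i + j = 0 := by
    intro k l i j hkl hij e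
    have := hg.isPathSeq (i + j) (fun t => if t ≤ i then F k (i - t) else F l (t - i)) ?_ ?_ hij
    · have h0 := (this.eq_iff (i := 0) (j := i + j) (by omega) le_rfl).1 ?_
      · omega
      · rcases Nat.eq_zero_or_pos j with rfl | hj
        · simp [e, hF0]
        · simp [show ¬ (i + j ≤ i) by omega, e]
    · intro t ht
      rcases lt_trichotomy t i with h | rfl | h
      · have := (hFadj k (i - (t + 1))).symm
        rw [show i - (t + 1) + 1 = i - t by omega] at this
        simpa [h.le, show t + 1 ≤ i by omega] using this
      · have := hFadj l 0
        rw [hF0] at this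
        simpa [hF0] using this
      · have := hFadj l (t - i)
        simpa [show ¬ t ≤ i by omega, show ¬ t + 1 ≤ i by omega,
          show t + 1 - i = t - i + 1 by omega] using this
    · intro t ht
      by_cases h1 : t + 2 ≤ i
      · have := (hFnb k (i - (t + 2))).symm
        rw [show i - (t + 2) + 2 = i - t by omega] at this
        simpa [h1, show t ≤ i by omega] using this
      · by_cases h2 : i < t
        · have := hFnb l (t - i)
          simpa [h1, show ¬ t ≤ i by omega, show t + 2 - i = t - i + 2 by omega] using this
        · by_cases h3 : t = i
          · subst h3
            have := hFnb l 0
            rw [hF0] at this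
            simpa [hF0] using this
          · obtain rfl : i = t + 1 := by omega
            simp only [show t ≤ t + 1 by omega, if_true, show ¬ (t + 2 ≤ t + 1) by omega, if_false,
              show t + 1 - t = 1 by omega, show t + 2 - (t + 1) = 1 by omega, hF1]
            exact fun e => hkl (hvinj e)
  -- The vertex `u` and the positions 1, …, n-1 of the three branches are 3n-2 distinct vertices.
  set S : Finset V := insert u
    ((Finset.univ ×ˢ Finset.Icc 1 (n - 1)).image (fun x : Fin 3 × ℕ => F x.1 x.2)) with hS
  have hScard : S.card = 3 * n - 2 := by
    rw [hS, Finset.card_insert_of_notMem, Finset.card_image_of_injOn]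
    · simp; omega
    · rintro ⟨k, i⟩ h ⟨l, j⟩ h' e
      simp at h h' e
      by_cases hkl : k = l
      · subst hkl
        have := ((hp k).eq_iff (by omega) (by omega)).1 e
        simp [this]
      · have := hd k l i j hkl (by omega) e
        omega
    · simp only [Finset.mem_image, Finset.mem_product, Finset.mem_univ, true_and, Finset.mem_Icc,
        Prod.exists, not_exists, not_and]
      rintro k i hi e
      rw [← hF0 k] at e
      have := ((hp k).eq_iff (by omega) (by omega)).1 e
      omega
  have hnS : ∀ k, F k n ∉ S := by
    intro k
    rw [hS, Finset.mem_insert, not_or]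
    refine ⟨fun e => ?_, ?_⟩
    · rw [← hF0 k] at e
      have := ((hp k).eq_iff (by omega) (by omega)).1 e
      omega
    · simp only [Finset.mem_image, Finset.mem_product, Finset.mem_univ, true_and, Finset.mem_Icc,
        Prod.exists, not_exists, not_and]
      rintro l i hi e
      by_cases hkl : l = k
      · subst hkl
        have := ((hp l).eq_iff (by omega) (by omega)).1 e
        omega
      · have := hd l k i n hkl (by omega) e
        omega
  have hSA : insert (F 0 n) S ⊆ A := by
    rw [hS]
    refine Finset.insert_subset (hFA _ _) (Finset.insert_subset hu ?_)
    intro x hx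
    obtain ⟨y, -, rfl⟩ := Finset.mem_image.1 hx
    exact hFA _ _
  have hSc : (insert (F 0 n) S).card = 3 * n - 1 := by
    rw [Finset.card_insert_of_notMem (hnS 0), hScard]; omega
  have hAeq := Finset.eq_of_subset_of_card_le hSA (by omega)
  refine ⟨by rw [← hAeq, hSc], ?_⟩
  -- The cardinality leaves room for a single vertex outside `S`, so the three branches meet after n
  -- steps.
  have hend : ∀ k, F k n = F 0 n := by
    intro k
    have : F k n ∈ insert (F 0 n) S := hAeq ▸ hFA k n
    rw [Finset.mem_insert] at this
    exact this.resolve_right (hnS k)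
  have hpar : ∀ x ∈ A, ∃ k i, i ≤ n ∧ x = F k i := by
    intro x hx
    rw [← hAeq, hS, Finset.mem_insert, Finset.mem_insert] at hx
    rcases hx with rfl | rfl | hx
    · exact ⟨0, n, le_rfl, rfl⟩
    · exact ⟨0, 0, by omega, (hF0 0).symm⟩
    · simp only [Finset.mem_image, Finset.mem_product, Finset.mem_univ, true_and, Finset.mem_Icc,
        Prod.exists] at hx
      obtain ⟨k, i, hi, rfl⟩ := hx
      exact ⟨k, i, by omega, rfl⟩
  have hwalk : ∀ k i m, ∃ w : G.Walk (F k i) (F k (i + m)), w.length = m ∧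
      ∀ z ∈ w.support, z ∈ A := by
    intro k i m
    obtain ⟨w, hw, hwv⟩ := exists_walk_of_adj m (fun t => F k (i + t)) (fun t _ => hFadj k (i + t))
    refine ⟨w, hw, fun z hz => ?_⟩
    obtain ⟨t, ht, htl⟩ := SimpleGraph.Walk.mem_support_iff_exists_getVert.1 hz
    rw [← ht, hwv t (by omega)]
    exact hFA _ _
  intro x hx y hy
  obtain ⟨k, i, hi, rfl⟩ := hpar x hx
  obtain ⟨l, j, hj, rfl⟩ := hpar y hy
  -- Pass through the common start `u` in this case and through the common end otherwise, at cost
  -- (n-i) + (n-j) ≤ n.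
  by_cases hij : i + j ≤ n
  · obtain ⟨w, hw, hwA⟩ := hwalk k 0 i
    obtain ⟨w', hw', hwA'⟩ := hwalk l 0 j
    refine ⟨(w.reverse.append (w'.copy ((hF0 l).trans (hF0 k).symm) rfl)).copy
      (by simp) (by simp), by simp; omega, ?_⟩
    intro z hz
    simp only [SimpleGraph.Walk.support_copy, SimpleGraph.Walk.mem_support_append_iff,
      SimpleGraph.Walk.support_reverse, List.mem_reverse] at hz
    exact hz.elim (hwA z) (hwA' z)
  · obtain ⟨w, hw, hwA⟩ := hwalk k i (n - i)
    obtain ⟨w', hw', hwA'⟩ := hwalk l j (n - j)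
    have e : F l (j + (n - j)) = F k (i + (n - i)) := by
      rw [show j + (n - j) = n by omega, show i + (n - i) = n by omega, hend, hend k]
    refine ⟨w.append (w'.copy rfl e).reverse, by simp; omega, ?_⟩
    intro z hz
    simp only [SimpleGraph.Walk.support_copy, SimpleGraph.Walk.mem_support_append_iff,
      SimpleGraph.Walk.support_reverse, List.mem_reverse] at hz
    exact hz.elim (hwA z) (hwA' z)

/-- Discarding a vertex of valency at most one does not reduce the surplus of edges over vertices.
-/
theorem exists_core (A : Finset V) (h : 2 * A.card + 2 ≤ e2 G A) :
    ∃ B ⊆ A, 2 * B.card + 2 ≤ e2 G B ∧ ∀ v ∈ B, 2 ≤ dg G B v := by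
  classical
  induction A using Finset.strongInduction with
  | _ A ih =>
    by_cases hA : ∀ v ∈ A, 2 ≤ dg G A v
    · exact ⟨A, subset_rfl, h, hA⟩
    · push Not at hA
      obtain ⟨v, hv, hd⟩ := hA
      have h1 := e2_erase (G := G) hv
      have h2 := Finset.card_erase_of_mem hv
      have h3 := Finset.card_pos.2 ⟨v, hv⟩
      obtain ⟨B, hB, hB'⟩ := ih _ (Finset.erase_ssubset hv) (by omega)
      exact ⟨B, hB.trans (Finset.erase_subset _ _), hB'⟩

/-- Strip pieces by induction. Loose ends preserve surplus at least 2 and lower the defect. The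
critical case is a clean arc whose removal leaves surplus 1. If the defect is too small, the
remainder has at most 3n-1 vertices and, by `theta_graph`, any two of its vertices are joined inside
it by a walk of length at most n. By the girth the arc of length n-1 is contained in such a walk,
although its interior has been removed. -/
theorem defect_ge_of_open {n : ℕ} (hn : 3 ≤ n) (hg : LargeGirth n G)
    (hop : ∀ A : Finset V, A.Nonempty → HasPiece n G ∅ A) (A : Finset V)
    (hA : 2 * A.card + 4 ≤ e2 G A) : 4 * (n : ℤ) + 4 ≤ defect n G A := by
  classical
  induction hc : A.card using Nat.strong_induction_on generalizing A with
  | _ c ih =>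
    by_contra! hlt
    have hne : A.Nonempty := by
      rw [Finset.nonempty_iff_ne_empty]
      rintro rfl
      simp [e2_empty] at hA
    rcases hop A hne with ⟨z, hz, -, hd⟩ | ⟨p, hp, hpA, hpi⟩
    · have h1 := e2_erase (G := G) hz
      have h2 := Finset.card_erase_of_mem hz
      have h3 := Finset.card_pos.2 hne
      have h4 := ih _ (by omega) (A.erase z) (by omega) rfl
      have h5 := defect_erase_lt hn hz hd
      omega
    · obtain ⟨h1, h2, h3⟩ := sdiff_arc hn hp (A := A)
        (fun i h1 h2 => ⟨hpA i (by omega), (hpi i h1 h2).2⟩)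
      set A' := A \ (Finset.Ioo 0 (n - 1)).image p with hA'
      have hlt' : e2 G A' ≤ 2 * A'.card + 2 := by
        by_contra! hcon
        obtain ⟨r, hr⟩ := even_e2 (G := G) A'
        have h4 := ih _ (by omega) A' (by omega) rfl
        omega
      -- Surplus at most 1 gives `defect` at least 2|A'| - 2(n-2), so 2|A'| ≤ 6n-1.
      have hcard : A'.card ≤ 3 * n - 1 := by
        have h5 : (e2 G A' : ℤ) ≤ 2 * A'.card + 2 := by exact_mod_cast hlt'
        have h6 : defect n G A' ≤ 4 * n + 3 := by omega
        unfold defect at h6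
        have h7 : (3 : ℤ) ≤ n := by exact_mod_cast hn
        have h8 : (A'.card : ℤ) * 2 ≤ 6 * n - 1 := by
          nlinarith [mul_le_mul_of_nonneg_left h5 (show (0 : ℤ) ≤ n - 2 by linarith)]
        omega
      obtain ⟨B, hBA, hB2, hBd⟩ := exists_core (G := G) A' (by omega)
      have hex : ∃ u ∈ B, 3 ≤ dg G B u := by
        by_contra! hcon
        have : e2 G B ≤ B.card • 2 := Finset.sum_le_card_nsmul _ _ _ fun x hx => by
          have := hcon x hx
          omega
        simp at this
        omega
      obtain ⟨u, hu, hu3⟩ := hex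
      have hBc := Finset.card_le_card hBA
      obtain ⟨hB1, hB3⟩ := theta_graph hn hg hBd hu hu3 (by omega)
      have hBeq := Finset.eq_of_subset_of_card_le hBA (by omega)
      rw [hBeq] at hB3
      have hends : ∀ i ≤ n - 1, i = 0 ∨ i = n - 1 → p i ∈ A' := by
        intro i hi hi'
        rw [hA', Finset.mem_sdiff]
        refine ⟨hpA i hi, ?_⟩
        simp only [Finset.mem_image, Finset.mem_Ioo, not_exists, not_and]
        intro j hj e
        have := (hp.eq_iff (by omega) hi).1 e
        omega
      obtain ⟨w, hw, hwA⟩ := hB3 _ (hends 0 (by omega) (by simp)) _ (hends (n - 1) le_rfl (by simp))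
      have hbl := w.length_bypass_le_length
      have := hg.pathSeq_unique hp (isPathSeq_getVert w.bypass_isPath) (by simp) (by simp) (by omega)
      have h1' := this.2 1 (by omega)
      have hmem : p 1 ∈ A' := by
        rw [h1']
        exact hwA _ (w.support_bypass_subset_support (SimpleGraph.Walk.getVert_mem_support _ _))
      rw [hA', Finset.mem_sdiff] at hmem
      exact hmem.2 (Finset.mem_image.2 ⟨1, by simp; omega, rfl⟩)

theorem defect_nonneg_of_open {n : ℕ} (hn : 3 ≤ n)
    (hop : ∀ A : Finset V, A.Nonempty → HasPiece n G ∅ A) (A : Finset V) :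
    0 ≤ defect n G A := by
  classical
  have := defect_filter_le hn (T := ∅) A (fun C _ hC => hop C (by
    rw [Finset.nonempty_iff_ne_empty]; rintro rfl; simp at hC))
  simpa [defect, e2_empty] using this

/-- In an open graph of girth at least `2 n`, every finite set that contains a subset with at least
two more edges than vertices has defect at least that of a path of length `n + 3`. -/
theorem defect_ge_of_subset {n : ℕ} (hn : 3 ≤ n) (hg : LargeGirth n G)
    (hop : ∀ A : Finset V, A.Nonempty → HasPiece n G ∅ A) {A B : Finset V} (hBA : B ⊆ A)
    (hB : 2 * B.card + 4 ≤ e2 G B) : 4 * (n : ℤ) + 4 ≤ defect n G A := by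
  classical
  induction hc : A.card - B.card using Nat.strong_induction_on generalizing B with
  | _ c ih =>
    -- Vertices of `A` adjacent to `B` are absorbed into `B`, which does not reduce its surplus.
    -- When none is left, no edge joins `B` to `A \ B`, and the defect is additive with a
    -- nonnegative second summand.
    by_cases hex : ∃ v ∈ A, v ∉ B ∧ 1 ≤ dg G B v
    · obtain ⟨v, hv, hvB, hd⟩ := hex
      have h1 := e2_insert (G := G) hvB
      have h2 := Finset.card_insert_of_notMem hvB
      have h3 := Finset.card_le_card (Finset.insert_subset hv hBA)
      exact ih _ (by omega) (Finset.insert_subset hv hBA) (by omega) rfl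
    · push Not at hex
      have h1 := e2_union (G := G) (A := B) (B := A \ B) Finset.disjoint_sdiff (fun a ha b hb hab => by
        rw [Finset.mem_sdiff] at hb
        have := hex b hb.1 hb.2
        have := one_le_dg ha hab.symm
        omega)
      have h2 := Finset.card_sdiff_add_card_eq_card hBA
      rw [Finset.union_sdiff_of_subset hBA] at h1
      have h3 := defect_nonneg_of_open hn hop (A \ B)
      have h4 := defect_ge_of_open hn hg hop B hB
      unfold defect at h3 h4 ⊢
      rw [h1, ← h2]
      push_cast
      linarith

end LowerBound

/-! ### Generalized polygons -/

section Criterion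

variable {V : Type*} {G : SimpleGraph V}

/-- In a bipartite graph all walks between two given vertices have lengths of the same parity, and
here n has the wrong one. -/
theorem exists_short_path {n : ℕ} (hb : G.IsBipartite)
    (hd : ∀ x y : V, ∃ w : G.Walk x y, w.length ≤ n) {x y : V} (w₀ : G.Walk x y)
    (hodd : Odd (w₀.length + n)) : ∃ w : G.Walk x y, w.IsPath ∧ w.length + 1 ≤ n := by
  classical
  obtain ⟨c⟩ := hb
  let c' : G.Coloring Bool := SimpleGraph.Coloring.mk (fun v => decide (c v = 0)) (by
    intro v w h
    have := c.valid h
    revert this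
    generalize c v = a
    generalize c w = b
    revert a b
    decide)
  obtain ⟨w, hw⟩ := hd x y
  refine ⟨w.bypass, w.bypass_isPath, ?_⟩
  have hl := w.length_bypass_le_length
  have h1 := c'.even_length_iff_congr w.bypass
  have h2 := c'.even_length_iff_congr w₀
  have h3 := h1.trans h2.symm
  rcases (show w.bypass.length ≤ n by omega).eq_or_lt with h | h
  · rw [h] at h3
    rw [Nat.odd_add'] at hodd
    rcases Nat.even_or_odd n with he | ho
    · exact absurd he (Nat.not_even_iff_odd.2 (hodd.2 (h3.1 he)))
    · exact absurd (h3.2 (hodd.1 ho)) (Nat.not_even_iff_odd.2 ho)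
  · exact h

theorem exists_ne_of_two_le {v : V} (h : 2 ≤ (G.neighborSet v).encard) (b : V) :
    ∃ c, c ≠ b ∧ G.Adj v c := by
  have h1 : 1 < (G.neighborSet v).encard := lt_of_lt_of_le (by norm_num) h
  obtain ⟨x, y, hx, hy, hxy⟩ := Set.one_lt_encard_iff.1 h1
  by_cases hxb : x = b
  · exact ⟨y, fun e => hxy (hxb.trans e.symm), hy⟩
  · exact ⟨x, hxb, hx⟩

theorem exists_nonbacktracking' (hmin : ∀ v, 2 ≤ (G.neighborSet v).encard) {u v : V}
    (huv : G.Adj u v) : ∃ f : ℕ → V, f 0 = u ∧ f 1 = v ∧ (∀ i, G.Adj (f i) (f (i + 1))) ∧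
      ∀ i, f i ≠ f (i + 2) := by
  obtain ⟨f, h0, h1, -, h2⟩ := exists_nonbacktracking (G := G) (A := Set.univ) (u := u) (v := v)
    (fun a _ b => by
      obtain ⟨c, h1, h2⟩ := exists_ne_of_two_le (hmin a) b
      exact ⟨c, trivial, h1, h2⟩) trivial trivial huv
  exact ⟨f, h0, h1, h2⟩

/-- A nonbacktracking walk of length n is a path without a shorter rival, which gives the diameter.
Continued by one step, it has ends that are also joined by a path of length at most n-1, which
closes a cycle of length at most 2n. -/
theorem isGeneralizedPolygon_of [Nonempty V] {n : ℕ} (hn : 3 ≤ n) (hb : G.IsBipartite)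
    (hd : ∀ x y : V, ∃ w : G.Walk x y, w.length ≤ n) (hg : LargeGirth n G)
    (ht : ∀ v : V, 3 ≤ (G.neighborSet v).encard) : IsGeneralizedPolygon n G := by
  classical
  have hmin : ∀ v, 2 ≤ (G.neighborSet v).encard := fun v => le_trans (by norm_num) (ht v)
  obtain ⟨u⟩ := ‹Nonempty V›
  obtain ⟨v, -, huv⟩ := exists_ne_of_two_le (hmin u) u
  obtain ⟨f, -, -, hadj, hnb⟩ := exists_nonbacktracking' hmin huv
  have hf : ∀ m < 2 * n, IsPathSeq G m f := fun m hm =>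
    hg.isPathSeq m f (fun i _ => hadj i) (fun i _ => hnb i) hm
  refine ⟨hb, le_antisymm ?_ ?_, le_antisymm ?_ ?_, ht⟩
  · rw [SimpleGraph.ediam_le_iff]
    intro x y
    obtain ⟨w, hw⟩ := hd x y
    exact (SimpleGraph.edist_le w).trans (by exact_mod_cast hw)
  · refine le_trans ?_ (SimpleGraph.edist_le_ediam (u := f 0) (v := f n))
    obtain ⟨w₀, -⟩ := hd (f 0) (f n)
    obtain ⟨w, hw⟩ := (SimpleGraph.Walk.reachable w₀).exists_walk_length_eq_edist
    rw [← hw]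
    by_contra! hlt
    have hlt' : w.length < n := by exact_mod_cast hlt
    have hl := w.length_bypass_le_length
    have := hg.pathSeq_unique (hf n (by omega)) (isPathSeq_getVert w.bypass_isPath) (by simp)
      (by simp) (by omega)
    omega
  · obtain ⟨w₁, hw₁, hl₁, -⟩ := (hf (n + 1) (by omega)).exists_walk
    obtain ⟨w, hw, hwl⟩ := exists_short_path hb hd w₁ (by rw [hl₁]; exact ⟨n, by ring⟩)
    obtain ⟨a, z, hz, hzl⟩ := exists_cycle_of_ne w₁ w hw₁ hw (fun e => by rw [← e] at hwl; omega)
    exact (SimpleGraph.egirth_le_length hz).trans (by exact_mod_cast (by omega))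
  · rw [SimpleGraph.le_egirth]
    intro a w hw
    exact_mod_cast hg a w hw

/-- Opposite vertices have the same valency. -/
theorem encard_neighborSet_le_of_opposite {n : ℕ} (hn : 3 ≤ n) (hb : G.IsBipartite)
    (hd : ∀ x y : V, ∃ w : G.Walk x y, w.length ≤ n) (hg : LargeGirth n G) {f : ℕ → V}
    (hf : IsPathSeq G n f) :
    (G.neighborSet (f 0)).encard ≤ (G.neighborSet (f n)).encard := by
  classical
  -- By parity a neighbour u of `f 0` is joined to `f n` by a path of length at most n-1. Since `f
  -- 0` has distance n from `f n`, prefixing `f 0` gives a path of length exactly n.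
  have key : ∀ u ∈ G.neighborSet (f 0), ∃ q : ℕ → V, IsPathSeq G n q ∧ q 0 = f 0 ∧ q 1 = u ∧
      q n = f n := by
    intro u hu
    rw [SimpleGraph.mem_neighborSet] at hu
    obtain ⟨w₁, hw₁, hl₁, -⟩ := hf.exists_walk
    obtain ⟨w, hw, hwl⟩ := exists_short_path hb hd (.cons hu.symm w₁)
      (by rw [SimpleGraph.Walk.length_cons, hl₁]; exact ⟨n, by ring⟩)
    have hmin : ∀ w' : G.Walk (f 0) (f n), n ≤ w'.length := by
      intro w'
      by_contra! hlt
      have hl := w'.length_bypass_le_length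
      have := hg.pathSeq_unique hf (isPathSeq_getVert w'.bypass_isPath) (by simp) (by simp)
        (by omega)
      omega
    have h0 : f 0 ∉ w.support := by
      intro h
      have h1 := hmin (w.dropUntil _ h)
      have h2 := w.length_dropUntil_le_length h
      omega
    have hp : (SimpleGraph.Walk.cons hu w).IsPath := SimpleGraph.Walk.cons_isPath_iff _ _ |>.2 ⟨hw, h0⟩
    have hlen : (SimpleGraph.Walk.cons hu w).length = n := by
      have := hmin (.cons hu w)
      simp only [SimpleGraph.Walk.length_cons] at this ⊢
      omega
    have hps := isPathSeq_getVert hp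
    rw [hlen] at hps
    refine ⟨_, hps, by simp, by simp, ?_⟩
    have := (SimpleGraph.Walk.cons hu w).getVert_length
    rwa [hlen] at this
  choose! q hq using key
  -- A neighbour of `f 0` is sent to the penultimate vertex of its path; uniqueness of paths of
  -- length n-1 starting at `f 0` makes this injective.
  refine Set.encard_le_encard_of_injOn (f := fun u => q u (n - 1)) ?_ ?_
  · intro u hu
    obtain ⟨h1, h2, h3, h4⟩ := hq u hu
    have := (h1.adj (n - 1) (by omega)).symm
    rw [show n - 1 + 1 = n by omega, h4] at this
    exact this
  · intro u hu u' hu' e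
    obtain ⟨h1, h2, h3, h4⟩ := hq u hu
    obtain ⟨h1', h2', h3', h4'⟩ := hq u' hu'
    have a := h1.sub (i := 0) (k := n - 1) (by omega)
    have a' := h1'.sub (i := 0) (k := n - 1) (by omega)
    simp only [Nat.zero_add] at a a'
    have := (hg.pathSeq_unique a a' (h2.trans h2'.symm) e (by omega)).2 1 (by omega)
    rw [← h3, ← h3', this]

/-- Let q, r be neighbours of p and w a third one. A nonbacktracking walk starting p, w, … reaches
after n-1 steps a vertex opposite to both q and r, so these have equal valency. Hence an adjacent
pair of vertices of valency at least 3 propagates this property along every walk. -/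
theorem thick_of_adj {n : ℕ} (hn : 3 ≤ n) (hb : G.IsBipartite)
    (hd : ∀ x y : V, ∃ w : G.Walk x y, w.length ≤ n) (hg : LargeGirth n G)
    (hmin : ∀ v, 2 ≤ (G.neighborSet v).encard) {p q : V} (hpq : G.Adj p q)
    (hp : 3 ≤ (G.neighborSet p).encard) (hq : 3 ≤ (G.neighborSet q).encard) (v : V) :
    3 ≤ (G.neighborSet v).encard := by
  have step : ∀ p q r : V, G.Adj p q → G.Adj p r → 3 ≤ (G.neighborSet p).encard →
      3 ≤ (G.neighborSet q).encard → 3 ≤ (G.neighborSet r).encard := by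
    intro p q r hpq hpr hp hq
    have hw : ∃ w, w ≠ q ∧ w ≠ r ∧ G.Adj p w := by
      by_contra! hcon
      have hsub : G.neighborSet p ⊆ {q, r} := by
        intro x hx
        by_contra hx'
        simp only [Set.mem_insert_iff, Set.mem_singleton_iff, not_or] at hx'
        exact hcon x hx'.1 hx'.2 hx
      have h2 : ({q, r} : Set V).encard ≤ 2 :=
        (Set.encard_insert_le _ _).trans (by rw [Set.encard_singleton]; norm_num)
      have := (hp.trans (Set.encard_le_encard hsub)).trans h2
      norm_num at this
    obtain ⟨w, hwq, hwr, hw⟩ := hw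
    obtain ⟨f, h0, h1, hadj, hnb⟩ := exists_nonbacktracking' hmin hw
    have hpath : ∀ s, s ≠ w → G.Adj p s → IsPathSeq G n (fun t => if t = 0 then s else f (t - 1)) := by
      intro s hs hps
      refine hg.isPathSeq n _ ?_ ?_ (by omega)
      · intro i _
        rcases i with _ | i
        · simpa [h0] using hps.symm
        · simpa using hadj i
      · intro i _
        rcases i with _ | i
        · simpa [h1] using hs
        · simpa using hnb i
    have a1 := encard_neighborSet_le_of_opposite hn hb hd hg (hpath q hwq.symm hpq)
    have a2 := encard_neighborSet_le_of_opposite hn hb hd hg (hpath r hwr.symm hpr).reverse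
    simp only [if_true, show n ≠ 0 by omega, if_false, Nat.sub_zero, Nat.sub_self] at a1 a2
    exact hq.trans (a1.trans a2)
  have hwalk : ∀ (x y : V) (w : G.Walk x y) (z : V), G.Adj x z → 3 ≤ (G.neighborSet x).encard →
      3 ≤ (G.neighborSet z).encard → 3 ≤ (G.neighborSet y).encard := by
    intro x y w
    induction w with
    | nil => intro z _ h _; exact h
    | cons h w ih => intro z hxz hx hz; exact ih _ h.symm (step _ z _ hxz h hx hz) hx
  obtain ⟨w, -⟩ := hd p v
  exact hwalk p v w q hpq hp hq

end Criterion

/-! ### Openness expressed by `HasPiece`, and transport of pieces and defects along embeddings. -/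

section Pieces

variable {V : Type*} {G : SimpleGraph V}

theorem encard_neighborSet_induce (A : Finset V) (v : (A : Set V)) :
    ((G.induce (A : Set V)).neighborSet v).encard = dg G A v := by
  classical
  rw [← Subtype.val_injective.encard_image, dg, ← Set.encard_coe_eq_coe_finsetCard]
  congr 1
  ext x
  simp only [Set.mem_image, SimpleGraph.mem_neighborSet, SimpleGraph.induce_adj, Finset.coe_filter,
    Set.mem_ofPred_eq]
  constructor
  · rintro ⟨y, hy, rfl⟩
    exact ⟨y.2, hy⟩
  · rintro ⟨h1, h2⟩
    exact ⟨⟨x, h1⟩, h2, rfl⟩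

theorem isOpenGraph_of_hasPiece {n : ℕ} (h : ∀ A : Finset V, A.Nonempty → HasPiece n G ∅ A)
    (hn : 3 ≤ n) : IsOpenGraph n G := by
  intro A hA
  rcases h A hA with ⟨z, hz, -, hd⟩ | ⟨p, hp, hpA, hpi⟩
  · left
    refine ⟨⟨z, hz⟩, ?_⟩
    rw [encard_neighborSet_induce]
    exact_mod_cast hd
  · right
    -- The index is truncated at n-1 because only the first n terms of `p` are known to lie in `A`.
    let p' : ℕ → (A : Set V) := fun i => ⟨p (min i (n - 1)), hpA _ (min_le_right _ _)⟩
    have hp' : IsPathSeq (G.induce (A : Set V)) (n - 1) p' := by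
      refine ⟨fun i hi => ?_, fun i hi j hj e => ?_⟩
      · have := hp.adj i hi
        simpa [p', min_eq_left hi.le, min_eq_left (show i + 1 ≤ n - 1 by omega)] using this
      · simp only [Set.mem_Iic] at hi hj
        have := congrArg Subtype.val e
        simp only [p', min_eq_left hi, min_eq_left hj] at this
        exact hp.inj hi hj this
    obtain ⟨w, hw, hwl, hwv⟩ := hp'.exists_walk
    refine ⟨_, _, w, hw, by omega, fun z hz hz0 hz1 => ?_⟩
    obtain ⟨i, rfl, hi⟩ := SimpleGraph.Walk.mem_support_iff_exists_getVert.1 hz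
    rw [hwv i (by omega)] at hz0 hz1 ⊢
    have hi0 : i ≠ 0 := fun e => hz0 (by rw [e])
    have hi1 : i ≠ n - 1 := fun e => hz1 (by rw [e])
    rw [encard_neighborSet_induce]
    have e : ((p' i : (A : Set V)) : V) = p i := by
      simp [p', min_eq_left (show i ≤ n - 1 by omega)]
    rw [e]
    have h1 := (hpi i (by omega) (by omega)).2
    have h2 : 2 ≤ dg G A (p i) := by
      have ha := (hp.adj (i - 1) (by omega)).symm
      rw [show i - 1 + 1 = i by omega] at ha
      refine two_le_dg (hpA (i - 1) (by omega)) (hpA (i + 1) (by omega)) ?_ ha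
        (hp.adj i (by omega))
      intro e
      have := (hp.eq_iff (by omega) (by omega)).1 e
      omega
    exact_mod_cast le_antisymm h1 h2

variable {W : Type*} {H : SimpleGraph W}

theorem dg_map (f : H ↪g G) (C : Finset W) (v : W) :
    dg G (C.map f.toEmbedding) (f v) = dg H C v := by
  classical
  unfold dg
  rw [Finset.filter_map, Finset.card_map]
  congr 1
  ext x
  simp

theorem e2_map (f : H ↪g G) (C : Finset W) : e2 G (C.map f.toEmbedding) = e2 H C := by
  unfold e2
  rw [Finset.sum_map]
  exact Finset.sum_congr rfl fun x _ => dg_map f C x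

theorem defect_map (n : ℕ) (f : H ↪g G) (C : Finset W) :
    defect n G (C.map f.toEmbedding) = defect n H C := by
  unfold defect
  rw [e2_map, Finset.card_map]

theorem IsPathSeq.map (f : H ↪g G) {m : ℕ} {p : ℕ → W} (hp : IsPathSeq H m p) :
    IsPathSeq G m (fun i => f (p i)) :=
  ⟨fun i hi => f.map_rel_iff.2 (hp.adj i hi), fun _ hi _ hj e => hp.inj hi hj (f.injective e)⟩

theorem HasPiece.map (f : H ↪g G) {n : ℕ} {T : Set W} {C : Finset W} (h : HasPiece n H T C) :
    HasPiece n G (f '' T) (C.map f.toEmbedding) := by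
  rcases h with ⟨z, hz, hzT, hd⟩ | ⟨p, hp, hpC, hpi⟩
  · refine Or.inl ⟨f z, Finset.mem_map_of_mem _ hz, ?_, by rwa [dg_map]⟩
    rwa [f.injective.mem_set_image]
  · refine Or.inr ⟨_, hp.map f, fun i hi => Finset.mem_map_of_mem _ (hpC i hi), fun i h1 h2 => ?_⟩
    rw [f.injective.mem_set_image, dg_map]
    exact hpi i h1 h2

end Pieces

theorem exists_superset_of_isPathSeq {V : Type u} {G : SimpleGraph V} {n : ℕ} (hn : 3 ≤ n)
    {p : ℕ → V} {m : ℕ} (hm : m + 1 ≤ n) (hp : IsPathSeq G m p) (C : Finset V) (h0 : p 0 ∈ C)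
    (h1 : p m ∈ C) :
    ∃ C' : Finset V, C ⊆ C' ∧ (∀ k ≤ m, p k ∈ C') ∧ (∀ x ∈ C', x ∈ C ∨ ∃ k ≤ m, p k = x) ∧
      defect n G C' ≤ defect n G C := by
  classical
  refine ⟨C ∪ (Finset.range (m + 1)).image p, Finset.subset_union_left, fun k hk =>
    Finset.mem_union_right _ (Finset.mem_image.2 ⟨k, by simp; omega, rfl⟩), fun x hx => ?_,
    defect_union_path_le hn hm hp C h0 h1⟩
  refine (Finset.mem_union.1 hx).imp id fun h => ?_
  obtain ⟨k, hk, e⟩ := Finset.mem_image.1 h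
  exact ⟨k, by simpa [Nat.lt_succ_iff] using hk, e⟩

/-! ### The stages of the free completion -/

section Stages

variable {V : Type u} {n : ℕ} {H : SimpleGraph V}

theorem freeStage_le_succ (i : ℕ) : freeStage n H i ≤ freeStage n H (i + 1) :=
  ⟨fun _ h => Or.inl h, fun _ _ h => Or.inl h⟩

theorem freeStage_mono : Monotone (freeStage n H) := monotone_nat_of_le_succ freeStage_le_succ

theorem arcVertex_mem {i : ℕ} {x y : FreeVertex V} (h : NeedsArc n (freeStage n H i) x y) {j : ℕ}
    (hj : j < n) : arcVertex n x y j ∈ (freeStage n H (i + 1)).verts := by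
  unfold arcVertex
  split_ifs with h0 h1
  · exact Or.inl h.mem.1
  · exact Or.inl h.mem.2
  · exact Or.inr ⟨x, y, j, h, by omega, by omega, rfl⟩

theorem arcVertex_adj {i : ℕ} {x y : FreeVertex V} (h : NeedsArc n (freeStage n H i) x y) {j : ℕ}
    (hj : j + 1 < n) :
    (freeStage n H (i + 1)).Adj (arcVertex n x y j) (arcVertex n x y (j + 1)) :=
  Or.inr ⟨x, y, j, h, hj, Or.inl ⟨rfl, rfl⟩⟩

theorem arcVertex_zero (x y : FreeVertex V) : arcVertex n x y 0 = x := by simp [arcVertex]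

theorem arcVertex_last (hn : 3 ≤ n) (x y : FreeVertex V) : arcVertex n x y (n - 1) = y := by
  simp [arcVertex, show n - 1 ≠ 0 by omega, show n - 1 + 1 = n by omega]

theorem arcVertex_interior (x y : FreeVertex V) {j : ℕ} (h0 : 0 < j) (h1 : j < n - 1) :
    arcVertex n x y j = .arc x y j := by
  simp [arcVertex, show j ≠ 0 by omega, show j + 1 ≠ n by omega]

theorem needsArc_of_arc_mem {i : ℕ} {x y : FreeVertex V} {j : ℕ}
    (h : FreeVertex.arc x y j ∈ (freeStage n H i).verts) :
    ∃ k < i, NeedsArc n (freeStage n H k) x y := by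
  induction i with
  | zero => obtain ⟨v, hv⟩ := h; cases hv
  | succ i ih =>
    rcases h with h | ⟨x', y', j', h, -, -, e⟩
    · obtain ⟨k, hk, h⟩ := ih h
      exact ⟨k, by omega, h⟩
    · injection e with e1 e2 e3
      subst e1 e2
      exact ⟨i, by omega, h⟩

theorem dist_le_of_needsArc (hn : 3 ≤ n) {k i : ℕ} (hki : k < i) {x y : FreeVertex V}
    (h : NeedsArc n (freeStage n H k) x y) : (freeStage n H i).spanningCoe.dist x y ≤ n - 1 := by
  obtain ⟨w, hw, -⟩ := exists_walk_of_adj (G := (freeStage n H i).spanningCoe) (n - 1)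
    (arcVertex n x y) (fun j hj => (freeStage_mono (show k + 1 ≤ i from hki)).2
      (arcVertex_adj h (by omega)))
  have := SimpleGraph.dist_le (w.copy (arcVertex_zero x y) (arcVertex_last hn x y))
  simpa [hw] using this

/-- A name already present would come from an arc added earlier, and then the ends would have
distance at most n-1 instead of n+1. So the interior vertices of an added arc are new. -/
theorem arc_notMem (hn : 3 ≤ n) {i : ℕ} {x y : FreeVertex V}
    (h : NeedsArc n (freeStage n H i) x y) (j : ℕ) :
    FreeVertex.arc x y j ∉ (freeStage n H i).verts := by
  intro hm
  obtain ⟨k, hk, hk'⟩ := needsArc_of_arc_mem hm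
  have := dist_le_of_needsArc hn hk hk'
  rw [h.1] at this
  omega

theorem arcVertex_eq_arc (hn : 3 ≤ n) {i : ℕ} {x y x' y' : FreeVertex V} {j l : ℕ}
    (h : NeedsArc n (freeStage n H i) x y) (h' : NeedsArc n (freeStage n H i) x' y')
    (e : FreeVertex.arc x y j = arcVertex n x' y' l) : x' = x ∧ y' = y ∧ l = j := by
  have hf := arc_notMem hn h j
  unfold arcVertex at e
  split_ifs at e with h0 h1
  · exact absurd (e ▸ h'.mem.1) hf
  · exact absurd (e ▸ h'.mem.2) hf
  · injection e with e1 e2 e3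
    exact ⟨e1.symm, e2.symm, e3.symm⟩

theorem adj_arc (hn : 3 ≤ n) {i : ℕ} {x y b : FreeVertex V} {j : ℕ}
    (h : NeedsArc n (freeStage n H i) x y)
    (hb : (freeStage n H (i + 1)).Adj (.arc x y j) b) :
    b = arcVertex n x y (j - 1) ∨ b = arcVertex n x y (j + 1) := by
  rcases hb with hb | ⟨x', y', l, h', hl, ⟨e, e'⟩ | ⟨e', e⟩⟩
  · exact absurd ((freeStage n H i).edge_vert hb) (arc_notMem hn h j)
  · obtain ⟨rfl, rfl, rfl⟩ := arcVertex_eq_arc hn h h' e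
    exact Or.inr e'
  · obtain ⟨rfl, rfl, rfl⟩ := arcVertex_eq_arc hn h h' e
    exact Or.inl (by simpa using e')

/-- Every new edge has an end in the interior of a new arc because n ≥ 3, so each stage is an
induced subgraph of the next. -/
theorem adj_of_mem_stage (hn : 3 ≤ n) {i : ℕ} {a b : FreeVertex V}
    (ha : a ∈ (freeStage n H i).verts) (hb : b ∈ (freeStage n H i).verts)
    (h : (freeStage n H (i + 1)).Adj a b) : (freeStage n H i).Adj a b := by
  have key : ∀ {x y : FreeVertex V} {l : ℕ}, NeedsArc n (freeStage n H i) x y → l + 1 < n →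
      arcVertex n x y l ∈ (freeStage n H i).verts →
      arcVertex n x y (l + 1) ∈ (freeStage n H i).verts → False := by
    intro x y l hxy hl h1 h2
    rcases Nat.eq_zero_or_pos l with rfl | hl0
    · rw [arcVertex_interior x y (by omega) (by omega)] at h2
      exact arc_notMem hn hxy _ h2
    · rw [arcVertex_interior x y hl0 (by omega)] at h1
      exact arc_notMem hn hxy _ h1
  rcases h with h | ⟨x, y, l, hxy, hl, ⟨rfl, rfl⟩ | ⟨rfl, rfl⟩⟩
  · exact h
  · exact (key hxy hl ha hb).elim
  · exact (key hxy hl hb ha).elim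

theorem adj_of_mem_stage_of_le (hn : 3 ≤ n) {i k : ℕ} (hik : i ≤ k) {a b : FreeVertex V}
    (ha : a ∈ (freeStage n H i).verts) (hb : b ∈ (freeStage n H i).verts)
    (h : (freeStage n H k).Adj a b) : (freeStage n H i).Adj a b := by
  induction k, hik using Nat.le_induction with
  | base => exact h
  | succ k hik ih =>
    exact ih (adj_of_mem_stage hn ((freeStage_mono hik).1 ha) ((freeStage_mono hik).1 hb) h)

/-- The vertices of the `i`-th stage of the free completion. -/
def lev (n : ℕ) (H : SimpleGraph V) (i : ℕ) : Set (FreeCompletionVertex n H) :=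
  {a | a.1 ∈ (freeStage n H i).verts}

theorem lev_mono : Monotone (lev n H) := fun _ _ h _ ha => (freeStage_mono h).1 ha

theorem mem_completion_iff {x : FreeVertex V} :
    x ∈ (⨆ i, freeStage n H i : (⊤ : SimpleGraph (FreeVertex V)).Subgraph).verts ↔
      ∃ i, x ∈ (freeStage n H i).verts := by
  rw [SimpleGraph.Subgraph.verts_iSup, Set.mem_iUnion]

theorem exists_mem_lev (a : FreeCompletionVertex n H) : ∃ i, a ∈ lev n H i :=
  mem_completion_iff.1 a.2

theorem exists_subset_lev (C : Finset (FreeCompletionVertex n H)) :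
    ∃ i, (C : Set (FreeCompletionVertex n H)) ⊆ lev n H i := by
  classical
  induction C using Finset.induction with
  | empty => exact ⟨0, by simp⟩
  | insert a C _ ih =>
    obtain ⟨i, hi⟩ := ih
    obtain ⟨j, hj⟩ := exists_mem_lev a
    refine ⟨max i j, ?_⟩
    rw [Finset.coe_insert]
    exact Set.insert_subset (lev_mono (le_max_right _ _) hj) (hi.trans (lev_mono (le_max_left _ _)))

theorem mem_completion {i : ℕ} {x : FreeVertex V} (h : x ∈ (freeStage n H i).verts) :
    x ∈ (⨆ i, freeStage n H i : (⊤ : SimpleGraph (FreeVertex V)).Subgraph).verts :=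
  mem_completion_iff.2 ⟨i, h⟩

theorem freeCompletion_adj_iff {a b : FreeCompletionVertex n H} :
    (freeCompletion n H).Adj a b ↔ ∃ i, (freeStage n H i).Adj a.1 b.1 := by
  unfold freeCompletion
  rw [SimpleGraph.Subgraph.coe_adj, SimpleGraph.Subgraph.iSup_adj]

theorem stage_adj_of_adj (hn : 3 ≤ n) {i : ℕ} {a b : FreeCompletionVertex n H}
    (ha : a ∈ lev n H i) (hb : b ∈ lev n H i) (h : (freeCompletion n H).Adj a b) :
    (freeStage n H i).Adj a.1 b.1 := by
  obtain ⟨k, hk⟩ := freeCompletion_adj_iff.1 h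
  rcases le_total i k with hik | hik
  · exact adj_of_mem_stage_of_le hn hik ha hb hk
  · exact (freeStage_mono hik).2 hk

/-- The inclusion of a graph in its free completion. -/
def baseVertex (n : ℕ) (H : SimpleGraph V) (v : V) : FreeCompletionVertex n H :=
  ⟨.base v, mem_completion (i := 0) ⟨v, rfl⟩⟩

theorem baseVertex_mem (v : V) : baseVertex n H v ∈ lev n H 0 := ⟨v, rfl⟩

theorem exists_baseVertex {a : FreeCompletionVertex n H} (h : a ∈ lev n H 0) :
    ∃ v, a = baseVertex n H v := by
  obtain ⟨v, hv⟩ := h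
  exact ⟨v, Subtype.ext hv.symm⟩

theorem baseVertex_injective : Function.Injective (baseVertex n H) := by
  intro v w h
  have := congrArg Subtype.val h
  simpa [baseVertex] using this

theorem baseVertex_adj (hn : 3 ≤ n) {v w : V} :
    (freeCompletion n H).Adj (baseVertex n H v) (baseVertex n H w) ↔ H.Adj v w := by
  constructor
  · intro h
    obtain ⟨v', w', h', e, e'⟩ := stage_adj_of_adj hn (baseVertex_mem v) (baseVertex_mem w) h
    injection e with e
    injection e' with e'
    rwa [e, e']
  · intro h
    exact freeCompletion_adj_iff.2 ⟨0, v, w, h, rfl, rfl⟩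

/-- The inclusion of a graph in its free completion, as an embedding of graphs. -/
def baseEmbedding (hn : 3 ≤ n) (H : SimpleGraph V) : H ↪g freeCompletion n H where
  toFun := baseVertex n H
  inj' := baseVertex_injective
  map_rel_iff' := baseVertex_adj hn

/-- The sequence `p` is one of the arcs added to the `i`-th stage, in one of its directions. -/
def IsStageArc (n : ℕ) (H : SimpleGraph V) (i : ℕ) (p : ℕ → FreeCompletionVertex n H) : Prop :=
  ∃ x y, NeedsArc n (freeStage n H i) x y ∧
    ((∀ k ≤ n - 1, (p k).1 = arcVertex n x y k) ∨
      ∀ k ≤ n - 1, (p k).1 = arcVertex n x y (n - 1 - k))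

namespace IsStageArc

variable {i : ℕ} {p q : ℕ → FreeCompletionVertex n H}

theorem reverse (h : IsStageArc n H i p) : IsStageArc n H i (fun k => p (n - 1 - k)) := by
  obtain ⟨x, y, hxy, h | h⟩ := h
  · exact ⟨x, y, hxy, Or.inr fun k hk => h _ (by omega)⟩
  · refine ⟨x, y, hxy, Or.inl fun k hk => ?_⟩
    rw [h _ (by omega), show n - 1 - (n - 1 - k) = k by omega]

/-- The names of an arc run in one direction only. A property that is invariant under reversal and
depends only on the first n terms needs to be checked in that direction alone. -/
theorem induct (hn : 3 ≤ n) {P : (ℕ → FreeCompletionVertex n H) → Prop}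
    (hrev : ∀ p, P p → P (fun k => p (n - 1 - k)))
    (hext : ∀ p q, (∀ k ≤ n - 1, p k = q k) → P p → P q)
    (hfwd : ∀ p x y, NeedsArc n (freeStage n H i) x y →
      (∀ k ≤ n - 1, (p k).1 = arcVertex n x y k) → P p) (h : IsStageArc n H i p) : P p := by
  obtain ⟨x, y, hxy, h | h⟩ := h
  · exact hfwd p x y hxy h
  · refine hext _ _ ?_ (hrev _ (hfwd (fun k => p (n - 1 - k)) x y hxy fun k hk => ?_))
    · intro k hk
      simp only [show n - 1 - (n - 1 - k) = k by omega]
    · show (p (n - 1 - k)).1 = _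
      rw [h _ (by omega), show n - 1 - (n - 1 - k) = k by omega]

theorem ends (hn : 3 ≤ n) (h : IsStageArc n H i p) :
    p 0 ∈ lev n H i ∧ p (n - 1) ∈ lev n H i := by
  obtain ⟨x, y, hxy, h | h⟩ := h
  · unfold lev
    constructor <;> rw [Set.mem_ofPred_eq, h _ (by omega)]
    · rw [arcVertex_zero]; exact hxy.mem.1
    · rw [arcVertex_last hn]; exact hxy.mem.2
  · unfold lev
    constructor <;> rw [Set.mem_ofPred_eq, h _ (by omega)]
    · rw [Nat.sub_zero, arcVertex_last hn]; exact hxy.mem.2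
    · rw [Nat.sub_self, arcVertex_zero]; exact hxy.mem.1

theorem mem (h : IsStageArc n H i p) (hn : 3 ≤ n) {k : ℕ} (hk : k ≤ n - 1) :
    p k ∈ lev n H (i + 1) := by
  obtain ⟨x, y, hxy, h | h⟩ := h <;> unfold lev <;> rw [Set.mem_ofPred_eq, h _ hk] <;>
    exact arcVertex_mem hxy (by omega)

theorem notMem (h : IsStageArc n H i p) (hn : 3 ≤ n) {k : ℕ} (h0 : 0 < k) (hk : k < n - 1) :
    p k ∉ lev n H i := by
  obtain ⟨x, y, hxy, h | h⟩ := h <;> unfold lev <;> rw [Set.mem_ofPred_eq, h _ (by omega),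
    arcVertex_interior x y (by omega) (by omega)] <;> exact arc_notMem hn hxy _

theorem dist_eq (h : IsStageArc n H i p) (hn : 3 ≤ n) :
    (freeStage n H i).spanningCoe.dist (p 0).1 (p (n - 1)).1 = n + 1 := by
  obtain ⟨x, y, hxy, h | h⟩ := h <;> rw [h _ (by omega), h _ (by omega)]
  · rw [arcVertex_zero, arcVertex_last hn, hxy.1]
  · rw [Nat.sub_zero, Nat.sub_self, arcVertex_zero, arcVertex_last hn, SimpleGraph.dist_comm, hxy.1]

theorem isPathSeq (h : IsStageArc n H i p) (hn : 3 ≤ n) :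
    IsPathSeq (freeCompletion n H) (n - 1) p := by
  refine induct hn (P := fun p => IsPathSeq (freeCompletion n H) (n - 1) p)
    (fun p hp => hp.reverse) ?_ ?_ h
  · intro p q e hp
    refine ⟨fun k hk => ?_, fun a ha b hb hab => ?_⟩
    · rw [← e k (by omega), ← e (k + 1) (by omega)]
      exact hp.adj k hk
    · rw [← e a ha, ← e b hb] at hab
      exact hp.inj ha hb hab
  · intro p x y hxy hp
    refine ⟨fun k hk => ?_, fun a ha b hb hab => ?_⟩
    · rw [freeCompletion_adj_iff]
      refine ⟨i + 1, ?_⟩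
      rw [hp _ (by omega), hp _ (by omega)]
      exact arcVertex_adj hxy (by omega)
    · simp only [Set.mem_Iic] at ha hb
      have e := congrArg Subtype.val hab
      rw [hp _ ha, hp _ hb] at e
      have hx : ∀ k ≤ n - 1, arcVertex n x y k = x → k = 0 := by
        intro k hk e
        by_contra h0
        rcases hk.eq_or_lt with rfl | hk'
        · rw [arcVertex_last hn] at e
          exact hxy.ne e.symm
        · rw [arcVertex_interior x y (by omega) hk'] at e
          exact FreeVertex.ne_arc_left x y k e.symm
      have hy : ∀ k ≤ n - 1, arcVertex n x y k = y → k = n - 1 := by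
        intro k hk e
        by_contra h1
        rcases Nat.eq_zero_or_pos k with rfl | hk'
        · rw [arcVertex_zero] at e
          exact hxy.ne e
        · rw [arcVertex_interior x y hk' (by omega)] at e
          exact FreeVertex.ne_arc_right x y k e.symm
      rcases Nat.eq_zero_or_pos a with rfl | ha0
      · rw [arcVertex_zero] at e
        exact (hx b hb e.symm).symm
      rcases ha.eq_or_lt with rfl | ha1
      · rw [arcVertex_last hn] at e
        exact (hy b hb e.symm).symm
      rw [arcVertex_interior x y ha0 ha1] at e
      exact (arcVertex_eq_arc hn hxy hxy e).2.2.symm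

theorem eq_or_eq_of_adj (h : IsStageArc n H i p) (hn : 3 ≤ n) {k : ℕ} (h0 : 0 < k) (hk : k < n - 1)
    {w : FreeCompletionVertex n H} (hw : w ∈ lev n H (i + 1))
    (ha : (freeCompletion n H).Adj (p k) w) : w = p (k - 1) ∨ w = p (k + 1) := by
  have h2 := stage_adj_of_adj hn (h.mem hn (by omega)) hw ha
  obtain ⟨x, y, hxy, h | h⟩ := h
  · rw [h k (by omega), arcVertex_interior x y h0 hk] at h2
    rcases adj_arc hn hxy h2 with e | e
    · exact Or.inl (Subtype.ext (e.trans (h _ (by omega)).symm))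
    · exact Or.inr (Subtype.ext (e.trans (h _ (by omega)).symm))
  · rw [h k (by omega), arcVertex_interior x y (by omega) (by omega)] at h2
    rcases adj_arc hn hxy h2 with e | e
    · refine Or.inr (Subtype.ext (e.trans ?_))
      rw [h _ (by omega)]
      congr 1
    · refine Or.inl (Subtype.ext (e.trans ?_))
      rw [h _ (by omega)]
      congr 1
      omega

/-- The well-ordering in `NeedsArc` admits only one direction for each pair of ends, so two arcs
with the same ends cannot have opposite names. -/
theorem eq_of_ends (hp : IsStageArc n H i p) (hq : IsStageArc n H i q) (hn : 3 ≤ n)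
    (h0 : p 0 = q 0) (h1 : p (n - 1) = q (n - 1)) {k : ℕ} (hk : k ≤ n - 1) : p k = q k := by
  have e0 := congrArg Subtype.val h0
  have e1 := congrArg Subtype.val h1
  obtain ⟨x, y, hxy, h | h⟩ := hp <;> obtain ⟨x', y', hxy', h' | h'⟩ := hq <;>
    rw [h _ (by omega), h' _ (by omega)] at e0 e1 <;>
    simp only [arcVertex_zero, arcVertex_last hn, Nat.sub_zero, Nat.sub_self] at e0 e1 <;>
    subst e0 e1
  · exact Subtype.ext ((h k hk).trans (h' k hk).symm)
  · exact absurd hxy'.2 (asymm hxy.2)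
  · exact absurd hxy'.2 (asymm hxy.2)
  · exact Subtype.ext ((h k hk).trans (h' k hk).symm)

end IsStageArc

theorem exists_forward_arc (hn : 3 ≤ n) {i : ℕ} {x y : FreeVertex V}
    (h : NeedsArc n (freeStage n H i) x y) : ∃ p, IsStageArc n H i p ∧
      ∀ k ≤ n - 1, (p k).1 = arcVertex n x y k := by
  have key : ∀ k, arcVertex n x y (min k (n - 1)) ∈
      (⨆ i, freeStage n H i : (⊤ : SimpleGraph (FreeVertex V)).Subgraph).verts := fun k =>
    mem_completion (arcVertex_mem h (by omega))
  have h' : ∀ k ≤ n - 1, (⟨_, key k⟩ : FreeCompletionVertex n H).1 = arcVertex n x y k :=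
    fun k hk => by simp [min_eq_left hk]
  exact ⟨fun k => ⟨_, key k⟩, ⟨x, y, h, Or.inl h'⟩, h'⟩

theorem exists_stageArc_of_mem (hn : 3 ≤ n) {i : ℕ} {z : FreeCompletionVertex n H}
    (hz : z ∈ lev n H (i + 1)) (hz' : z ∉ lev n H i) :
    ∃ p k, IsStageArc n H i p ∧ 0 < k ∧ k < n - 1 ∧ z = p k := by
  rcases hz with hz | ⟨x, y, j, h, h0, h1, e⟩
  · exact absurd hz hz'
  · obtain ⟨p, hp, hpk⟩ := exists_forward_arc hn h
    refine ⟨p, j, hp, h0, by omega, Subtype.ext ?_⟩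
    rw [hpk j (by omega), e, arcVertex_interior x y h0 (by omega)]

theorem exists_stageArc (hn : 3 ≤ n) {i : ℕ} {x y : FreeCompletionVertex n H}
    (h : (freeStage n H i).spanningCoe.dist x.1 y.1 = n + 1) :
    ∃ p, IsStageArc n H i p ∧ p 0 = x ∧ p (n - 1) = y := by
  rcases trichotomous_of WellOrderingRel x.1 y.1 with h' | h' | h'
  · obtain ⟨p, hp, hpk⟩ := exists_forward_arc (H := H) (i := i) hn ⟨h, h'⟩
    refine ⟨p, hp, Subtype.ext ?_, Subtype.ext ?_⟩
    · rw [hpk _ (by omega), arcVertex_zero]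
    · rw [hpk _ (by omega), arcVertex_last hn]
  · rw [h', SimpleGraph.dist_self] at h
    omega
  · rw [SimpleGraph.dist_comm] at h
    obtain ⟨p, hp, hpk⟩ := exists_forward_arc (H := H) (i := i) hn ⟨h, h'⟩
    refine ⟨_, hp.reverse, Subtype.ext ?_, Subtype.ext ?_⟩
    · rw [Nat.sub_zero, hpk _ (by omega), arcVertex_last hn]
    · rw [Nat.sub_self, hpk _ (by omega), arcVertex_zero]

/-! ### Consequences for the free completion -/

theorem dg_le_two_of_stageArc (hn : 3 ≤ n) {i : ℕ} {p : ℕ → FreeCompletionVertex n H}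
    (hp : IsStageArc n H i p) {C : Finset (FreeCompletionVertex n H)}
    (hC : (C : Set (FreeCompletionVertex n H)) ⊆ lev n H (i + 1)) {k : ℕ} (h0 : 0 < k)
    (hk : k < n - 1) : dg (freeCompletion n H) C (p k) ≤ 2 := by
  classical
  refine (Finset.card_le_card (t := {p (k - 1), p (k + 1)}) ?_).trans Finset.card_le_two
  intro w hw
  rw [Finset.mem_filter] at hw
  simpa using hp.eq_or_eq_of_adj hn h0 hk (hC hw.1) hw.2

/-- After the last position before `k` at which the arc is missing from `C` comes a vertex of `C`
that has lost one of its only two neighbours. -/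
theorem exists_looseEnd_of_missing (hn : 3 ≤ n) {i : ℕ} {p : ℕ → FreeCompletionVertex n H}
    (hp : IsStageArc n H i p) {C : Finset (FreeCompletionVertex n H)}
    (hC : (C : Set (FreeCompletionVertex n H)) ⊆ lev n H (i + 1)) {j k : ℕ} (hjk : j < k)
    (hk : k < n - 1) (hj : p j ∉ C) (hkC : p k ∈ C) :
    ∃ z ∈ C, z ∉ lev n H i ∧ dg (freeCompletion n H) C z ≤ 1 := by
  classical
  set t := Nat.findGreatest (fun s => p s ∉ C) k with ht
  have h1 : p t ∉ C := Nat.findGreatest_spec (P := fun s => p s ∉ C) hjk.le hj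
  have h2 : t ≤ k := Nat.findGreatest_le k
  have h3 : t < k := lt_of_le_of_ne h2 fun e => h1 (e ▸ hkC)
  have h4 : p (t + 1) ∈ C := by
    by_contra hcon
    exact Nat.findGreatest_is_greatest (P := fun s => p s ∉ C) (Nat.lt_succ_self t) h3 hcon
  refine ⟨p (t + 1), h4, hp.notMem hn (by omega) (by omega), ?_⟩
  refine (Finset.card_le_card (t := {p (t + 2)}) ?_).trans (by simp)
  intro w hw
  rw [Finset.mem_filter] at hw
  rcases hp.eq_or_eq_of_adj hn (by omega) (by omega) (hC hw.1) hw.2 with e | e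
  · exact absurd (e ▸ hw.1) h1
  · simpa using e

/-- The free completion is open over each of its stages. -/
theorem hasPiece_lev (hn : 3 ≤ n) (i : ℕ) (C : Finset (FreeCompletionVertex n H))
    (hC : ¬ (C : Set (FreeCompletionVertex n H)) ⊆ lev n H i) :
    HasPiece n (freeCompletion n H) (lev n H i) C := by
  classical
  have hex := exists_subset_lev C
  -- In the least stage containing `C` the newest vertices have valency at most two. An arc whose
  -- interior meets `C` is either entirely in `C`, hence clean, or broken, and then it leaves a
  -- loose end.
  set L := Nat.find hex with hL
  have hL1 := Nat.find_spec hex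
  have hiL : i < L := by
    by_contra! hcon
    exact hC (hL1.trans (lev_mono hcon))
  obtain ⟨l, hl⟩ : ∃ l, L = l + 1 := ⟨L - 1, by omega⟩
  have hil : lev n H i ⊆ lev n H l := lev_mono (by omega)
  have hL2 := Nat.find_min hex (show l < L by omega)
  rw [← hL, hl] at hL1
  obtain ⟨z, hz, hzl⟩ := Set.not_subset.1 hL2
  obtain ⟨p, k, hp, hk0, hk1, rfl⟩ := exists_stageArc_of_mem hn (hL1 hz) hzl
  by_cases hall : ∀ j ≤ n - 1, p j ∈ C
  · exact Or.inr ⟨p, hp.isPathSeq hn, hall, fun j h0 h1 => ⟨fun h => hp.notMem hn h0 h1 (hil h),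
      dg_le_two_of_stageArc hn hp hL1 h0 h1⟩⟩
  · left
    push Not at hall
    obtain ⟨j, hj, hjC⟩ := hall
    have : ∃ z ∈ C, z ∉ lev n H l ∧ dg (freeCompletion n H) C z ≤ 1 := by
      rcases lt_trichotomy j k with h | rfl | h
      · exact exists_looseEnd_of_missing hn hp hL1 h hk1 hjC hz
      · exact absurd hz hjC
      · refine exists_looseEnd_of_missing hn hp.reverse hL1 (j := n - 1 - j) (k := n - 1 - k)
          (by omega) (by omega) ?_ ?_
        · rwa [show n - 1 - (n - 1 - j) = j by omega]
        · rwa [show n - 1 - (n - 1 - k) = k by omega]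
    obtain ⟨z, h1, h2, h3⟩ := this
    exact ⟨z, h1, fun h => h2 (hil h), h3⟩

/-- A vertex new in stage i+1 lies on an arc with ends in stage i. The ends are adjoined by
induction and then the arc, which does not raise the defect. -/
theorem exists_superset_defect_le (hn : 3 ≤ n) {d : ℤ} {I : ℕ}
    {C : Finset (FreeCompletionVertex n H)} (h0 : lev n H 0 ⊆ C) (hCI : ∀ x ∈ C, x ∈ lev n H I)
    (hd : defect n (freeCompletion n H) C ≤ d) {z : FreeCompletionVertex n H}
    (hz : z ∈ lev n H I) :
    ∃ C' : Finset (FreeCompletionVertex n H), C ⊆ C' ∧ z ∈ C' ∧ (∀ x ∈ C', x ∈ lev n H I) ∧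
      defect n (freeCompletion n H) C' ≤ d := by
  suffices key : ∀ i ≤ I, ∀ z ∈ lev n H i, ∀ C : Finset (FreeCompletionVertex n H),
      lev n H 0 ⊆ C → (∀ x ∈ C, x ∈ lev n H I) → defect n (freeCompletion n H) C ≤ d →
      ∃ C' : Finset (FreeCompletionVertex n H), C ⊆ C' ∧ z ∈ C' ∧ (∀ x ∈ C', x ∈ lev n H I) ∧
        defect n (freeCompletion n H) C' ≤ d from key I le_rfl z hz C h0 hCI hd
  intro i
  induction i with
  | zero => exact fun _ z hz C h0 hCI hd => ⟨C, subset_rfl, h0 hz, hCI, hd⟩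
  | succ i ih =>
    intro hiI z hi C h0 hCI hd
    by_cases hz : z ∈ lev n H i
    · exact ih (by omega) z hz C h0 hCI hd
    · obtain ⟨p, k, hp, hk0, hk1, rfl⟩ := exists_stageArc_of_mem hn hi hz
      obtain ⟨C₁, h1, h2, h3, h3'⟩ := ih (by omega) _ (hp.ends hn).1 C h0 hCI hd
      have h0' : lev n H 0 ⊆ (C₁ : Set (FreeCompletionVertex n H)) := fun a ha => h1 (h0 ha)
      obtain ⟨C₂, h4, h5, h6, h6'⟩ := ih (by omega) _ (hp.ends hn).2 C₁ h0' h3 h3'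
      obtain ⟨C₃, h7, h8, h9, h10⟩ := exists_superset_of_isPathSeq hn (show n - 1 + 1 ≤ n by omega)
        (hp.isPathSeq hn) C₂ (h4 h2) h5
      refine ⟨C₃, (h1.trans h4).trans h7, h8 k (by omega), fun x hx => ?_, h10.trans h6'⟩
      rcases h9 x hx with h | ⟨j, hj, rfl⟩
      · exact h6 x h
      · exact lev_mono hiI (hp.mem hn hj)

theorem exists_finset_superset_defect_le (hn : 3 ≤ n) {d : ℤ} {I : ℕ}
    {C : Finset (FreeCompletionVertex n H)} (h0 : lev n H 0 ⊆ C) (hCI : ∀ x ∈ C, x ∈ lev n H I)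
    (hd : defect n (freeCompletion n H) C ≤ d) (F : Finset (FreeCompletionVertex n H))
    (hF : ∀ x ∈ F, x ∈ lev n H I) :
    ∃ C' : Finset (FreeCompletionVertex n H), C ⊆ C' ∧ F ⊆ C' ∧ (∀ x ∈ C', x ∈ lev n H I) ∧
      defect n (freeCompletion n H) C' ≤ d := by
  classical
  induction F using Finset.induction with
  | empty => exact ⟨C, subset_rfl, by simp, hCI, hd⟩
  | insert z F _ ih =>
    obtain ⟨C₁, h1, h2, h3, h3'⟩ := ih fun x hx => hF x (Finset.mem_insert_of_mem hx)
    have h0' : lev n H 0 ⊆ (C₁ : Set (FreeCompletionVertex n H)) := fun a ha => h1 (h0 ha)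
    obtain ⟨C₂, h4, h5, h6, h6'⟩ :=
      exists_superset_defect_le hn h0' h3 h3' (hF z (Finset.mem_insert_self _ _))
    exact ⟨C₂, h1.trans h4, Finset.insert_subset h5 (h2.trans h4), h6, h6'⟩

theorem exists_walk_of_stage {i : ℕ} {x y : FreeVertex V}
    (w : (freeStage n H i).spanningCoe.Walk x y)
    (hx : x ∈ (⨆ i, freeStage n H i : (⊤ : SimpleGraph (FreeVertex V)).Subgraph).verts)
    (hy : y ∈ (⨆ i, freeStage n H i : (⊤ : SimpleGraph (FreeVertex V)).Subgraph).verts) :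
    ∃ w' : (freeCompletion n H).Walk ⟨x, hx⟩ ⟨y, hy⟩, w'.length = w.length := by
  induction w with
  | nil => exact ⟨.nil, rfl⟩
  | @cons x z y h w ih =>
    have hz := mem_completion ((freeStage n H i).edge_vert (SimpleGraph.Adj.symm h))
    obtain ⟨w', hw'⟩ := ih hz hy
    have hadj : (freeCompletion n H).Adj ⟨x, hx⟩ ⟨z, hz⟩ := freeCompletion_adj_iff.2 ⟨i, h⟩
    exact ⟨.cons hadj w', by simp [hw']⟩

theorem exists_stage_walk {x y : FreeCompletionVertex n H} (w : (freeCompletion n H).Walk x y) :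
    ∃ i, ∃ w' : (freeStage n H i).spanningCoe.Walk x.1 y.1, w'.length = w.length := by
  induction w with
  | nil => exact ⟨0, .nil, rfl⟩
  | cons h w ih =>
    obtain ⟨i, w', hw'⟩ := ih
    obtain ⟨j, hj⟩ := freeCompletion_adj_iff.1 h
    have hle : (freeStage n H i).spanningCoe ≤ (freeStage n H (max i j)).spanningCoe :=
      fun a b hab => (freeStage_mono (le_max_left i j)).2 hab
    have hadj : (freeStage n H (max i j)).Adj _ _ := (freeStage_mono (le_max_right i j)).2 hj
    refine ⟨max i j, .cons hadj (w'.mapLe hle), ?_⟩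
    exact congrArg (· + 1) ((SimpleGraph.Walk.length_mapLe hle w').trans hw')

theorem freeCompletion_connected (hn : 3 ≤ n) (hH : H.Connected) :
    (freeCompletion n H).Connected := by
  obtain ⟨v₀⟩ := hH.nonempty
  have key : ∀ i, ∀ z ∈ lev n H i, (freeCompletion n H).Reachable (baseVertex n H v₀) z := by
    intro i
    induction i with
    | zero =>
      intro z hz
      obtain ⟨v, rfl⟩ := exists_baseVertex hz
      exact (hH.preconnected v₀ v).map (baseEmbedding hn H).toHom
    | succ i ih =>
      intro z hz
      by_cases hz' : z ∈ lev n H i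
      · exact ih z hz'
      · obtain ⟨p, k, hp, hk0, hk1, rfl⟩ := exists_stageArc_of_mem hn hz hz'
        obtain ⟨w, -⟩ := exists_walk_of_adj k p (fun i hi => (hp.isPathSeq hn).adj i (by omega))
        exact (ih _ (hp.ends hn).1).trans w.reachable
  have : Nonempty (FreeCompletionVertex n H) := ⟨baseVertex n H v₀⟩
  refine ⟨fun x y => ?_⟩
  obtain ⟨i, hi⟩ := exists_mem_lev x
  obtain ⟨j, hj⟩ := exists_mem_lev y
  exact (key i x hi).symm.trans (key j y hj)

/-- A geodesic longer than n begins with n+1 steps to a vertex at distance n+1. This distance is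
already n+1 in some stage, so the next stage adds an arc of length n-1 between the two vertices, a
contradiction. -/
theorem freeCompletion_exists_walk (hn : 3 ≤ n) (hH : H.Connected)
    (x y : FreeCompletionVertex n H) : ∃ w : (freeCompletion n H).Walk x y, w.length ≤ n := by
  have hc := freeCompletion_connected hn hH
  obtain ⟨w, hw⟩ := hc.exists_walk_length_eq_dist x y
  refine ⟨w, ?_⟩
  by_contra! hlt
  have h1 : (freeCompletion n H).dist x (w.getVert (n + 1)) = n + 1 := by
    have a1 := SimpleGraph.dist_le (w.take (n + 1))
    have a2 := SimpleGraph.dist_le (w.drop (n + 1))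
    have a3 := hc.dist_triangle (u := x) (v := w.getVert (n + 1)) (w := y)
    rw [SimpleGraph.Walk.take_length] at a1
    rw [SimpleGraph.Walk.drop_length] at a2
    have := min_le_left (n + 1) w.length
    omega
  obtain ⟨i, w', hw'⟩ := exists_stage_walk (w.take (n + 1))
  have h2 : (freeStage n H i).spanningCoe.dist x.1 (w.getVert (n + 1)).1 = n + 1 := by
    apply le_antisymm
    · refine (SimpleGraph.dist_le w').trans ?_
      rw [hw', SimpleGraph.Walk.take_length]
      exact min_le_left _ _
    · obtain ⟨w₂, hw₂⟩ := w'.reachable.exists_walk_length_eq_dist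
      obtain ⟨w₃, hw₃⟩ := exists_walk_of_stage w₂ x.2 (w.getVert (n + 1)).2
      have h3 : (freeCompletion n H).dist x (w.getVert (n + 1)) ≤ w₃.length :=
        SimpleGraph.dist_le w₃
      omega
  obtain ⟨p, hp, h3, h4⟩ := exists_stageArc hn h2
  obtain ⟨w₄, hw₄, -⟩ := exists_walk_of_adj _ p (hp.isPathSeq hn).adj
  have := SimpleGraph.dist_le (w₄.copy h3 h4)
  rw [h1, SimpleGraph.Walk.length_copy, hw₄] at this
  omega

/-- The colouring of the vertices of the free completion induced by a colouring of `V`. -/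
def FreeVertex.color (c : V → Bool) : FreeVertex V → Bool
  | .base v => c v
  | .arc x _ j => xor (x.color c) (decide (j % 2 = 1))

/-- An arc of length n-1 is added between vertices at distance n+1, which has the same parity; so
the alternating colouring of the arc fits at its second end. -/
theorem color_ne (hn : 3 ≤ n) (c : H.Coloring Bool) (i : ℕ) {a b : FreeVertex V}
    (h : (freeStage n H i).Adj a b) : a.color c ≠ b.color c := by
  induction i generalizing a b with
  | zero =>
    obtain ⟨v, w, hvw, rfl, rfl⟩ := h
    exact c.valid hvw
  | succ i ih =>
    let c' : (freeStage n H i).spanningCoe.Coloring Bool :=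
      SimpleGraph.Coloring.mk (fun a => a.color c) (fun {a b} h => ih h)
    have hcol : ∀ {x y : FreeVertex V} {j : ℕ}, NeedsArc n (freeStage n H i) x y → j < n →
        (arcVertex n x y j).color c = xor (x.color c) (decide (j % 2 = 1)) := by
      intro x y j hxy hj
      unfold arcVertex
      split_ifs with h0 h1
      · simp [h0]
      · obtain ⟨w, hw⟩ := (SimpleGraph.Reachable.of_dist_ne_zero (u := x) (v := y)
          (G := (freeStage n H i).spanningCoe) (by rw [hxy.1]; omega)).exists_walk_length_eq_dist
        have h2 := c'.even_length_iff_congr w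
        rw [hw, hxy.1, Nat.even_iff] at h2
        have h3 : c' x = x.color c := rfl
        have h4 : c' y = y.color c := rfl
        rw [h3, h4] at h2
        by_cases hj2 : j % 2 = 1
        · have : ¬ ((n + 1) % 2 = 0) := by omega
          rw [hj2]
          revert h2
          cases x.color c <;> cases y.color c <;> simp [this]
        · have : (n + 1) % 2 = 0 := by omega
          revert h2
          cases x.color c <;> cases y.color c <;> simp [this, hj2]
      · rfl
    have key : ∀ {x y : FreeVertex V} {j : ℕ}, NeedsArc n (freeStage n H i) x y → j + 1 < n →
        (arcVertex n x y j).color c ≠ (arcVertex n x y (j + 1)).color c := by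
      intro x y j hxy hj
      rw [hcol hxy (by omega), hcol hxy hj]
      rcases Nat.mod_two_eq_zero_or_one j with h | h
      · have : (j + 1) % 2 = 1 := by omega
        simp [h, this]
      · have : (j + 1) % 2 = 0 := by omega
        simp [h, this]
    rcases h with h | ⟨x, y, j, hxy, hj, ⟨rfl, rfl⟩ | ⟨rfl, rfl⟩⟩
    · exact ih h
    · exact key hxy hj
    · exact (key hxy hj).symm

theorem freeCompletion_isBipartite (hn : 3 ≤ n) (c : H.Coloring Bool) :
    (freeCompletion n H).IsBipartite := by
  have c' : (freeCompletion n H).Coloring Bool := SimpleGraph.Coloring.mk (fun a => a.1.color c)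
    (fun {a b} h => by
      obtain ⟨i, hi⟩ := freeCompletion_adj_iff.1 h
      exact color_ne hn c i hi)
  have := c'.colorable
  rwa [Fintype.card_bool] at this

end Stages

/-! ### The girth of the free completion -/

section Girth

variable {V : Type u} {n : ℕ}

/-- A closed nonbacktracking sequence of period `m`. -/
structure IsClosedSeq (G : SimpleGraph V) (m : ℕ) (f : ℕ → V) : Prop where
  pos : 0 < m
  period : ∀ i, f (i + m) = f i
  adj : ∀ i, G.Adj (f i) (f (i + 1))
  ne : ∀ i, f i ≠ f (i + 2)

theorem IsClosedSeq.shift {G : SimpleGraph V} {m : ℕ} {f : ℕ → V} (h : IsClosedSeq G m f) (a : ℕ) :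
    IsClosedSeq G m (fun i => f (a + i)) where
  pos := h.pos
  period i := by rw [← add_assoc, h.period]
  adj i := h.adj (a + i)
  ne i := h.ne (a + i)

theorem IsClosedSeq.period_mul {G : SimpleGraph V} {m : ℕ} {f : ℕ → V} (h : IsClosedSeq G m f)
    (i k : ℕ) : f (i + k * m) = f i := by
  induction k with
  | zero => simp
  | succ k ih => rw [Nat.succ_mul, ← add_assoc, h.period, ih]

theorem IsClosedSeq.apply_mod {G : SimpleGraph V} {m : ℕ} {f : ℕ → V} (h : IsClosedSeq G m f)
    (i : ℕ) : f (i % m) = f i := by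
  have := h.period_mul (i % m) (i / m)
  rwa [mul_comm, Nat.mod_add_div, eq_comm] at this

theorem exists_isClosedSeq {G : SimpleGraph V} {a : V} {w : G.Walk a a} (hw : w.IsCycle) :
    ∃ f, IsClosedSeq G w.length f := by
  have h3 := hw.three_le_length
  set m := w.length with hm
  have hmod : ∀ i, i % m < m := fun i => Nat.mod_lt _ (by omega)
  have hval : ∀ i k : ℕ, (i + k) % m = (i % m + k) % m := fun i k => by rw [Nat.mod_add_mod]
  refine ⟨fun i => w.getVert (i % m), by omega, fun i => by simp, fun i => ?_, fun i e => ?_⟩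
  · show G.Adj (w.getVert (i % m)) (w.getVert ((i + 1) % m))
    rw [hval]
    have h1 := w.adj_getVert_succ (hmod i)
    rcases (Nat.succ_le_of_lt (hmod i)).eq_or_lt with h | h
    · have h' : i % m + 1 = m := h
      rw [h'] at h1 ⊢
      have h2 : w.getVert m = w.getVert 0 := by
        rw [hm, SimpleGraph.Walk.getVert_length, SimpleGraph.Walk.getVert_zero]
      rwa [Nat.mod_self, ← h2]
    · rwa [Nat.mod_eq_of_lt h]
  · have h1 := hw.getVert_injOn' (show i % m ≤ m - 1 by have := hmod i; omega)
      (show (i + 2) % m ≤ m - 1 by have := hmod (i + 2); omega) e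
    rw [hval] at h1
    have h2 := hmod i
    rcases lt_or_ge (i % m + 2) m with h | h
    · rw [Nat.mod_eq_of_lt h] at h1
      omega
    · rw [Nat.mod_eq_sub_mod h, Nat.mod_eq_of_lt (show i % m + 2 - m < m by omega)] at h1
      omega

/-- Next to an occurrence of the largest value both neighbouring terms are one smaller, so the
sequence backtracks there. -/
theorem not_isClosedSeq_pathGraph {k m : ℕ} (f : ℕ → Fin k) :
    ¬ IsClosedSeq (SimpleGraph.pathGraph k) m f := by
  intro h
  obtain ⟨i, hi⟩ : ∃ i, ∀ j, f j ≤ f i := by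
    obtain ⟨x, ⟨i, rfl⟩, hx⟩ := (Set.range f).toFinite.exists_maximal ⟨f 0, 0, rfl⟩
    exact ⟨i, fun j => (le_total (f j) (f i)).elim id (hx ⟨j, rfl⟩)⟩
  have hm := h.pos
  obtain ⟨l, hl⟩ : ∃ l, i + m = l + 1 := ⟨i + m - 1, by omega⟩
  have h0 : f (l + 1) = f i := by rw [← hl, h.period]
  have h1 := h.adj l
  have h2 := h.adj (l + 1)
  rw [SimpleGraph.pathGraph_adj, h0] at h1 h2
  have h3 := hi l
  have h4 := hi (l + 1 + 1)
  rw [Fin.le_def] at h3 h4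
  exact h.ne l (Fin.ext (by show (f l : ℕ) = f (l + 1 + 1); omega))

variable {H : SimpleGraph V}

/-- Within the newest stage an interior vertex of an arc has only its two neighbours on the arc, so
a nonbacktracking sequence running along the arc has no choice. -/
theorem IsStageArc.follow (hn : 3 ≤ n) {l : ℕ} {p g : ℕ → FreeCompletionVertex n H}
    (hp : IsStageArc n H l p) {k M : ℕ} (hM : k + M ≤ n - 1)
    (hg : ∀ t ≤ M, g t ∈ lev n H (l + 1))
    (hadj : ∀ t < M, (freeCompletion n H).Adj (g t) (g (t + 1)))
    (hne : ∀ t, t + 2 ≤ M → g t ≠ g (t + 2)) (h0 : g 0 = p k) (h1 : g 1 = p (k + 1)) :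
    ∀ t ≤ M, g t = p (k + t) := by
  intro t
  induction t using Nat.strong_induction_on with
  | _ t ih =>
    intro ht
    match t with
    | 0 => exact h0
    | 1 => exact h1
    | t + 2 =>
      have a1 := ih t (by omega) (by omega)
      have a2 := ih (t + 1) (by omega) (by omega)
      have a3 := hadj (t + 1) (by omega)
      rw [a2] at a3
      rcases hp.eq_or_eq_of_adj hn (by omega) (by omega) (hg _ ht) a3 with e | e
      · refine absurd ?_ (hne t ht)
        rw [a1]
        exact e.symm
      · exact e

/-- The arc is followed forwards from position i and backwards from position i+1; the bound n ≤ i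
leaves room for the latter. -/
theorem exists_run (hn : 3 ≤ n) {l : ℕ} {f : ℕ → FreeCompletionVertex n H}
    (hf : ∀ i, f i ∈ lev n H (l + 1)) (hadj : ∀ i, (freeCompletion n H).Adj (f i) (f (i + 1)))
    (hne : ∀ i, f i ≠ f (i + 2)) {i : ℕ} (hi : n ≤ i) (hil : f i ∉ lev n H l) :
    ∃ a p, IsStageArc n H l p ∧ a < i ∧ i < a + (n - 1) ∧ ∀ t ≤ n - 1, f (a + t) = p t := by
  obtain ⟨p, k, hp, hk0, hk1, e⟩ := exists_stageArc_of_mem hn (hf i) hil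
  obtain ⟨p, k, hp, hk0, hk1, e, e'⟩ : ∃ p k, IsStageArc n H l p ∧ 0 < k ∧ k < n - 1 ∧ f i = p k ∧
      f (i + 1) = p (k + 1) := by
    have h1 := hadj i
    rw [e] at h1
    rcases hp.eq_or_eq_of_adj hn hk0 hk1 (hf _) h1 with e' | e'
    · refine ⟨_, n - 1 - k, hp.reverse, by omega, by omega, ?_, ?_⟩
      · rw [show n - 1 - (n - 1 - k) = k by omega, e]
      · rw [show n - 1 - (n - 1 - k + 1) = k - 1 by omega, e']
    · exact ⟨p, k, hp, hk0, hk1, e, e'⟩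
  have h1 := hp.follow hn (g := fun t => f (i + t)) (k := k) (M := n - 1 - k) (by omega)
    (fun t _ => hf _) (fun t _ => hadj _) (fun t _ => hne _) e e'
  have h2 := hp.reverse.follow hn (g := fun t => f (i + 1 - t)) (k := n - 2 - k) (M := k + 1)
    (by omega) (fun t _ => hf _)
    (fun t ht => by
      have := hadj (i - t)
      rw [show i - t + 1 = i + 1 - t by omega] at this
      rw [show i + 1 - (t + 1) = i - t by omega]
      exact this.symm)
    (fun t ht => by
      have := hne (i + 1 - (t + 2))
      rw [show i + 1 - (t + 2) + 2 = i + 1 - t by omega] at this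
      exact this.symm)
    (by rw [show n - 1 - (n - 2 - k) = k + 1 by omega]; exact e')
    (by rw [show n - 1 - (n - 2 - k + 1) = k by omega]; exact e)
  refine ⟨i - k, p, hp, by omega, by omega, fun t ht => ?_⟩
  rcases le_total k t with hkt | hkt
  · have := h1 (t - k) (by omega)
    rw [show k + (t - k) = t by omega] at this
    rw [← this]
    congr 1
    omega
  · have := h2 (k + 1 - t) (by omega)
    rw [show n - 1 - (n - 2 - k + (k + 1 - t)) = t by omega] at this
    rw [← this]
    congr 1
    omega

/-- Take the least stage containing the closed sequence. It is not stage 0 by `hbase`, so the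
sequence traverses an entire arc added last. If the remainder stays in the previous stage, it joins
vertices at distance n+1 there, giving length at least (n-1) + (n+1). Otherwise it traverses a
second new arc, giving at least 2n-2; equality would make the second arc the reverse of the first.
-/
theorem IsClosedSeq.two_mul_le (hn : 3 ≤ n) (hb : (freeCompletion n H).IsBipartite)
    (hbase : ∀ m f, ¬ IsClosedSeq H m f) {m : ℕ} {f : ℕ → FreeCompletionVertex n H}
    (hf : IsClosedSeq (freeCompletion n H) m f) : 2 * n ≤ m := by
  classical
  have hm := hf.pos
  have hex : ∃ L, ∀ i, f i ∈ lev n H L := by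
    obtain ⟨L, hL⟩ := exists_subset_lev ((Finset.range m).image f)
    refine ⟨L, fun i => ?_⟩
    rw [← hf.apply_mod]
    exact hL (Finset.mem_coe.2 (Finset.mem_image_of_mem f (by simpa using Nat.mod_lt i hm)))
  have h1 := Nat.find_spec hex
  rcases Nat.eq_zero_or_pos (Nat.find hex) with h0 | h0
  · rw [h0] at h1
    choose g hg using fun i => exists_baseVertex (h1 i)
    refine absurd (⟨hm, fun i => ?_, fun i => ?_, fun i => ?_⟩ : IsClosedSeq H m g) (hbase m g)
    · have := hf.period i
      rw [hg, hg] at this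
      exact baseVertex_injective this
    · have := hf.adj i
      rw [hg, hg] at this
      exact (baseVertex_adj hn).1 this
    · intro e
      apply hf.ne i
      rw [hg, hg, e]
  obtain ⟨l, hl⟩ : ∃ l, Nat.find hex = l + 1 := ⟨Nat.find hex - 1, by omega⟩
  rw [hl] at h1
  obtain ⟨i, hi⟩ := not_forall.1 (Nat.find_min hex (show l < Nat.find hex by omega))
  -- Shifting by n periods provides a position at least n, as `exists_run` requires.
  rw [← hf.period_mul i n] at hi
  obtain ⟨a, p, hp, -, -, hap⟩ := exists_run hn h1 hf.adj hf.ne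
    (show n ≤ i + n * m by nlinarith) hi
  clear hi
  have hf' := hf.shift a
  have h1' : ∀ i, f (a + i) ∈ lev n H (l + 1) := fun i => h1 _
  generalize hg : (fun i => f (a + i)) = g at hf'
  replace hap : ∀ t ≤ n - 1, g t = p t := fun t ht => by rw [← hg]; exact hap t ht
  replace h1' : ∀ i, g i ∈ lev n H (l + 1) := fun i => by rw [← hg]; exact h1 _
  clear hg h1 h0 hf hex hl f
  have hgm : g m = g 0 := by simpa using hf'.period 0
  have hends := hp.ends hn
  rw [← hap _ (by omega), ← hap _ le_rfl] at hends
  have hnot : ∀ t, 0 < t → t < n - 1 → g t ∉ lev n H l := fun t h0 h1 => by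
    rw [hap t (by omega)]
    exact hp.notMem hn h0 h1
  have hmn : n - 1 < m := by
    by_contra! hcon
    have := (hp.isPathSeq hn).inj (Set.mem_Iic.2 hcon) (Set.mem_Iic.2 (Nat.zero_le _))
      (by rw [← hap _ hcon, ← hap _ (Nat.zero_le _), hgm])
    omega
  by_cases hb2 : ∃ b, n - 1 < b ∧ b < m ∧ g b ∉ lev n H l
  · obtain ⟨b, hb1, hbm, hbl⟩ := hb2
    obtain ⟨a', q, hq, ha1, ha2, hqt⟩ := exists_run hn h1' hf'.adj hf'.ne (by omega) hbl
    have hends' := hq.ends hn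
    rw [← hqt _ (by omega), ← hqt _ le_rfl] at hends'
    have hnot' : ∀ t, 0 < t → t < n - 1 → g (a' + t) ∉ lev n H l := fun t h0 h1 => by
      rw [hqt t (by omega)]
      exact hq.notMem hn h0 h1
    have ha'n : n - 1 ≤ a' := by
      by_contra! hcon
      rcases Nat.eq_zero_or_pos a' with h | h
      · omega
      · exact hnot a' h hcon hends'.1
    have ha'm : a' + (n - 1) ≤ m := by
      by_contra! hcon
      have := hnot' (m - a') (by omega) (by omega)
      rw [show a' + (m - a') = m by omega, hgm] at this
      exact this hends.1
    by_contra! hlt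
    have hcol : Even m := by
      obtain ⟨c⟩ := hb
      obtain ⟨w, hw, -⟩ := exists_walk_of_adj m g (fun i _ => hf'.adj i)
      have c' : (freeCompletion n H).Coloring Bool :=
        (SimpleGraph.recolorOfEquiv _ finTwoEquiv) c
      have := c'.even_length_iff_congr w
      rw [hw, hgm] at this
      exact this.2 Iff.rfl
    -- Evenness excludes 2n-1.
    have hm2 : m = 2 * n - 2 := by
      obtain ⟨r, hr⟩ := hcol
      omega
    have ha'' : a' = n - 1 := by omega
    have e := hq.eq_of_ends hp.reverse hn
      (by rw [← hqt _ (by omega), Nat.sub_zero, ← hap _ le_rfl, ha'']; rfl)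
      (by rw [← hqt _ le_rfl, Nat.sub_self, ← hap _ (by omega), ← hgm]; congr 1; omega)
      (show 1 ≤ n - 1 by omega)
    rw [← hqt _ (by omega), ← hap _ (by omega)] at e
    apply hf'.ne (n - 1 - 1)
    rw [← e]
    congr 1
    omega
  · push Not at hb2
    have hin : ∀ t ≤ m - (n - 1), g (n - 1 + t) ∈ lev n H l := by
      intro t ht
      rcases Nat.eq_zero_or_pos t with rfl | h0
      · exact hends.2
      rcases ht.eq_or_lt with rfl | h
      · rw [show n - 1 + (m - (n - 1)) = m by omega, hgm]
        exact hends.1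
      · exact hb2 _ (by omega) (by omega)
    obtain ⟨w, hw, -⟩ := exists_walk_of_adj (G := (freeStage n H l).spanningCoe) (m - (n - 1))
      (fun t => (g (n - 1 + t)).1)
      (fun t ht => stage_adj_of_adj hn (hin _ (by omega)) (hin _ (by omega)) (hf'.adj _))
    have h2 := SimpleGraph.dist_le w
    have h3 := hp.dist_eq hn
    rw [← hap _ (by omega), ← hap _ le_rfl] at h3
    rw [hw, SimpleGraph.dist_comm] at h2
    simp only [Nat.add_zero, show n - 1 + (m - (n - 1)) = m by omega, hgm] at h2
    omega

theorem largeGirth_freeCompletion (hn : 3 ≤ n) (hb : (freeCompletion n H).IsBipartite)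
    (hbase : ∀ m f, ¬ IsClosedSeq H m f) : LargeGirth n (freeCompletion n H) := by
  intro a w hw
  obtain ⟨f, hf⟩ := exists_isClosedSeq hw
  exact hf.two_mul_le hn hb hbase

end Girth

/-! ### The polygon `Γ^{n+3}` -/

section General

variable {V : Type u} {G : SimpleGraph V} {n : ℕ}

theorem HasPiece.anti {T T' : Set V} {C : Finset V} (h : HasPiece n G T C) (hT : T' ⊆ T) :
    HasPiece n G T' C := by
  rcases h with ⟨z, hz, hzT, hd⟩ | ⟨p, hp, hpC, hpi⟩
  · exact Or.inl ⟨z, hz, fun h => hzT (hT h), hd⟩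
  · exact Or.inr ⟨p, hp, hpC, fun i h0 h1 => ⟨fun h => (hpi i h0 h1).1 (hT h), (hpi i h0 h1).2⟩⟩

open Classical in
/-- The set of the first `m + 1` terms of a sequence. -/
noncomputable def initialImage (m : ℕ) (p : ℕ → V) : Finset V := (Finset.range (m + 1)).image p

theorem mem_initialImage {m : ℕ} {p : ℕ → V} {x : V} :
    x ∈ initialImage m p ↔ ∃ t ≤ m, p t = x := by
  simp [initialImage]

theorem IsPathSeq.card_image {m : ℕ} {p : ℕ → V} (hp : IsPathSeq G m p) :
    (initialImage m p).card = m + 1 := by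
  classical
  rw [initialImage, Finset.card_image_of_injOn, Finset.card_range]
  intro a ha b hb e
  exact hp.inj (by simp at ha; simp; omega) (by simp at hb; simp; omega) e

open Classical in
theorem IsPathSeq.le_e2 {m : ℕ} {p : ℕ → V} (hp : IsPathSeq G m p) :
    2 * m ≤ e2 G (initialImage m p) := by
  have h := (e2_union_chain (G := G) (A := {p 0}) (p := p) (by simp) m hp.adj
    (fun i h1 h2 => by
      rw [Finset.mem_singleton, hp.eq_iff h2 (Nat.zero_le _)]
      omega)
    (fun a ha b hb e => hp.inj ha.2 hb.2 e)).1
  have e : ({p 0} ∪ (Finset.Icc 1 m).image p) = initialImage m p := by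
    ext x
    simp only [Finset.mem_union, Finset.mem_singleton, Finset.mem_image, Finset.mem_Icc,
      mem_initialImage]
    constructor
    · rintro (rfl | ⟨i, hi, rfl⟩)
      · exact ⟨0, by omega, rfl⟩
      · exact ⟨i, by omega, rfl⟩
    · rintro ⟨i, hi, rfl⟩
      rcases Nat.eq_zero_or_pos i with rfl | h0
      · exact Or.inl rfl
      · exact Or.inr ⟨i, by omega, rfl⟩
  rw [e] at h
  omega

theorem IsPathSeq.defect_le {m : ℕ} {p : ℕ → V} (hn : 2 ≤ n) (hp : IsPathSeq G m p) :
    defect n G (initialImage m p) ≤ 2 * ((n : ℤ) - 1 + m) := by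
  unfold defect
  have h1 : (2 * m : ℤ) ≤ e2 G (initialImage m p) := by exact_mod_cast hp.le_e2
  have h2 : (2 : ℤ) ≤ n := by exact_mod_cast hn
  rw [hp.card_image]
  push_cast
  nlinarith

/-- Peeling off loose ends removes at most one edge per vertex and none with the last vertex. -/
theorem e2_le_of_looseEnds (A : Finset V) (hne : A.Nonempty)
    (h : ∀ C ⊆ A, C.Nonempty → ∃ z ∈ C, dg G C z ≤ 1) : e2 G A + 2 ≤ 2 * A.card := by
  classical
  induction hc : A.card using Nat.strong_induction_on generalizing A with
  | _ c ih =>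
    obtain ⟨z, hz, hd⟩ := h A subset_rfl hne
    have h1 := e2_erase (G := G) hz
    have h2 := Finset.card_erase_add_one hz
    rcases (A.erase z).eq_empty_or_nonempty with h0 | h0
    · have h3 : dg G A z = 0 := by
        rw [← Finset.insert_erase hz, h0, dg_insert_self]
        simp [dg]
      rw [h0, e2_empty, h3] at h1
      omega
    · have := ih _ (by omega) (A.erase z) h0
        (fun C hC => h C (hC.trans (Finset.erase_subset _ _))) rfl
      omega

/-- If the vertex set were finite, openness would apply to all of it and provide a vertex of valency
at most two; for clean arcs this uses that n ≥ 3 gives an interior vertex. -/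
theorem infinite_of_thick (hn : 3 ≤ n) [Nonempty V] (ht : ∀ v : V, 3 ≤ (G.neighborSet v).encard)
    (hop : ∀ A : Finset V, A.Nonempty → HasPiece n G ∅ A) : Infinite V := by
  classical
  by_contra hfin
  rw [not_infinite_iff_finite] at hfin
  have := Fintype.ofFinite V
  have hd : ∀ v, 3 ≤ dg G Finset.univ v := by
    intro v
    have h1 := ht v
    have h2 : G.neighborSet v = (Finset.univ.filter (G.Adj v) : Finset V) := by
      ext
      simp
    rw [h2, Set.encard_coe_eq_coe_finsetCard] at h1
    unfold dg
    exact_mod_cast h1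
  rcases hop Finset.univ Finset.univ_nonempty with ⟨z, -, -, hz⟩ | ⟨p, -, -, hpi⟩
  · have := hd z
    omega
  · have := (hpi 1 (by omega) (by omega)).2
    have := hd (p 1)
    omega

theorem two_le_encard {v a b : V} (hab : a ≠ b) (ha : G.Adj v a) (hb : G.Adj v b) :
    2 ≤ (G.neighborSet v).encard := by
  rw [← Set.encard_pair hab]
  exact Set.encard_le_encard (by rintro x (rfl | rfl) <;> assumption)

theorem three_le_encard {v a b c : V} (hab : a ≠ b) (hac : a ≠ c) (hbc : b ≠ c) (ha : G.Adj v a)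
    (hb : G.Adj v b) (hc : G.Adj v c) : 3 ≤ (G.neighborSet v).encard := by
  rw [← Set.encard_eq_three.2 ⟨a, b, c, hab, hac, hbc, rfl⟩]
  exact Set.encard_le_encard (by rintro x (rfl | rfl | rfl) <;> assumption)

theorem abs_sub_le_length {f : V → ℤ} (hf : ∀ a b, G.Adj a b → |f a - f b| ≤ 1) {x y : V}
    (w : G.Walk x y) : |f x - f y| ≤ w.length := by
  induction w with
  | nil => simp
  | @cons x z y h w ih =>
    have := hf _ _ h
    rw [SimpleGraph.Walk.length_cons]
    push_cast
    rw [abs_le] at *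
    omega

end General

section Gamma

variable {n : ℕ}

/-- The path `(x₀, …, xₙ₊₃)` in `Γ^{n+3}`. -/
def gammaPath (n t : ℕ) : GammaVertex n (n + 3) :=
  baseVertex n _ ⟨min t (n + 3), by omega⟩

theorem gammaPath_val (n : ℕ) {t : ℕ} (ht : t ≤ n + 3) :
    gammaPath n t = baseVertex n _ ⟨t, by omega⟩ := by
  simp [gammaPath, min_eq_left ht]

theorem isPathSeq_gammaPath (hn : 3 ≤ n) : IsPathSeq (Gamma n (n + 3)) (n + 3) (gammaPath n) where
  adj i hi := by
    rw [gammaPath_val n (by omega), gammaPath_val n (by omega)]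
    refine (baseVertex_adj hn).2 ?_
    rw [SimpleGraph.pathGraph_adj]
    left
    rfl
  inj a ha b hb e := by
    simp only [Set.mem_Iic] at ha hb
    rw [gammaPath_val n ha, gammaPath_val n hb] at e
    simpa using baseVertex_injective e

theorem gammaPath_mem (t : ℕ) : gammaPath n t ∈ lev n (SimpleGraph.pathGraph (n + 3 + 1)) 0 :=
  baseVertex_mem _

theorem exists_gammaPath {a : GammaVertex n (n + 3)}
    (h : a ∈ lev n (SimpleGraph.pathGraph (n + 3 + 1)) 0) : ∃ t ≤ n + 3, a = gammaPath n t := by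
  obtain ⟨v, rfl⟩ := exists_baseVertex h
  exact ⟨v, by omega, (gammaPath_val n (by omega)).symm⟩

theorem gamma_adj_gammaPath (hn : 3 ≤ n) {s t : ℕ} (hs : s ≤ n + 3) (ht : t ≤ n + 3) :
    (Gamma n (n + 3)).Adj (gammaPath n s) (gammaPath n t) ↔ s + 1 = t ∨ t + 1 = s := by
  rw [gammaPath_val n hs, gammaPath_val n ht]
  exact (baseVertex_adj hn).trans SimpleGraph.pathGraph_adj

theorem gamma_exists_walk (hn : 3 ≤ n) (x y : GammaVertex n (n + 3)) :
    ∃ w : (Gamma n (n + 3)).Walk x y, w.length ≤ n :=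
  freeCompletion_exists_walk hn (SimpleGraph.pathGraph_connected _) x y

theorem gamma_isBipartite (hn : 3 ≤ n) : (Gamma n (n + 3)).IsBipartite :=
  freeCompletion_isBipartite hn (SimpleGraph.pathGraph.bicoloring _)

theorem gamma_largeGirth (hn : 3 ≤ n) : LargeGirth n (Gamma n (n + 3)) :=
  largeGirth_freeCompletion hn (gamma_isBipartite hn) fun _ f => not_isClosedSeq_pathGraph f

theorem gamma_exists_looseEnd (hn : 3 ≤ n) (C : Finset (GammaVertex n (n + 3))) (hne : C.Nonempty)
    (hC : (C : Set (GammaVertex n (n + 3))) ⊆ lev n (SimpleGraph.pathGraph (n + 3 + 1)) 0) :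
    ∃ z ∈ C, dg (Gamma n (n + 3)) C z ≤ 1 := by
  classical
  have hex : ∃ t, t ≤ n + 3 ∧ gammaPath n t ∈ C := by
    obtain ⟨z, hz⟩ := hne
    obtain ⟨t, ht, rfl⟩ := exists_gammaPath (hC hz)
    exact ⟨t, ht, hz⟩
  have h1 := Nat.find_spec hex
  refine ⟨_, h1.2, (Finset.card_le_card (t := {gammaPath n (Nat.find hex + 1)}) ?_).trans (by simp)⟩
  intro w hw
  rw [Finset.mem_filter] at hw
  obtain ⟨t, ht, rfl⟩ := exists_gammaPath (hC hw.1)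
  have h2 := Nat.find_min' hex ⟨ht, hw.1⟩
  have h3 := (gamma_adj_gammaPath hn h1.1 ht).1 hw.2
  rw [Finset.mem_singleton, show Nat.find hex + 1 = t by omega]

theorem gamma_hasPiece (hn : 3 ≤ n) (C : Finset (GammaVertex n (n + 3))) (hne : C.Nonempty) :
    HasPiece n (Gamma n (n + 3)) ∅ C := by
  by_cases hC : (C : Set (GammaVertex n (n + 3))) ⊆ lev n (SimpleGraph.pathGraph (n + 3 + 1)) 0
  · obtain ⟨z, hz, hd⟩ := gamma_exists_looseEnd hn C hne hC
    exact Or.inl ⟨z, hz, by simp, hd⟩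
  · exact (hasPiece_lev hn 0 C hC).anti (by simp)

/-- The vertex set of the path `(x₀, …, xₙ₊₃)` in `Γ^{n+3}`. -/
noncomputable def gammaBase (n : ℕ) : Finset (GammaVertex n (n + 3)) :=
  initialImage (n + 3) (gammaPath n)

theorem mem_gammaBase {a : GammaVertex n (n + 3)} :
    a ∈ gammaBase n ↔ a ∈ lev n (SimpleGraph.pathGraph (n + 3 + 1)) 0 := by
  rw [gammaBase, mem_initialImage]
  constructor
  · rintro ⟨t, -, rfl⟩
    exact gammaPath_mem t
  · intro h
    obtain ⟨t, ht, rfl⟩ := exists_gammaPath h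
    exact ⟨t, ht, rfl⟩

theorem gammaPath_mem_gammaBase (t : ℕ) : gammaPath n t ∈ gammaBase n :=
  mem_gammaBase.2 (gammaPath_mem t)

theorem gammaBase_defect_le (hn : 3 ≤ n) : defect n (Gamma n (n + 3)) (gammaBase n) ≤ 4 * n + 4 := by
  have := (isPathSeq_gammaPath hn).defect_le (n := n) (by omega)
  push_cast at this
  have h2 : defect n (Gamma n (n + 3)) (gammaBase n) ≤ 2 * ((n : ℤ) - 1 + (n + 3)) := this
  omega

theorem le_gammaBase_defect (hn : 3 ≤ n) :
    4 * (n : ℤ) + 4 ≤ defect n (Gamma n (n + 3)) (gammaBase n) := by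
  have h1 := e2_le_of_looseEnds (G := Gamma n (n + 3)) (gammaBase n)
    ⟨_, gammaPath_mem_gammaBase 0⟩ fun C hC hne => gamma_exists_looseEnd hn C hne fun a ha =>
      mem_gammaBase.1 (hC ha)
  have h2 : (gammaBase n).card = n + 3 + 1 := (isPathSeq_gammaPath hn).card_image
  rw [h2] at h1
  unfold defect
  rw [h2]
  have h3 : (e2 (Gamma n (n + 3)) (gammaBase n) : ℤ) ≤ 2 * (n + 3) := by
    have : e2 (Gamma n (n + 3)) (gammaBase n) ≤ 2 * (n + 3) := by omega
    exact_mod_cast this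
  have h4 : (3 : ℤ) ≤ n := by exact_mod_cast hn
  push_cast
  nlinarith

/-- Stripping the pieces outside stage 0 leads back to the base path and does not raise the defect.
-/
theorem gamma_defect_ge (hn : 3 ≤ n) {A : Finset (GammaVertex n (n + 3))} (hA : gammaBase n ⊆ A) :
    4 * (n : ℤ) + 4 ≤ defect n (Gamma n (n + 3)) A := by
  classical
  have h1 := defect_filter_le (G := Gamma n (n + 3)) hn
    (T := lev n (SimpleGraph.pathGraph (n + 3 + 1)) 0) A fun C _ hC => hasPiece_lev hn 0 C hC
  refine le_trans ?_ h1
  have h2 : A.filter (· ∈ lev n (SimpleGraph.pathGraph (n + 3 + 1)) 0) = gammaBase n := by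
    ext x
    rw [Finset.mem_filter, mem_gammaBase]
    exact ⟨fun h => h.2, fun h => ⟨hA (mem_gammaBase.2 h), h⟩⟩
  rw [h2]
  exact le_gammaBase_defect hn

theorem gamma_exists_superset (hn : 3 ≤ n) (F : Finset (GammaVertex n (n + 3))) :
    ∃ C : Finset (GammaVertex n (n + 3)), gammaBase n ⊆ C ∧ F ⊆ C ∧
      defect n (Gamma n (n + 3)) C ≤ 4 * n + 4 := by
  classical
  obtain ⟨I, hI⟩ := exists_subset_lev (gammaBase n ∪ F)
  obtain ⟨C, h1, h2, -, h3⟩ := exists_finset_superset_defect_le hn (C := gammaBase n)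
    (fun _ ha => mem_gammaBase.2 ha)
    (fun x hx => hI (Finset.mem_coe.2 (Finset.mem_union_left _ hx)))
    (gammaBase_defect_le hn) F (fun x hx => hI (Finset.mem_coe.2 (Finset.mem_union_right _ hx)))
  exact ⟨C, h1, h2, h3⟩

theorem gamma_exists_arc (hn : 3 ≤ n) {i : ℕ} (hi : i ≤ 2) :
    ∃ p, IsStageArc n (SimpleGraph.pathGraph (n + 3 + 1)) 0 p ∧ p 0 = gammaPath n i ∧
      p (n - 1) = gammaPath n (i + n + 1) := by
  apply exists_stageArc hn
  rw [gammaPath_val n (by omega), gammaPath_val n (by omega)]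
  apply le_antisymm
  · obtain ⟨w, hw, -⟩ := exists_walk_of_adj
      (G := (freeStage n (SimpleGraph.pathGraph (n + 3 + 1)) 0).spanningCoe) (n + 1)
      (fun t => (gammaPath n (i + t)).1) (fun t ht => by
        refine ⟨⟨i + t, by omega⟩, ⟨i + (t + 1), by omega⟩, ?_, ?_, ?_⟩
        · rw [SimpleGraph.pathGraph_adj]; left; rfl
        · rw [gammaPath_val n (by omega)]; rfl
        · rw [gammaPath_val n (by omega)]; rfl)
    have := SimpleGraph.dist_le w
    rw [hw] at this
    rw [gammaPath_val n (by omega), gammaPath_val n (by omega)] at this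
    exact this
  · obtain ⟨w, hw⟩ : ∃ w : (freeStage n (SimpleGraph.pathGraph (n + 3 + 1)) 0).spanningCoe.Walk
        (baseVertex n (SimpleGraph.pathGraph (n + 3 + 1)) ⟨i, by omega⟩).1
        (baseVertex n (SimpleGraph.pathGraph (n + 3 + 1)) ⟨i + n + 1, by omega⟩).1,
        w.length = (freeStage n (SimpleGraph.pathGraph (n + 3 + 1)) 0).spanningCoe.dist _ _ := by
      apply SimpleGraph.Reachable.exists_walk_length_eq_dist
      obtain ⟨w⟩ := (SimpleGraph.pathGraph_connected (n + 3)).preconnected ⟨i, by omega⟩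
        ⟨i + n + 1, by omega⟩
      let φ : SimpleGraph.pathGraph (n + 3 + 1) →g
          (freeStage n (SimpleGraph.pathGraph (n + 3 + 1)) 0).spanningCoe :=
        ⟨FreeVertex.base, fun h => ⟨_, _, h, rfl, rfl⟩⟩
      exact ⟨w.map φ⟩
    -- The position on the path changes by at most one along an edge, which bounds distances from
    -- below. The value on arc vertices is immaterial, as stage 0 has no edges there.
    let f : FreeVertex (Fin (n + 3 + 1)) → ℤ := fun v => match v with
      | .base v => (v : ℕ)
      | .arc _ _ _ => 0
    have h1 := abs_sub_le_length (f := f) (fun a b hab => by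
      obtain ⟨v, w, h, rfl, rfl⟩ := hab
      rw [SimpleGraph.pathGraph_adj] at h
      show |((v : ℕ) : ℤ) - ((w : ℕ) : ℤ)| ≤ 1
      rw [abs_le]
      omega) w
    rw [hw] at h1
    have h2 : |((i : ℕ) : ℤ) - ((i + n + 1 : ℕ) : ℤ)| ≤ _ := h1
    rw [abs_le] at h2
    push_cast at h2
    omega

/-- The end vertices of the base path receive their second neighbour from the arcs between x₀ and
xₙ₊₁ and between x₂ and xₙ₊₃. -/
theorem gamma_two_le_encard (hn : 3 ≤ n) (v : GammaVertex n (n + 3)) :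
    2 ≤ ((Gamma n (n + 3)).neighborSet v).encard := by
  have hpath := isPathSeq_gammaPath hn
  by_cases hv : v ∈ lev n (SimpleGraph.pathGraph (n + 3 + 1)) 0
  · obtain ⟨t, ht, rfl⟩ := exists_gammaPath hv
    have hout : ∀ {p : ℕ → GammaVertex n (n + 3)} {k s : ℕ},
        IsStageArc n (SimpleGraph.pathGraph (n + 3 + 1)) 0 p → 0 < k → k < n - 1 →
        p k ≠ gammaPath n s := fun hp h0 h1 e => hp.notMem hn h0 h1 (e ▸ gammaPath_mem _)
    rcases Nat.eq_zero_or_pos t with rfl | h0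
    · obtain ⟨p, hp, h0, -⟩ := gamma_exists_arc hn (show 0 ≤ 2 by omega)
      have h1 := (hp.isPathSeq hn).adj 0 (by omega)
      rw [h0] at h1
      exact two_le_encard (hout hp (by omega) (by omega)) h1 (hpath.adj 0 (by omega))
    rcases ht.eq_or_lt with rfl | h1
    · obtain ⟨p, hp, -, h1⟩ := gamma_exists_arc hn (show 2 ≤ 2 by omega)
      have h2 := ((hp.isPathSeq hn).adj (n - 1 - 1) (by omega)).symm
      rw [show n - 1 - 1 + 1 = n - 1 by omega, h1, show 2 + n + 1 = n + 3 by omega] at h2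
      exact two_le_encard (hout hp (by omega) (by omega)) h2 (hpath.adj (n + 2) (by omega)).symm
    · have h2 := hpath.adj (t - 1) (by omega)
      rw [show t - 1 + 1 = t by omega] at h2
      refine two_le_encard ?_ h2.symm (hpath.adj t h1)
      rw [Ne, hpath.eq_iff (by omega) (by omega)]
      omega
  · obtain ⟨i, hi⟩ := exists_mem_lev v
    induction i with
    | zero => exact absurd hi hv
    | succ i ih =>
      by_cases hvi : v ∈ lev n (SimpleGraph.pathGraph (n + 3 + 1)) i
      · exact ih hvi
      · obtain ⟨p, k, hp, h0, h1, rfl⟩ := exists_stageArc_of_mem hn hi hvi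
        have hpp := hp.isPathSeq hn
        have h2 := hpp.adj (k - 1) (by omega)
        rw [show k - 1 + 1 = k by omega] at h2
        refine two_le_encard ?_ h2.symm (hpp.adj k h1)
        rw [Ne, hpp.eq_iff (by omega) (by omega)]
        omega

theorem gamma_three_le_encard_gammaPath (hn : 3 ≤ n) {i : ℕ} (h0 : 0 < i) (h2 : i ≤ 2) :
    3 ≤ ((Gamma n (n + 3)).neighborSet (gammaPath n i)).encard := by
  have hpath := isPathSeq_gammaPath hn
  obtain ⟨p, hp, hp0, -⟩ := gamma_exists_arc hn h2
  have hout : ∀ {s : ℕ}, p 1 ≠ gammaPath n s := fun e =>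
    hp.notMem hn (show 0 < 1 by omega) (by omega) (e ▸ gammaPath_mem _)
  have h1 := hpath.adj (i - 1) (by omega)
  rw [show i - 1 + 1 = i by omega] at h1
  have h3 := (hp.isPathSeq hn).adj 0 (by omega)
  rw [hp0] at h3
  refine three_le_encard hout hout ?_ h3 h1.symm (hpath.adj i (by omega))
  rw [Ne, hpath.eq_iff (by omega) (by omega)]
  omega

/-- The adjacent vertices x₁ and x₂ have a third neighbour on a first-stage arc, and `thick_of_adj`
spreads this to all vertices. -/
theorem gamma_thick (hn : 3 ≤ n) (v : GammaVertex n (n + 3)) :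
    3 ≤ ((Gamma n (n + 3)).neighborSet v).encard :=
  thick_of_adj hn (gamma_isBipartite hn) (gamma_exists_walk hn) (gamma_largeGirth hn)
    (gamma_two_le_encard hn) ((isPathSeq_gammaPath hn).adj 1 (by omega))
    (gamma_three_le_encard_gammaPath hn (by omega) (by omega))
    (gamma_three_le_encard_gammaPath hn (by omega) (by omega)) v

theorem gamma_isGeneralizedPolygon (hn : 3 ≤ n) : IsGeneralizedPolygon n (Gamma n (n + 3)) := by
  have : Nonempty (GammaVertex n (n + 3)) := ⟨gammaPath n 0⟩
  exact isGeneralizedPolygon_of hn (gamma_isBipartite hn) (gamma_exists_walk hn)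
    (gamma_largeGirth hn) (gamma_thick hn)

theorem gamma_isOpenPolygon (hn : 3 ≤ n) : IsOpenPolygon n (Gamma n (n + 3)) :=
  ⟨gamma_isGeneralizedPolygon hn, isOpenGraph_of_hasPiece (gamma_hasPiece hn) hn⟩

theorem gamma_infinite (hn : 3 ≤ n) : Infinite (GammaVertex n (n + 3)) := by
  have : Nonempty (GammaVertex n (n + 3)) := ⟨gammaPath n 0⟩
  exact infinite_of_thick hn (gamma_thick hn) (gamma_hasPiece hn)

end Gamma

/-! ### Elementary substructures -/

section Patterns

variable {V : Type u} {G : SimpleGraph V} {n : ℕ}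

/-- Finite configurations have copies inside `S`, over each finite subset of `S`. -/
def CopiesPatterns (G : SimpleGraph V) (S : Set V) : Prop :=
  ∀ A F : Finset V, (A : Set V) ⊆ S → A ⊆ F → ∃ g : V → V, (∀ a ∈ A, g a = a) ∧
    (∀ x ∈ F, g x ∈ S) ∧ Set.InjOn g F ∧ ∀ x ∈ F, ∀ y ∈ F, G.Adj x y → G.Adj (g x) (g y)

-- One formula records the edges, equalities and inequalities among `A` and `F`. Quantified
-- existentially over `F`, with parameters in `A`, it holds in the polygon and hence in the
-- substructure. Non-edges are not recorded, and extra edges in the copy do no harm since they only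
-- lower the defect.
open FirstOrder.Language in
theorem copiesPatterns_of_elementary (c : G.Coloring Bool) :
    letI := polygonStructure G c
    ∀ S : polygonLang.ElementarySubstructure V, CopiesPatterns G (S : Set V) := by
  classical
  let _ := polygonStructure G c
  intro S A F hAS hAF
  let val : A ⊕ F → V := Sum.elim (fun a => a.1) (fun x => x.1)
  let R : polygonLang.Relations 2 := PolygonRel.adj
  let f : (A ⊕ F) × (A ⊕ F) → polygonLang.Formula (A ⊕ F) := fun b =>
    (if G.Adj (val b.1) (val b.2) then R.formula₂ (Term.var b.1) (Term.var b.2) else ⊤) ⊓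
    (if val b.1 = val b.2 then Term.equal (Term.var b.1) (Term.var b.2)
      else (Term.equal (Term.var b.1) (Term.var b.2)).not)
  let φ : polygonLang.Formula (A ⊕ F) := Formula.iInf f
  have hφ : ∀ v : A ⊕ F → V, φ.Realize v ↔ ∀ x y, (G.Adj (val x) (val y) → G.Adj (v x) (v y)) ∧
      (val x = val y ↔ v x = v y) := by
    intro v
    have h1 : φ.Realize v ↔ ∀ b, (f b).Realize v := by
      show BoundedFormula.Realize (BoundedFormula.iInf f) v default ↔ _
      rw [BoundedFormula.realize_iInf]
      rfl
    rw [h1, Prod.forall]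
    refine forall_congr' fun x => forall_congr' fun y => ?_
    simp only [f, Formula.realize_inf]
    refine and_congr ?_ ?_
    · split_ifs with h
      · simp only [h, true_imp_iff, Formula.realize_rel₂, Term.realize_var]
        exact Iff.rfl
      · simp [h]
    · split_ifs with h <;> simp [h, Formula.realize_equal, Formula.realize_not]
  have hval : φ.Realize val := (hφ val).2 fun x y => ⟨id, Iff.rfl⟩
  let a : A → S := fun a => ⟨a.1, hAS a.2⟩
  have h1 : (φ.iExs F).Realize (S.subtype ∘ a) :=
    Formula.realize_iExs.2 ⟨fun x => x.1, by
      convert hval using 1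
      funext x
      rcases x with x | x <;> rfl⟩
  rw [ElementaryEmbedding.map_formula, Formula.realize_iExs] at h1
  obtain ⟨i, hi⟩ := h1
  rw [← ElementaryEmbedding.map_formula S.subtype, hφ] at hi
  refine ⟨fun x => if h : x ∈ F then (i ⟨x, h⟩).1 else x, fun x hx => ?_, fun x hx => ?_, ?_, ?_⟩
  · simp only [dif_pos (hAF hx)]
    exact ((hi (Sum.inl ⟨x, hx⟩) (Sum.inr ⟨x, hAF hx⟩)).2.1 rfl).symm
  · simp only [dif_pos hx]
    exact (i ⟨x, hx⟩).2
  · intro x hx y hy e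
    simp only [dif_pos (Finset.mem_coe.1 hx), dif_pos (Finset.mem_coe.1 hy)] at e
    exact (hi (Sum.inr ⟨x, hx⟩) (Sum.inr ⟨y, hy⟩)).2.2 e
  · intro x hx y hy h
    simp only [dif_pos hx, dif_pos hy]
    exact (hi (Sum.inr ⟨x, hx⟩) (Sum.inr ⟨y, hy⟩)).1 h

open Classical in
theorem dg_le_image {W : Type*} {K : SimpleGraph W} {F : Finset W} {g : W → V}
    (hinj : Set.InjOn g F) (hadj : ∀ x ∈ F, ∀ y ∈ F, K.Adj x y → G.Adj (g x) (g y)) {x : W}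
    (hx : x ∈ F) : dg K F x ≤ dg G (F.image g) (g x) := by
  unfold dg
  rw [← Finset.card_image_of_injOn (f := g) (s := F.filter (K.Adj x))
    (hinj.mono (fun y hy => (Finset.mem_filter.1 hy).1))]
  refine Finset.card_le_card fun y hy => ?_
  obtain ⟨z, hz, rfl⟩ := Finset.mem_image.1 hy
  rw [Finset.mem_filter] at hz ⊢
  exact ⟨Finset.mem_image_of_mem g hz.1, hadj x hx z hz.1 hz.2⟩

open Classical in
theorem e2_le_image {W : Type*} {K : SimpleGraph W} {F : Finset W} {g : W → V}
    (hinj : Set.InjOn g F) (hadj : ∀ x ∈ F, ∀ y ∈ F, K.Adj x y → G.Adj (g x) (g y)) :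
    e2 K F ≤ e2 G (F.image g) := by
  unfold e2
  rw [Finset.sum_image hinj]
  exact Finset.sum_le_sum fun x hx => dg_le_image hinj hadj hx

open Classical in
theorem defect_image_le {W : Type*} {K : SimpleGraph W} (hn : 2 ≤ n) {F : Finset W} {g : W → V}
    (hinj : Set.InjOn g F) (hadj : ∀ x ∈ F, ∀ y ∈ F, K.Adj x y → G.Adj (g x) (g y)) :
    defect n G (F.image g) ≤ defect n K F := by
  unfold defect
  rw [Finset.card_image_of_injOn hinj]
  have h1 : (e2 K F : ℤ) ≤ e2 G (F.image g) := by exact_mod_cast e2_le_image hinj hadj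
  have h2 : (2 : ℤ) ≤ n := by exact_mod_cast hn
  nlinarith

/-- A piece of a union of copies of `D` over its neighbourhood `A` gives a piece in one copy. -/
theorem hasPiece_of_copies {A D E U : Finset V} (hn : 3 ≤ n)
    (hnbr : ∀ d ∈ D, ∀ e ∈ E, G.Adj d e → e ∈ A ∨ e ∈ D)
    {h : Fin 3 → V → V} (hA : ∀ k, ∀ a ∈ A, h k a = a)
    (hinj : ∀ k, Set.InjOn (h k) (A ∪ D : Set V))
    (hadj : ∀ k, ∀ x ∈ D, ∀ y, y ∈ A ∨ y ∈ D → G.Adj x y → G.Adj (h k x) (h k y))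
    (hdis : ∀ k l, ∀ x ∈ D, ∀ y ∈ D, h k x = h l y → k = l)
    (hDA : ∀ a ∈ A, ∃ d ∈ D, G.Adj d a) (hDE : D ⊆ E)
    (hU : ∀ x, x ∈ U ↔ x ∈ A ∨ ∃ k, ∃ d ∈ D, h k d = x) (hp : HasPiece n G ∅ U) :
    (∃ z ∈ D, dg G E z ≤ 1) ∨ ∃ p : ℕ → V, IsPathSeq G (n - 1) p ∧ (∀ i ≤ n - 1, p i ∈ E) ∧
      ∀ i, 0 < i → i < n - 1 → p i ∈ D ∧ dg G E (p i) ≤ 2 := by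
  classical
  -- Disjointness of the three copies gives every vertex of `A` valency at least three in `U`; so
  -- loose ends and interior vertices of clean arcs of `U` lie in the copies of `D`.
  have hAU : ∀ a ∈ A, 3 ≤ dg G U a := by
    intro a ha
    obtain ⟨d, hd, hda⟩ := hDA a ha
    have key : ∀ k, h k d ∈ U ∧ G.Adj a (h k d) := fun k => by
      refine ⟨(hU _).2 (Or.inr ⟨k, d, hd, rfl⟩), ?_⟩
      have := hadj k d hd a (Or.inl ha) hda
      rw [hA k a ha] at this
      exact this.symm
    exact three_le_dg (key 0).1 (key 1).1 (key 2).1 (fun e => by simpa using hdis _ _ d hd d hd e)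
      (fun e => by simpa using hdis _ _ d hd d hd e)
      (fun e => by simpa using hdis _ _ d hd d hd e) (key 0).2 (key 1).2 (key 2).2
  have hmemU : ∀ k, ∀ y, y ∈ A ∨ y ∈ D → h k y ∈ U := by
    rintro k y (hy | hy)
    · rw [hA k y hy]; exact (hU _).2 (Or.inl hy)
    · exact (hU _).2 (Or.inr ⟨k, y, hy, rfl⟩)
  have himg : ∀ k, ∀ d ∈ D, (E.filter (G.Adj d)).image (h k) ⊆ U.filter (G.Adj (h k d)) ∧
      ((E.filter (G.Adj d)).image (h k)).card = dg G E d := by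
    intro k d hd
    constructor
    · intro y hy
      obtain ⟨z, hz, rfl⟩ := Finset.mem_image.1 hy
      rw [Finset.mem_filter] at hz ⊢
      have := hnbr d hd z hz.1 hz.2
      exact ⟨hmemU k z this, hadj k d hd z this hz.2⟩
    · unfold dg
      refine Finset.card_image_of_injOn ((hinj k).mono fun z hz => ?_)
      rw [Finset.mem_coe, Finset.mem_filter] at hz
      exact hnbr d hd z hz.1 hz.2
  have hdeg : ∀ k, ∀ d ∈ D, dg G E d ≤ dg G U (h k d) := fun k d hd => by
    rw [← (himg k d hd).2]
    exact Finset.card_le_card (himg k d hd).1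
  rcases hp with ⟨z, hz, -, hd⟩ | ⟨p, hp, hpU, hpi⟩
  · rcases (hU z).1 hz with hzA | ⟨k, d, hdD, rfl⟩
    · have := hAU z hzA
      omega
    · exact Or.inl ⟨d, hdD, (hdeg k d hdD).trans hd⟩
  by_cases hloose : ∃ z ∈ D, dg G E z ≤ 1
  · exact Or.inl hloose
  push Not at hloose
  right
  have hint : ∀ i, 0 < i → i < n - 1 → ∃ k, ∃ d ∈ D, h k d = p i := by
    intro i h0 h1
    rcases (hU _).1 (hpU i h1.le) with hA' | h'
    · have := hAU _ hA'
      have := (hpi i h0 h1).2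
      omega
    · exact h'
  -- With no loose end in `D`, a copied vertex of valency at most two in `U` has all its
  -- `U`-neighbours in its own copy or in `A`. Hence a clean arc cannot pass to another copy and
  -- pulls back to `E`.
  have hsurj : ∀ k, ∀ d ∈ D, dg G U (h k d) ≤ 2 → ∀ y ∈ U, G.Adj (h k d) y →
      ∃ z ∈ E, G.Adj d z ∧ h k z = y := by
    intro k d hd h2 y hy hadj'
    have h3 := himg k d hd
    have h4 := Finset.eq_of_subset_of_card_le h3.1 (by
      rw [h3.2]
      have := hloose d hd
      exact le_trans h2 this)
    have h5 : y ∈ U.filter (G.Adj (h k d)) := Finset.mem_filter.2 ⟨hy, hadj'⟩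
    rw [← h4] at h5
    obtain ⟨z, hz, rfl⟩ := Finset.mem_image.1 h5
    rw [Finset.mem_filter] at hz
    exact ⟨z, hz.1, hz.2, rfl⟩
  obtain ⟨k, d1, hd1, e1⟩ := hint 1 (by omega) (by omega)
  have hall : ∀ i ≤ n - 1, ∃ z ∈ E, (z ∈ A ∨ z ∈ D) ∧ h k z = p i ∧ (0 < i → i < n - 1 → z ∈ D) := by
    have hpos : ∀ i, i + 1 ≤ n - 1 → ∃ z ∈ E, (z ∈ A ∨ z ∈ D) ∧ h k z = p (i + 1) ∧
        (i + 1 < n - 1 → z ∈ D) := by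
      intro i
      induction i with
      | zero => exact fun _ => ⟨d1, hDE hd1, Or.inr hd1, e1, fun _ => hd1⟩
      | succ i ih =>
        intro hi
        obtain ⟨z, hzE, -, hz, hzD⟩ := ih (by omega)
        have hzD := hzD (by omega)
        obtain ⟨y, hyE, hzy, hy⟩ := hsurj k z hzD (by rw [hz]; exact (hpi _ (by omega) (by omega)).2)
          _ (hpU (i + 1 + 1) hi) (by rw [hz]; exact hp.adj _ (by omega))
        refine ⟨y, hyE, hnbr z hzD y hyE hzy, hy, fun hi' => ?_⟩
        obtain ⟨l, d, hd, e⟩ := hint (i + 1 + 1) (by omega) hi'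
        rcases hnbr z hzD y hyE hzy with hyA | hyD
        · have h6 := hAU y hyA
          rw [← hA k y hyA, hy] at h6
          have := (hpi (i + 1 + 1) (by omega) hi').2
          omega
        · exact hyD
    intro i hi
    rcases Nat.eq_zero_or_pos i with rfl | h0
    · obtain ⟨y, hyE, hzy, hy⟩ := hsurj k d1 hd1 (by rw [e1]; exact (hpi _ (by omega) (by omega)).2)
        _ (hpU 0 hi) (by rw [e1]; exact (hp.adj 0 (by omega)).symm)
      exact ⟨y, hyE, hnbr d1 hd1 y hyE hzy, hy, fun h => absurd h (lt_irrefl _)⟩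
    · obtain ⟨z, h1, h2, h3, h4⟩ := hpos (i - 1) (by omega)
      rw [show i - 1 + 1 = i by omega] at h3 h4
      exact ⟨z, h1, h2, h3, fun _ => h4⟩
  have : Nonempty V := ⟨d1⟩
  choose! q hqE hqAD hq hqD using hall
  refine ⟨q, ⟨fun i hi => ?_, fun a ha b hb e => ?_⟩, hqE, fun i h0 h1 => ⟨hqD i h1.le h0 h1, ?_⟩⟩
  · have hedge := hp.adj i hi
    rw [← hq i hi.le, ← hq (i + 1) hi] at hedge
    by_cases h0 : 0 < i
    · have hd := hqD i hi.le h0 hi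
      obtain ⟨z, hzE, hz, e⟩ := hsurj k _ hd (by rw [hq i hi.le]; exact (hpi i h0 hi).2) _
        (hmemU k _ (hqAD _ hi)) hedge
      rwa [← hinj k (hnbr _ hd z hzE hz) (hqAD _ hi) e]
    · have hd := hqD (i + 1) hi (by omega) (by omega)
      obtain ⟨z, hzE, hz, e⟩ := hsurj k _ hd
        (by rw [hq (i + 1) hi]; exact (hpi _ (by omega) (by omega)).2) _
        (hmemU k _ (hqAD _ hi.le)) hedge.symm
      rw [← hinj k (hnbr _ hd z hzE hz) (hqAD _ hi.le) e]
      exact hz.symm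
  · refine hp.inj ha hb ?_
    rw [← hq a ha, ← hq b hb, e]
  · refine (hdeg k _ (hqD i h1.le h0 h1)).trans ?_
    rw [hq i h1.le]
    exact (hpi i h0 h1).2

/-- The three copies are C \ S itself and two copies inside `S`, the second taken over the first so
that they are disjoint. `A` consists of the neighbours of C \ S in C ∩ S. -/
theorem CopiesPatterns.hasPiece (hn : 3 ≤ n) {S : Set V} (hS : CopiesPatterns G S)
    (hop : ∀ A : Finset V, A.Nonempty → HasPiece n G ∅ A) (C : Finset V)
    (hC : ¬ (C : Set V) ⊆ S) : HasPiece n G S C := by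
  classical
  set D := C.filter (· ∉ S) with hD
  set A := C.filter (fun a => a ∈ S ∧ ∃ d ∈ D, G.Adj d a) with hA
  have hAS : ∀ a ∈ A, a ∈ S := fun a ha => (Finset.mem_filter.1 ha).2.1
  have hDS : ∀ d ∈ D, d ∉ S := fun d hd => (Finset.mem_filter.1 hd).2
  have hDC : D ⊆ C := Finset.filter_subset _ _
  obtain ⟨g, g1, g2, g3, g4⟩ := hS A (A ∪ D) hAS Finset.subset_union_left
  obtain ⟨g', g1', g2', g3', g4'⟩ := hS (A ∪ D.image g) (A ∪ D.image g ∪ D)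
    (fun x hx => by
      rcases Finset.mem_union.1 (Finset.mem_coe.1 hx) with h | h
      · exact hAS x h
      · obtain ⟨y, hy, rfl⟩ := Finset.mem_image.1 h
        exact g2 y (Finset.mem_union_right _ hy)) Finset.subset_union_left
  have hsub : A ∪ D ⊆ A ∪ D.image g ∪ D :=
    Finset.union_subset_union_left Finset.subset_union_left
  have hgg' : ∀ x ∈ D, ∀ y ∈ D, g x ≠ g' y := by
    intro x hx y hy e
    have hx' : g x ∈ A ∪ D.image g := Finset.mem_union_right _ (Finset.mem_image_of_mem g hx)
    rw [← g1' _ hx'] at e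
    have := g3' (Finset.mem_coe.2 (Finset.mem_union_left _ hx'))
      (Finset.mem_coe.2 (Finset.mem_union_right _ hy)) e
    exact hDS y hy (this ▸ g2 x (Finset.mem_union_right _ hx))
  obtain ⟨d0, hd0, hd0S⟩ := Set.not_subset.1 hC
  have hd0D : d0 ∈ D := Finset.mem_filter.2 ⟨hd0, hd0S⟩
  have hidg : ∀ x ∈ D, ∀ y ∈ D, x ≠ g y := fun x hx y hy e =>
    hDS x hx (e ▸ g2 y (Finset.mem_union_right _ hy))
  have hidg' : ∀ x ∈ D, ∀ y ∈ D, x ≠ g' y := fun x hx y hy e =>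
    hDS x hx (e ▸ g2' y (Finset.mem_union_right _ hy))
  have key := hasPiece_of_copies (n := n) (G := G) (A := A) (D := D) (E := C)
    (U := A ∪ D ∪ D.image g ∪ D.image g') hn
    (fun d hd e he hde => by
      by_cases h : e ∈ S
      · exact Or.inl (Finset.mem_filter.2 ⟨he, h, d, hd, hde⟩)
      · exact Or.inr (Finset.mem_filter.2 ⟨he, h⟩))
    (h := ![id, g, g'])
    (fun k a ha => by
      fin_cases k
      · rfl
      · exact g1 a ha
      · exact g1' a (Finset.mem_union_left _ ha))
    (fun k => by
      fin_cases k
      · exact Set.injOn_id _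
      · exact g3.mono (by rw [Finset.coe_union])
      · exact g3'.mono (by rw [← Finset.coe_union]; exact_mod_cast hsub))
    (fun k x hx y hy hxy => by
      have hx' : x ∈ A ∪ D := Finset.mem_union_right _ hx
      have hy' : y ∈ A ∪ D := Finset.mem_union.2 hy
      fin_cases k
      · exact hxy
      · exact g4 x hx' y hy' hxy
      · exact g4' x (hsub hx') y (hsub hy') hxy)
    (fun k l x hx y hy e => by
      fin_cases k <;> fin_cases l <;> first | rfl | skip
      · exact absurd e (hidg x hx y hy)
      · exact absurd e (hidg' x hx y hy)
      · exact absurd e.symm (hidg y hy x hx)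
      · exact absurd e (hgg' x hx y hy)
      · exact absurd e.symm (hidg' y hy x hx)
      · exact absurd e.symm (hgg' y hy x hx))
    (fun a ha => (Finset.mem_filter.1 ha).2.2) hDC
    (fun x => by
      simp only [Finset.mem_union, Finset.mem_image]
      constructor
      · rintro (((h | h) | ⟨d, hd, h⟩) | ⟨d, hd, h⟩)
        · exact Or.inl h
        · exact Or.inr ⟨0, x, h, rfl⟩
        · exact Or.inr ⟨1, d, hd, h⟩
        · exact Or.inr ⟨2, d, hd, h⟩
      · rintro (h | ⟨k, d, hd, h⟩)
        · exact Or.inl (Or.inl (Or.inl h))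
        · fin_cases k
          · exact Or.inl (Or.inl (Or.inr (by rw [← show d = x from h]; exact hd)))
          · exact Or.inl (Or.inr ⟨d, hd, h⟩)
          · exact Or.inr ⟨d, hd, h⟩)
    (hop _ ⟨d0, by simp [hd0D]⟩)
  rcases key with ⟨z, hz, hd⟩ | ⟨p, hp, hpC, hpi⟩
  · exact Or.inl ⟨z, hDC hz, hDS z hz, hd⟩
  · exact Or.inr ⟨p, hp, hpC, fun i h0 h1 => ⟨hDS _ (hpi i h0 h1).1, (hpi i h0 h1).2⟩⟩

/-- Stripping clean arcs does not raise the defect and stripping a loose end lowers it. The last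
piece is a loose end: an arc with both ends in `S` would have a copy in `S` with the same ends, and
by the girth this copy is the arc itself. -/
theorem CopiesPatterns.defect_filter_lt (hn : 3 ≤ n) (hg : LargeGirth n G) {S : Set V}
    (hS : CopiesPatterns G S) (hop : ∀ A : Finset V, A.Nonempty → HasPiece n G ∅ A)
    [DecidablePred (· ∈ S)] (C : Finset V) (hC : ¬ (C : Set V) ⊆ S) :
    defect n G (C.filter (· ∈ S)) < defect n G C := by
  classical
  induction hc : C.card using Nat.strong_induction_on generalizing C with
  | _ c ih =>
    have hrec : ∀ C' ⊆ C, C'.card < C.card → (∀ x ∈ C, x ∈ S → x ∈ C') →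
        C.filter (· ∈ S) = C'.filter (· ∈ S) ∧ ((C' : Set V) ⊆ S → C'.filter (· ∈ S) = C') := by
      intro C' h1 _ h2
      refine ⟨?_, fun h => Finset.filter_true_of_mem fun x hx => h hx⟩
      ext x
      rw [Finset.mem_filter, Finset.mem_filter]
      exact ⟨fun h => ⟨h2 x h.1 h.2, h.2⟩, fun h => ⟨h1 h.1, h.2⟩⟩
    rcases hS.hasPiece hn hop C hC with ⟨z, hz, hzS, hd⟩ | ⟨p, hp, hpC, hpi⟩
    · have h1 := hrec (C.erase z) (Finset.erase_subset _ _) (Finset.card_erase_lt_of_mem hz)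
        (fun x hx hxS => Finset.mem_erase.2 ⟨fun e => hzS (e ▸ hxS), hx⟩)
      have h2 := defect_erase_lt hn hz hd
      rw [h1.1]
      by_cases h : ((C.erase z : Finset V) : Set V) ⊆ S
      · rwa [h1.2 h]
      · exact (ih _ (by rw [← hc]; exact Finset.card_erase_lt_of_mem hz) _ h rfl).trans h2
    · have hint : ∀ i, 0 < i → i < n - 1 → p i ∈ C ∧ dg G C (p i) ≤ 2 :=
        fun i h0 h1 => ⟨hpC i h1.le, (hpi i h0 h1).2⟩
      obtain ⟨-, h2, h3⟩ := sdiff_arc hn hp hint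
      set C' := C \ (Finset.Ioo 0 (n - 1)).image p with hC'
      have hlt : C'.card < C.card := by omega
      have h1 := hrec C' Finset.sdiff_subset hlt (fun x hx hxS => Finset.mem_sdiff.2 ⟨hx, fun h => by
        obtain ⟨i, hi, rfl⟩ := Finset.mem_image.1 h
        rw [Finset.mem_Ioo] at hi
        exact (hpi i hi.1 hi.2).1 hxS⟩)
      rw [h1.1]
      by_cases h : (C' : Set V) ⊆ S
      · exfalso
        have hend : ∀ i ≤ n - 1, (i = 0 ∨ i = n - 1) → p i ∈ S := by
          intro i hi hi'
          refine h (Finset.mem_coe.2 (Finset.mem_sdiff.2 ⟨hpC i hi, fun h' => ?_⟩))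
          obtain ⟨j, hj, e⟩ := Finset.mem_image.1 h'
          rw [Finset.mem_Ioo] at hj
          rw [hp.eq_iff (by omega) hi] at e
          omega
        obtain ⟨g, g1, g2, g3, g4⟩ := hS {p 0, p (n - 1)} (initialImage (n - 1) p)
          (by
            intro x hx
            simp only [Finset.coe_insert, Finset.coe_singleton, Set.mem_insert_iff,
              Set.mem_singleton_iff] at hx
            rcases hx with rfl | rfl
            · exact hend _ (by omega) (Or.inl rfl)
            · exact hend _ le_rfl (Or.inr rfl))
          (by
            intro x hx
            rw [Finset.mem_insert, Finset.mem_singleton] at hx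
            rcases hx with rfl | rfl
            · exact mem_initialImage.2 ⟨0, by omega, rfl⟩
            · exact mem_initialImage.2 ⟨n - 1, le_rfl, rfl⟩)
        have hm : ∀ i ≤ n - 1, p i ∈ initialImage (n - 1) p := fun i hi =>
          mem_initialImage.2 ⟨i, hi, rfl⟩
        have hq : IsPathSeq G (n - 1) (fun i => g (p i)) :=
          ⟨fun i hi => g4 _ (hm i hi.le) _ (hm (i + 1) hi) (hp.adj i hi), fun a ha b hb e =>
            hp.inj ha hb (g3 (hm a ha) (hm b hb) e)⟩
        have := (hg.pathSeq_unique hp hq (g1 _ (by simp)).symm (g1 _ (by simp)).symm (by omega)).2 1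
          (by omega)
        have h4 := (hpi 1 (by omega) (by omega)).1
        rw [this] at h4
        exact h4 (g2 _ (hm 1 (by omega)))
      · exact (ih _ (by omega) _ h rfl).trans_le h3

/-- A polygon all of whose finite subsets lie in finite sets of small defect has no proper
subset into which all finite configurations can be copied. -/
theorem CopiesPatterns.eq_univ (hn : 3 ≤ n) (hg : LargeGirth n G) [Infinite V]
    (hop : ∀ A : Finset V, A.Nonempty → HasPiece n G ∅ A)
    (hsmall : ∀ F : Finset V, ∃ C, F ⊆ C ∧ defect n G C ≤ 4 * n + 4) {S : Set V}
    (hS : CopiesPatterns G S) : S = Set.univ := by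
  classical
  by_contra hne
  obtain ⟨s, hs⟩ := (Set.ne_univ_iff_exists_notMem _).1 hne
  -- With |C| ≥ 4n the bound on the defect gives (n-2)(e2 - 2|C|) ≥ 2|C| - 4n - 4 ≥ 4n - 4 > 4(n-2),
  -- that is, surplus at least 2.
  obtain ⟨F, hF⟩ := Infinite.exists_subset_card_eq V (4 * n)
  obtain ⟨C, hFC, hC⟩ := hsmall F
  obtain ⟨g, -, g2, g3, g4⟩ := hS ∅ C (by simp) (by simp)
  have h1 := e2_le_image g3 g4
  have h2 : 2 * C.card + 4 ≤ e2 G C := by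
    have h3 := Finset.card_le_card hFC
    unfold defect at hC
    obtain ⟨m, rfl⟩ : ∃ m, n = m + 3 := ⟨n - 3, by omega⟩
    zify
    zify at h3 hF
    push_cast at hC h3 hF
    rw [hF] at h3
    nlinarith
  have h3 : (C.image g).card = C.card := Finset.card_image_of_injOn g3
  -- The part of `E` in `S` contains the copy of `C`, so its defect is at least 4n+4; yet it is
  -- smaller than the defect of `E`.
  obtain ⟨E, hE, hEd⟩ := hsmall (insert s (C.image g))
  have h4 := hS.defect_filter_lt hn hg hop E (fun h => hs (h (hE (Finset.mem_insert_self _ _))))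
  have h5 := defect_ge_of_subset hn hg hop (A := E.filter (· ∈ S)) (B := C.image g)
    (fun x hx => Finset.mem_filter.2 ⟨hE (Finset.mem_insert_of_mem hx), by
      obtain ⟨y, hy, rfl⟩ := Finset.mem_image.1 hx
      exact g2 y hy⟩) (by omega)
  omega

theorem elementarySubstructure_eq_top (hn : 3 ≤ n) (hg : LargeGirth n G) [Infinite V]
    (hop : ∀ A : Finset V, A.Nonempty → HasPiece n G ∅ A)
    (hsmall : ∀ F : Finset V, ∃ C, F ⊆ C ∧ defect n G C ≤ 4 * n + 4) (c : G.Coloring Bool) :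
    letI := polygonStructure G c
    ∀ S : polygonLang.ElementarySubstructure V, S = ⊤ := by
  let _ := polygonStructure G c
  intro S
  have := (copiesPatterns_of_elementary c S).eq_univ hn hg hop hsmall
  exact SetLike.coe_injective this

end Patterns

/-! ### Embedding free completions -/

section Embedding

variable {W : Type} {V : Type u} {H : SimpleGraph W} {G : SimpleGraph V} {n : ℕ}

open Classical in
/-- A path of length `n - 1` from `u` to `v`, provided there is one. -/
noncomputable def arcChoice (n : ℕ) (G : SimpleGraph V) (u v : V) : ℕ → V :=
  if h : ∃ p, IsPathSeq G (n - 1) p ∧ p 0 = u ∧ p (n - 1) = v then h.choose else fun _ => u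

theorem arcChoice_spec {u v : V} (h : ∃ p, IsPathSeq G (n - 1) p ∧ p 0 = u ∧ p (n - 1) = v) :
    IsPathSeq G (n - 1) (arcChoice n G u v) ∧ arcChoice n G u v 0 = u ∧
      arcChoice n G u v (n - 1) = v := by
  unfold arcChoice
  rw [dif_pos h]
  exact h.choose_spec

/-- The extension of a map on `W` to the vertices of the free completion, by choosing paths. -/
noncomputable def freeExtend (n : ℕ) (G : SimpleGraph V) (y : W → V) : FreeVertex W → V
  | .base w => y w
  | .arc a b j => arcChoice n G (freeExtend n G y a) (freeExtend n G y b) j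

/-- The map `freeExtend` on the free completion. -/
noncomputable def freeMap (n : ℕ) (H : SimpleGraph W) (G : SimpleGraph V) (y : W → V)
    (a : FreeCompletionVertex n H) : V :=
  freeExtend n G y a.1

/-- The hypotheses under which `freeMap` is an embedding. -/
structure FreeMapData (n : ℕ) (H : SimpleGraph W) (G : SimpleGraph V) (y : W → V)
    (C₀ : Finset (FreeCompletionVertex n H)) (d : ℤ) : Prop where
  le : 3 ≤ n
  bipartite : G.IsBipartite
  walk : ∀ x y : V, ∃ w : G.Walk x y, w.length ≤ n
  base : ∀ x, x ∈ C₀ ↔ x ∈ lev n H 0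
  defect_le : defect n (freeCompletion n H) C₀ ≤ d
  le_defect : ∀ A : Finset V, (∀ w, y w ∈ A) → d ≤ defect n G A

/-- `freeMap` is an embedding on the `i`-th stage. -/
structure FreeMapStage (n : ℕ) (H : SimpleGraph W) (G : SimpleGraph V) (y : W → V) (i : ℕ) :
    Prop where
  inj : Set.InjOn (freeMap n H G y) (lev n H i)
  adj : ∀ a ∈ lev n H i, ∀ b ∈ lev n H i,
    (freeCompletion n H).Adj a b ↔ G.Adj (freeMap n H G y a) (freeMap n H G y b)

variable {y : W → V} {C₀ : Finset (FreeCompletionVertex n H)} {d : ℤ} {i : ℕ}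

-- Any finite part of a stage extends to a finite set whose image contains the image of `y` and has
-- defect at most `d`, the minimum over all sets containing it. This makes `clean_of_minimal`
-- applicable.
open Classical in
theorem FreeMapStage.exists_minimal (hs : FreeMapStage n H G y i) (h : FreeMapData n H G y C₀ d)
    (F : Finset (FreeCompletionVertex n H)) (hF : ∀ x ∈ F, x ∈ lev n H i) :
    ∃ C : Finset (FreeCompletionVertex n H), F ⊆ C ∧ (∀ x ∈ C, x ∈ lev n H i) ∧
      defect n G (C.image (freeMap n H G y)) ≤ d ∧
      ∀ A, C.image (freeMap n H G y) ⊆ A → d ≤ defect n G A := by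
  obtain ⟨C, h1, h2, h3, h4⟩ := exists_finset_superset_defect_le h.le (C := C₀)
    (fun x hx => (h.base x).2 hx) (fun x hx => lev_mono (Nat.zero_le i) ((h.base x).1 hx))
    h.defect_le F hF
  refine ⟨C, h2, h3, (defect_image_le (by have := h.le; omega) (fun a ha b hb e =>
    hs.inj (h3 a ha) (h3 b hb) e) (fun a ha b hb hab => (hs.adj a (h3 a ha) b (h3 b hb)).1 hab)).trans
    h4, fun A hA => h.le_defect A fun w => hA ?_⟩
  exact Finset.mem_image.2 ⟨baseVertex n H w, h1 ((h.base _).2 (baseVertex_mem w)), rfl⟩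

/-- A path of length at most n-1 inside the image would pull back to the stage, where the ends of
`P` have distance n+1. -/
theorem FreeMapStage.exists_notMem (hs : FreeMapStage n H G y i) (hn : 3 ≤ n)
    {P : ℕ → FreeCompletionVertex n H} (hP : IsStageArc n H i P) {m : ℕ} {q : ℕ → V}
    (hq : IsPathSeq G m q) (hm : m + 1 ≤ n) (h0 : q 0 = freeMap n H G y (P 0))
    (h1 : q m = freeMap n H G y (P (n - 1))) : ∃ k ≤ m, q k ∉ freeMap n H G y '' lev n H i := by
  by_contra! hcon
  have : Nonempty (FreeCompletionVertex n H) := ⟨P 0⟩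
  choose! r hr hrq using hcon
  obtain ⟨w, hw, -⟩ := exists_walk_of_adj (G := (freeStage n H i).spanningCoe) m
    (fun t => (r t).1) (fun t ht => stage_adj_of_adj hn (hr t ht.le) (hr (t + 1) ht) (by
      rw [hs.adj _ (hr t ht.le) _ (hr (t + 1) ht), hrq t ht.le, hrq (t + 1) ht]
      exact hq.adj t ht))
  have e0 : r 0 = P 0 := hs.inj (hr 0 (Nat.zero_le _)) (hP.ends hn).1 (by rw [hrq 0 (Nat.zero_le _), h0])
  have e1 : r m = P (n - 1) := hs.inj (hr m le_rfl) (hP.ends hn).2 (by rw [hrq m le_rfl, h1])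
  have h2 := SimpleGraph.dist_le w
  have h3 := hP.dist_eq hn
  rw [hw] at h2
  simp only [e0, e1] at h2
  omega

/-- Parity provides a path of length at most n-1 between the images of the ends. It leaves the image
of the stage, so minimality of the defect forces its length to be n-1. -/
theorem FreeMapStage.exists_path (hs : FreeMapStage n H G y i) (h : FreeMapData n H G y C₀ d)
    {P : ℕ → FreeCompletionVertex n H} (hP : IsStageArc n H i P) :
    ∃ q, IsPathSeq G (n - 1) q ∧ q 0 = freeMap n H G y (P 0) ∧
      q (n - 1) = freeMap n H G y (P (n - 1)) := by
  classical
  have hn := h.le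
  let f : (freeStage n H i).spanningCoe →g G := ⟨freeExtend n G y, fun {a b} hab => by
    have ha := (freeStage n H i).edge_vert hab
    have hb := (freeStage n H i).edge_vert (SimpleGraph.Adj.symm hab)
    exact (hs.adj ⟨a, mem_completion ha⟩ ha ⟨b, mem_completion hb⟩ hb).1
      (freeCompletion_adj_iff.2 ⟨i, hab⟩)⟩
  obtain ⟨w, hw⟩ := (SimpleGraph.Reachable.of_dist_ne_zero
    (G := (freeStage n H i).spanningCoe) (u := (P 0).1) (v := (P (n - 1)).1)
    (by rw [hP.dist_eq hn]; omega)).exists_walk_length_eq_dist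
  rw [hP.dist_eq hn] at hw
  obtain ⟨w', hw', hl⟩ := exists_short_path h.bipartite h.walk (w.map f) (by
    rw [SimpleGraph.Walk.length_map, hw]
    exact ⟨n, by omega⟩)
  have hq := isPathSeq_getVert hw'
  have h0 : w'.getVert 0 = freeMap n H G y (P 0) := w'.getVert_zero
  have h1 : w'.getVert w'.length = freeMap n H G y (P (n - 1)) := w'.getVert_length
  obtain ⟨k, hk, hkn⟩ := hs.exists_notMem hn hP hq hl h0 h1
  obtain ⟨C, hC1, hC2, hC3, hC4⟩ := hs.exists_minimal h {P 0, P (n - 1)} (by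
    intro x hx
    rw [Finset.mem_insert, Finset.mem_singleton] at hx
    rcases hx with rfl | rfl
    · exact (hP.ends hn).1
    · exact (hP.ends hn).2)
  have hmem : ∀ z ∈ C, freeMap n H G y z ∈ C.image (freeMap n H G y) := fun z hz =>
    Finset.mem_image_of_mem _ hz
  have h2 := (clean_of_minimal hn hl hq (A := C.image (freeMap n H G y))
    (by rw [h0]; exact hmem _ (hC1 (by simp))) (by rw [h1]; exact hmem _ (hC1 (by simp)))
    (fun A' hA' => hC3.trans (hC4 A' hA')) hk (fun hkC => hkn (by
      obtain ⟨c, hc, e⟩ := Finset.mem_image.1 hkC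
      exact ⟨c, hC2 c hc, e⟩))).1
  have h3 : w'.length = n - 1 := by omega
  rw [h3] at hq h1
  exact ⟨_, hq, h0, h1⟩

theorem freeExtend_arcVertex (hn : 3 ≤ n) {a b : FreeVertex W}
    (h : ∃ p, IsPathSeq G (n - 1) p ∧ p 0 = freeExtend n G y a ∧ p (n - 1) = freeExtend n G y b)
    {k : ℕ} (hk : k ≤ n - 1) :
    freeExtend n G y (arcVertex n a b k) =
      arcChoice n G (freeExtend n G y a) (freeExtend n G y b) k := by
  have hs := arcChoice_spec h
  rcases Nat.eq_zero_or_pos k with rfl | h0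
  · rw [arcVertex_zero, hs.2.1]
  rcases hk.eq_or_lt with rfl | h1
  · rw [arcVertex_last hn, hs.2.2]
  · rw [arcVertex_interior a b h0 h1]
    rfl

theorem FreeMapStage.isPathSeq (hs : FreeMapStage n H G y i) (h : FreeMapData n H G y C₀ d)
    {P : ℕ → FreeCompletionVertex n H} (hP : IsStageArc n H i P) :
    IsPathSeq G (n - 1) (fun k => freeMap n H G y (P k)) := by
  have hn := h.le
  refine IsStageArc.induct hn (P := fun P => IsPathSeq G (n - 1) fun k => freeMap n H G y (P k))
    (fun p hp => hp.reverse) ?_ ?_ hP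
  · intro p q e hp
    refine ⟨fun k hk => ?_, fun a ha b hb hab => ?_⟩
    · have := hp.adj k hk
      rwa [e k (by omega), e (k + 1) (by omega)] at this
    · refine hp.inj ha hb ?_
      simp only [e a ha, e b hb]
      exact hab
  · intro p a b hab hp
    have hP' : IsStageArc n H i p := ⟨a, b, hab, Or.inl hp⟩
    have h1 := hs.exists_path h hP'
    have e0 : (p 0).1 = a := by rw [hp 0 (by omega), arcVertex_zero]
    have e1 : (p (n - 1)).1 = b := by rw [hp _ le_rfl, arcVertex_last hn]
    unfold freeMap at h1
    rw [e0, e1] at h1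
    have h2 := arcChoice_spec h1
    have e : ∀ k ≤ n - 1, freeMap n H G y (p k) =
        arcChoice n G (freeExtend n G y a) (freeExtend n G y b) k := fun k hk => by
      unfold freeMap
      rw [hp k hk, freeExtend_arcVertex hn h1 hk]
    refine ⟨fun k hk => ?_, fun s hs t ht hst => ?_⟩
    · rw [e k (by omega), e (k + 1) (by omega)]
      exact h2.1.adj k hk
    · refine h2.1.inj hs ht ?_
      rw [← e s hs, ← e t ht]
      exact hst

/-- The image of an arc added to the `i`-th stage is clean over the image of this stage. -/
theorem FreeMapStage.clean (hs : FreeMapStage n H G y i) (h : FreeMapData n H G y C₀ d)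
    {P : ℕ → FreeCompletionVertex n H} (hP : IsStageArc n H i P) {k : ℕ} (h0 : 0 < k)
    (h1 : k < n - 1) {z : FreeCompletionVertex n H} (hz : z ∈ lev n H i) :
    freeMap n H G y (P k) ≠ freeMap n H G y z ∧
      ∀ x, x = z ∨ (∃ j ≤ n - 1, P j = x) →
        G.Adj (freeMap n H G y (P k)) (freeMap n H G y x) →
        freeMap n H G y x = freeMap n H G y (P (k - 1)) ∨
        freeMap n H G y x = freeMap n H G y (P (k + 1)) := by
  classical
  have hn := h.le
  have hq := hs.isPathSeq h hP
  obtain ⟨l, hl, hln⟩ := hs.exists_notMem hn hP hq (by omega) rfl rfl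
  obtain ⟨C, hC1, hC2, hC3, hC4⟩ := hs.exists_minimal h {P 0, P (n - 1), z} (by
    intro x hx
    rw [Finset.mem_insert, Finset.mem_insert, Finset.mem_singleton] at hx
    rcases hx with rfl | rfl | rfl
    · exact (hP.ends hn).1
    · exact (hP.ends hn).2
    · exact hz)
  have hmem : ∀ z ∈ C, freeMap n H G y z ∈ C.image (freeMap n H G y) := fun z hz =>
    Finset.mem_image_of_mem _ hz
  have h2 := (clean_of_minimal hn (show n - 1 + 1 ≤ n by omega) hq
    (A := C.image (freeMap n H G y)) (hmem _ (hC1 (by simp))) (hmem _ (hC1 (by simp)))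
    (fun A' hA' => hC3.trans (hC4 A' hA')) hl (fun hkC => hln (by
      obtain ⟨c, hc, e⟩ := Finset.mem_image.1 hkC
      exact ⟨c, hC2 c hc, e⟩))).2 k h0 h1
  have hzC := hmem z (hC1 (by simp))
  refine ⟨fun e => h2.1 (by rw [e]; exact hzC), fun x hx hadj => ?_⟩
  have hmem' : ∀ j ≤ n - 1, freeMap n H G y (P j) ∈ C.image (freeMap n H G y) ∪
      (Finset.range (n - 1 + 1)).image (fun k => freeMap n H G y (P k)) := fun j hj =>
    Finset.mem_union_right _ (Finset.mem_image.2 ⟨j, by simp; omega, rfl⟩)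
  have a1 := hq.adj (k - 1) (by omega)
  rw [show k - 1 + 1 = k by omega] at a1
  refine eq_or_eq_of_dg_le_two h2.2 (hmem' (k - 1) (by omega)) (hmem' (k + 1) (by omega))
    (by
      rcases hx with rfl | ⟨j, hj, rfl⟩
      · exact Finset.mem_union_left _ hzC
      · exact hmem' j hj) (fun e => ?_) a1.symm (hq.adj k h1) hadj
  have := hq.inj (show k - 1 ≤ n - 1 by omega) (show k + 1 ≤ n - 1 by omega) e
  omega

/-- Adjoin the image of `Q` to a set of minimal defect. Either the image of `P` leaves the result
and is clean over it, or it is contained in it; in the latter case `P` and `Q` share their ends and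
agree up to reversal. -/
theorem FreeMapStage.clean_arc (hs : FreeMapStage n H G y i) (h : FreeMapData n H G y C₀ d)
    {P Q : ℕ → FreeCompletionVertex n H} (hP : IsStageArc n H i P) (hQ : IsStageArc n H i Q) :
    (∀ k, 0 < k → k < n - 1 → ∀ j ≤ n - 1, freeMap n H G y (P k) ≠ freeMap n H G y (Q j) ∧
      (G.Adj (freeMap n H G y (P k)) (freeMap n H G y (Q j)) →
        freeMap n H G y (Q j) = freeMap n H G y (P (k - 1)) ∨
        freeMap n H G y (Q j) = freeMap n H G y (P (k + 1)))) ∨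
    ∀ j ≤ n - 1, ∃ l ≤ n - 1, Q j = P l := by
  classical
  have hn := h.le
  have hp := hs.isPathSeq h hP
  have hq := hs.isPathSeq h hQ
  obtain ⟨C, hC1, hC2, hC3, hC4⟩ := hs.exists_minimal h {P 0, P (n - 1), Q 0, Q (n - 1)} (by
    intro x hx
    simp only [Finset.mem_insert, Finset.mem_singleton] at hx
    rcases hx with rfl | rfl | rfl | rfl
    · exact (hP.ends hn).1
    · exact (hP.ends hn).2
    · exact (hQ.ends hn).1
    · exact (hQ.ends hn).2)
  have hmem : ∀ z ∈ C, freeMap n H G y z ∈ C.image (freeMap n H G y) := fun z hz =>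
    Finset.mem_image_of_mem _ hz
  set A := C.image (freeMap n H G y) ∪
    (Finset.range (n - 1 + 1)).image (fun k => freeMap n H G y (Q k)) with hA
  have hAd : defect n G A ≤ d := (defect_union_path_le hn (show n - 1 + 1 ≤ n by omega) hq _
    (hmem _ (hC1 (by simp))) (hmem _ (hC1 (by simp)))).trans hC3
  have hQA : ∀ j ≤ n - 1, freeMap n H G y (Q j) ∈ A := fun j hj =>
    Finset.mem_union_right _ (Finset.mem_image.2 ⟨j, by simp; omega, rfl⟩)
  by_cases hex : ∃ l ≤ n - 1, freeMap n H G y (P l) ∉ A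
  · left
    obtain ⟨l, hl, hlA⟩ := hex
    intro k h0 h1 j hj
    have h2 := (clean_of_minimal hn (show n - 1 + 1 ≤ n by omega) hp (A := A)
      (Finset.mem_union_left _ (hmem _ (hC1 (by simp))))
      (Finset.mem_union_left _ (hmem _ (hC1 (by simp))))
      (fun A' hA' => hAd.trans (hC4 A' (Finset.subset_union_left.trans hA'))) hl hlA).2 k h0 h1
    refine ⟨fun e => h2.1 (by rw [e]; exact hQA j hj), fun hadj => ?_⟩
    have hmem' : ∀ j ≤ n - 1, freeMap n H G y (P j) ∈ A ∪
        (Finset.range (n - 1 + 1)).image (fun k => freeMap n H G y (P k)) := fun j hj =>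
      Finset.mem_union_right _ (Finset.mem_image.2 ⟨j, by simp; omega, rfl⟩)
    have a1 := hp.adj (k - 1) (by omega)
    rw [show k - 1 + 1 = k by omega] at a1
    refine eq_or_eq_of_dg_le_two h2.2 (hmem' (k - 1) (by omega)) (hmem' (k + 1) (by omega))
      (Finset.mem_union_left _ (hQA j hj)) (fun e => ?_) a1.symm (hp.adj k h1) hadj
    have := hp.inj (show k - 1 ≤ n - 1 by omega) (show k + 1 ≤ n - 1 by omega) e
    omega
  · right
    push Not at hex
    -- The image of `R 1` is interior to the image of `Q`. By cleanness of `Q` the adjacent image of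
    -- `R 0` lies on `Q` too, and being in the image of the stage it is an end.
    have hend : ∀ R : ℕ → FreeCompletionVertex n H, IsStageArc n H i R →
        (∀ l ≤ n - 1, freeMap n H G y (R l) ∈ A) → R 0 = Q 0 ∨ R 0 = Q (n - 1) := by
      intro R hR hRA
      have hr := hs.isPathSeq h hR
      have h3 : ∃ j, 0 < j ∧ j < n - 1 ∧ freeMap n H G y (Q j) = freeMap n H G y (R 1) := by
        have hno : ∀ z ∈ lev n H i, freeMap n H G y z ≠ freeMap n H G y (R 1) := fun z hz e =>
          (hs.clean h hR (show 0 < 1 by omega) (by omega) hz).1 e.symm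
        rcases Finset.mem_union.1 (hRA 1 (by omega)) with h4 | h4
        · obtain ⟨c, hc, e⟩ := Finset.mem_image.1 h4
          exact absurd e (hno c (hC2 c hc))
        · obtain ⟨j, hj, e⟩ := Finset.mem_image.1 h4
          rw [Finset.mem_range] at hj
          have hj0 : j ≠ 0 := by rintro rfl; exact hno _ (hQ.ends hn).1 e
          have hj1 : j ≠ n - 1 := by rintro rfl; exact hno _ (hQ.ends hn).2 e
          exact ⟨j, by omega, by omega, e⟩
      obtain ⟨j, hj0, hj1, e⟩ := h3
      have hR0 := (hR.ends hn).1
      have hadj := (hr.adj 0 (by omega)).symm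
      simp only [Nat.zero_add] at hadj
      rw [← e] at hadj
      have hex2 : ∃ t ≤ n - 1, freeMap n H G y (R 0) = freeMap n H G y (Q t) := by
        rcases (hs.clean h hQ hj0 hj1 hR0).2 _ (Or.inl rfl) hadj with e' | e'
        · exact ⟨_, by omega, e'⟩
        · exact ⟨_, by omega, e'⟩
      obtain ⟨t, ht, e'⟩ := hex2
      rcases Nat.eq_zero_or_pos t with rfl | ht0
      · exact Or.inl (hs.inj hR0 (hQ.ends hn).1 e')
      rcases ht.eq_or_lt with rfl | ht1
      · exact Or.inr (hs.inj hR0 (hQ.ends hn).2 e')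
      · exact absurd e'.symm (hs.clean h hQ ht0 ht1 hR0).1
    have h0 := hend P hP hex
    have h1 := hend _ hP.reverse (fun l hl => hex _ (by omega))
    rw [Nat.sub_zero] at h1
    have hne : P 0 ≠ P (n - 1) := fun e => by
      have := (hP.isPathSeq hn).inj (show 0 ≤ n - 1 by omega) (show n - 1 ≤ n - 1 by omega) e
      omega
    intro j hj
    rcases h0 with h0 | h0 <;> rcases h1 with h1 | h1
    · exact absurd (h0.trans h1.symm) hne
    · exact ⟨j, hj, (hP.eq_of_ends hQ hn h0 h1 hj).symm⟩
    · refine ⟨n - 1 - j, by omega, (hP.reverse.eq_of_ends hQ hn ?_ ?_ hj).symm⟩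
      · rw [Nat.sub_zero]; exact h1
      · rw [Nat.sub_self]; exact h0
    · exact absurd (h0.trans h1.symm) hne

theorem FreeMapStage.succ (hs : FreeMapStage n H G y i) (h : FreeMapData n H G y C₀ d) :
    FreeMapStage n H G y (i + 1) := by
  have hn := h.le
  have hinj : Set.InjOn (freeMap n H G y) (lev n H (i + 1)) := by
    have key : ∀ a ∈ lev n H (i + 1), a ∉ lev n H i → ∀ b ∈ lev n H (i + 1),
        freeMap n H G y a = freeMap n H G y b → a = b := by
      intro a ha ha' b hb e
      obtain ⟨P, k, hP, hk0, hk1, rfl⟩ := exists_stageArc_of_mem hn ha ha'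
      by_cases hb' : b ∈ lev n H i
      · exact absurd e (hs.clean h hP hk0 hk1 hb').1
      obtain ⟨Q, j, hQ, hj0, hj1, rfl⟩ := exists_stageArc_of_mem hn hb hb'
      rcases hs.clean_arc h hP hQ with h1 | h1
      · exact absurd e (h1 k hk0 hk1 j hj1.le).1
      · obtain ⟨l, hl, e'⟩ := h1 j hj1.le
        rw [e'] at e ⊢
        rw [(hs.isPathSeq h hP).inj (show k ≤ n - 1 from hk1.le) (show l ≤ n - 1 from hl) e]
    intro a ha b hb e
    by_cases ha' : a ∈ lev n H i
    · by_cases hb' : b ∈ lev n H i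
      · exact hs.inj ha' hb' e
      · exact (key b hb hb' a ha e.symm).symm
    · exact key a ha ha' b hb e
  refine ⟨hinj, ?_⟩
  have key : ∀ a ∈ lev n H (i + 1), a ∉ lev n H i → ∀ b ∈ lev n H (i + 1),
      ((freeCompletion n H).Adj a b ↔ G.Adj (freeMap n H G y a) (freeMap n H G y b)) := by
    intro a ha ha' b hb
    obtain ⟨P, k, hP, hk0, hk1, rfl⟩ := exists_stageArc_of_mem hn ha ha'
    have hp := hs.isPathSeq h hP
    have hp' := hP.isPathSeq hn
    have a1 := hp.adj (k - 1) (by omega)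
    have a2 := hp'.adj (k - 1) (by omega)
    rw [show k - 1 + 1 = k by omega] at a1 a2
    constructor
    · intro hadj
      rcases hP.eq_or_eq_of_adj hn hk0 hk1 hb hadj with rfl | rfl
      · exact a1.symm
      · exact hp.adj k hk1
    · intro hadj
      have h3 : freeMap n H G y b = freeMap n H G y (P (k - 1)) ∨
          freeMap n H G y b = freeMap n H G y (P (k + 1)) := by
        by_cases hb' : b ∈ lev n H i
        · exact (hs.clean h hP hk0 hk1 hb').2 b (Or.inl rfl) hadj
        obtain ⟨Q, j, hQ, hj0, hj1, rfl⟩ := exists_stageArc_of_mem hn hb hb'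
        rcases hs.clean_arc h hP hQ with h1 | h1
        · exact (h1 k hk0 hk1 j hj1.le).2 hadj
        obtain ⟨l, hl, e'⟩ := h1 j hj1.le
        rw [e'] at hadj ⊢
        exact (hs.clean h hP hk0 hk1 (hP.ends hn).1).2 _ (Or.inr ⟨l, hl, rfl⟩) hadj
      rcases h3 with e | e
      · rw [hinj hb (hP.mem hn (by omega)) e]
        exact a2.symm
      · rw [hinj hb (hP.mem hn (by omega)) e]
        exact hp'.adj k hk1
  intro a ha b hb
  by_cases ha' : a ∈ lev n H i
  · by_cases hb' : b ∈ lev n H i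
    · exact hs.adj a ha' b hb'
    · rw [SimpleGraph.adj_comm, G.adj_comm]
      exact key b hb hb' a ha
  · exact key a ha ha' b hb

theorem exists_embedding (y : H ↪g G) (h : FreeMapData n H G y C₀ d) :
    ∃ φ : freeCompletion n H ↪g G, ∀ w, φ (baseVertex n H w) = y w := by
  have hn := h.le
  have hs : ∀ i, FreeMapStage n H G y i := by
    intro i
    induction i with
    | zero =>
      refine ⟨fun a ha b hb e => ?_, fun a ha b hb => ?_⟩
      · obtain ⟨v, rfl⟩ := exists_baseVertex ha
        obtain ⟨w, rfl⟩ := exists_baseVertex hb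
        rw [y.injective e]
      · obtain ⟨v, rfl⟩ := exists_baseVertex ha
        obtain ⟨w, rfl⟩ := exists_baseVertex hb
        rw [baseVertex_adj hn]
        exact y.map_rel_iff.symm
    | succ i ih => exact ih.succ h
  have hcommon : ∀ a b : FreeCompletionVertex n H, ∃ i, a ∈ lev n H i ∧ b ∈ lev n H i := by
    intro a b
    obtain ⟨i, hi⟩ := exists_mem_lev a
    obtain ⟨j, hj⟩ := exists_mem_lev b
    exact ⟨max i j, lev_mono (le_max_left _ _) hi, lev_mono (le_max_right _ _) hj⟩
  refine ⟨⟨⟨freeMap n H G y, fun a b e => ?_⟩, fun {a b} => ?_⟩, fun w => rfl⟩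
  · obtain ⟨i, ha, hb⟩ := hcommon a b
    exact (hs i).inj ha hb e
  · obtain ⟨i, ha, hb⟩ := hcommon a b
    exact ((hs i).adj a ha b hb).symm

theorem e2_lt_of_le {G' : SimpleGraph V} (hle : G' ≤ G) {A : Finset V} {u v : V} (hu : u ∈ A)
    (hv : v ∈ A) (h : G.Adj u v) (h' : ¬ G'.Adj u v) : e2 G' A < e2 G A := by
  classical
  have hsub : ∀ v, A.filter (G'.Adj v) ⊆ A.filter (G.Adj v) := fun v x hx => by
    rw [Finset.mem_filter] at hx ⊢
    exact ⟨hx.1, hle hx.2⟩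
  refine Finset.sum_lt_sum (fun v _ => Finset.card_le_card (hsub v)) ⟨u, hu, ?_⟩
  refine Finset.card_lt_card (Finset.ssubset_iff_subset_ne.2 ⟨hsub u, fun e => ?_⟩)
  have h2 : v ∈ A.filter (G.Adj u) := Finset.mem_filter.2 ⟨hv, h⟩
  rw [← e, Finset.mem_filter] at h2
  exact h' h2.2

/-- A path of length `n + 3` all of whose finite supersets have large defect generates a copy of
`Γ^{n+3}`. -/
theorem exists_gamma_embedding (hn : 3 ≤ n) (hb : G.IsBipartite)
    (hd : ∀ x y : V, ∃ w : G.Walk x y, w.length ≤ n) {p : ℕ → V} (hp : IsPathSeq G (n + 3) p)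
    (hmin : ∀ A : Finset V, (∀ t ≤ n + 3, p t ∈ A) → 4 * (n : ℤ) + 4 ≤ defect n G A) :
    ∃ φ : Gamma n (n + 3) ↪g G, ∀ t ≤ n + 3, φ (gammaPath n t) = p t := by
  classical
  have hind : ∀ s ≤ n + 3, ∀ t ≤ n + 3, s < t → G.Adj (p s) (p t) → s + 1 = t := by
    intro s hs t ht hst hadj
    by_contra hne
    have h1 := hmin (initialImage (n + 3) p) fun t ht => mem_initialImage.2 ⟨t, ht, rfl⟩
    -- A chord would give n+4 vertices more than n+3 edges and push the defect below 4n+4. The edges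
    -- of the path are counted in the graph without the chord, so that the chord is an additional
    -- one.
    set G' := G.deleteEdges {s(p s, p t)} with hG'
    have hp' : IsPathSeq G' (n + 3) p := by
      refine ⟨fun i hi => (SimpleGraph.deleteEdges_adj).2 ⟨hp.adj i hi, fun e => ?_⟩, hp.inj⟩
      rw [Set.mem_singleton_iff, Sym2.eq_iff] at e
      rcases e with ⟨e1, e2⟩ | ⟨e1, e2⟩
      · rw [hp.eq_iff hi.le hs] at e1
        rw [hp.eq_iff hi ht] at e2
        omega
      · rw [hp.eq_iff hi.le ht] at e1
        rw [hp.eq_iff hi hs] at e2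
        omega
    have h2 : e2 G' (initialImage (n + 3) p) < e2 G (initialImage (n + 3) p) :=
      e2_lt_of_le (G.deleteEdges_le _) (mem_initialImage.2 ⟨s, hs, rfl⟩)
        (mem_initialImage.2 ⟨t, ht, rfl⟩) hadj fun h => ((SimpleGraph.deleteEdges_adj).1 h).2 rfl
    have h3 : (2 * (n + 3) : ℤ) < e2 G (initialImage (n + 3) p) := by
      exact_mod_cast lt_of_le_of_lt hp'.le_e2 h2
    have h4 : (3 : ℤ) ≤ n := by exact_mod_cast hn
    unfold defect at h1
    rw [hp.card_image] at h1
    push_cast at h1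
    nlinarith
  let y : SimpleGraph.pathGraph (n + 3 + 1) ↪g G := ⟨⟨fun t => p t, fun s t e => by
      exact Fin.ext (hp.inj (show (s : ℕ) ≤ n + 3 by omega) (show (t : ℕ) ≤ n + 3 by omega) e)⟩,
    fun {s t} => by
      rw [SimpleGraph.pathGraph_adj]
      show G.Adj (p s) (p t) ↔ _
      constructor
      · intro h
        rcases lt_trichotomy (s : ℕ) t with h1 | h1 | h1
        · exact Or.inl (hind s (by omega) t (by omega) h1 h)
        · rw [h1] at h
          exact absurd h (G.irrefl)
        · exact Or.inr (hind t (by omega) s (by omega) h1 h.symm)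
      · rintro (h | h)
        · rw [← h]
          exact hp.adj s (by omega)
        · rw [← h]
          exact (hp.adj t (by omega)).symm⟩
  obtain ⟨φ, hφ⟩ := exists_embedding y (C₀ := gammaBase n) (d := 4 * n + 4)
    ⟨hn, hb, hd, fun x => mem_gammaBase, gammaBase_defect_le hn, fun A hA =>
      hmin A fun t ht => hA ⟨t, by omega⟩⟩
  refine ⟨φ, fun t ht => ?_⟩
  rw [gammaPath_val n ht]
  exact hφ _

end Embedding

/-! ### Labelled configurations -/

section Config

variable {ι : Type} {V : Type u} {G : SimpleGraph V} {n : ℕ}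

/-- Adjacency of consecutive terms among the first `m + 1` terms of a sequence. -/
def SeqAdj (m : ℕ) (q : ℕ → ι) (s t : ι) : Prop :=
  ∃ k < m, (s = q k ∧ t = q (k + 1)) ∨ (t = q k ∧ s = q (k + 1))

/-- The labelling `ψ` identifies the graph with vertex set `S` and adjacency relation `E` with an
induced subgraph of `G` of defect at most `d`, all of whose supersets have defect at least `d`. -/
structure Config (n : ℕ) (G : SimpleGraph V) (d : ℤ) (π : ι → ℕ) (S : Finset ι)
    (E : ι → ι → Prop) (ψ : ι → V) : Prop where
  mem : ∀ s t, E s t → s ∈ S ∧ t ∈ S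
  inj : Set.InjOn ψ S
  adj : ∀ s ∈ S, ∀ t ∈ S, G.Adj (ψ s) (ψ t) ↔ E s t
  parity : ∀ s ∈ S, ∀ t ∈ S, ∃ w : G.Walk (ψ s) (ψ t), w.length % 2 = (π s + π t) % 2
  defect_le : ∀ A : Finset V, (∀ x, x ∈ A ↔ ∃ s ∈ S, ψ s = x) → defect n G A ≤ d
  le_defect : ∀ A : Finset V, (∀ s ∈ S, ψ s ∈ A) → d ≤ defect n G A

/-- The potential `f` grows by at most one along an edge, so no path of length at most n-1 inside
the configuration joins `q 0` to `q (n - 1)`. Parity yields such a path in the polygon. It must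
leave the configuration, and minimality of the defect makes it a clean arc of length n-1, to be
labelled by `q`. -/
theorem Config.exists_arc [DecidableEq ι] (hn : 3 ≤ n) (hb : G.IsBipartite)
    (hd : ∀ x y : V, ∃ w : G.Walk x y, w.length ≤ n) {d : ℤ} {π : ι → ℕ} {S : Finset ι}
    {E : ι → ι → Prop} {ψ : ι → V} (h : Config n G d π S E ψ) (q : ℕ → ι) (h0 : q 0 ∈ S)
    (h1 : q (n - 1) ∈ S) (hq : ∀ k, 0 < k → k < n - 1 → q k ∉ S)
    (hinj : ∀ k l, 0 < k → k < n - 1 → 0 < l → l < n - 1 → q k = q l → k = l)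
    (hπ : ∀ k ≤ n - 1, π (q k) % 2 = (π (q 0) + k) % 2)
    (f : ι → ℕ) (hf : ∀ s t, E s t → f t ≤ f s + 1) (hfq : f (q 0) + n ≤ f (q (n - 1))) :
    ∃ ψ' : ι → V, (∀ s ∈ S, ψ' s = ψ s) ∧
      Config n G d π (S ∪ (Finset.range n).image q) (fun s t => E s t ∨ SeqAdj (n - 1) q s t) ψ' := by
  classical
  obtain ⟨w₀, hw₀⟩ := h.parity _ h0 _ h1
  obtain ⟨w, hw, hwl⟩ := exists_short_path hb hd w₀ (by
    have := hπ (n - 1) le_rfl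
    rw [Nat.odd_iff]
    omega)
  have hp := isPathSeq_getVert hw
  have e0 : w.getVert 0 = ψ (q 0) := w.getVert_zero
  have e1 : w.getVert w.length = ψ (q (n - 1)) := w.getVert_length
  generalize w.getVert = p at hp e0 e1
  generalize w.length = m at hp e1 hwl
  have hmemI : ∀ s ∈ S, ψ s ∈ S.image ψ := fun s hs => Finset.mem_image_of_mem ψ hs
  have hout : ∃ k ≤ m, p k ∉ S.image ψ := by
    by_contra! hcon
    have key : ∀ k ≤ m, ∃ s ∈ S, ψ s = p k ∧ f s ≤ f (q 0) + k := by
      intro k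
      induction k with
      | zero => exact fun _ => ⟨q 0, h0, e0.symm, le_rfl⟩
      | succ k ih =>
        intro hk
        obtain ⟨s, hs, hsk, hsf⟩ := ih (by omega)
        obtain ⟨t, ht, htk⟩ := Finset.mem_image.1 (hcon (k + 1) hk)
        have hst := hp.adj k hk
        rw [← hsk, ← htk, h.adj s hs t ht] at hst
        have := hf s t hst
        exact ⟨t, ht, htk, by omega⟩
    obtain ⟨s, hs, hsm, hsf⟩ := key m le_rfl
    rw [e1] at hsm
    rw [h.inj hs h1 hsm] at hsf
    omega
  obtain ⟨k₀, hk₀, hk₀S⟩ := hout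
  have hclean := clean_of_minimal hn hwl hp (A := S.image ψ) (by rw [e0]; exact hmemI _ h0)
    (by rw [e1]; exact hmemI _ h1)
    (fun A' hA' => (h.defect_le _ (fun x => Finset.mem_image)).trans
      (h.le_defect A' fun s hs => hA' (hmemI s hs))) hk₀ hk₀S
  obtain rfl : m = n - 1 := by omega
  replace hclean := hclean.2
  -- Interior labels of the arc go to the vertices of the path; injectivity of `q` there makes the
  -- chosen index the right one.
  let ψ' : ι → V := fun s => if hs : ∃ k, 0 < k ∧ k < n - 1 ∧ q k = s then p hs.choose else ψ s
  have hψS : ∀ s ∈ S, ψ' s = ψ s := by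
    intro s hs
    have : ¬ ∃ k, 0 < k ∧ k < n - 1 ∧ q k = s := by
      rintro ⟨k, hk0, hk1, rfl⟩
      exact hq k hk0 hk1 hs
    exact dif_neg this
  have hψq : ∀ k ≤ n - 1, ψ' (q k) = p k := by
    intro k hk
    rcases Nat.eq_zero_or_pos k with rfl | hk0
    · rw [hψS _ h0, e0]
    rcases hk.eq_or_lt with rfl | hk1
    · rw [hψS _ h1, e1]
    have hex : ∃ l, 0 < l ∧ l < n - 1 ∧ q l = q k := ⟨k, hk0, hk1, rfl⟩
    have : hex.choose = k := hinj _ _ hex.choose_spec.1 hex.choose_spec.2.1 hk0 hk1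
      hex.choose_spec.2.2
    show dite _ _ _ = _
    rw [dif_pos hex, this]
  have hcases : ∀ s ∈ S ∪ (Finset.range n).image q, s ∈ S ∨ ∃ k, 0 < k ∧ k < n - 1 ∧ q k = s := by
    intro s hs
    rcases Finset.mem_union.1 hs with hs | hs
    · exact Or.inl hs
    · obtain ⟨k, hk, rfl⟩ := Finset.mem_image.1 hs
      rw [Finset.mem_range] at hk
      rcases Nat.eq_zero_or_pos k with rfl | hk0
      · exact Or.inl h0
      rcases (show k ≤ n - 1 by omega).eq_or_lt with rfl | hk1
      · exact Or.inl h1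
      · exact Or.inr ⟨k, hk0, hk1, rfl⟩
  have hqmem : ∀ k ≤ n - 1, q k ∈ S ∪ (Finset.range n).image q := fun k hk =>
    Finset.mem_union_right _ (Finset.mem_image.2 ⟨k, by rw [Finset.mem_range]; omega, rfl⟩)
  have hinj' : Set.InjOn ψ' (S ∪ (Finset.range n).image q : Finset ι) := by
    intro s hs t ht e
    have hne : ∀ s ∈ S, ∀ k, 0 < k → k < n - 1 → ψ' s ≠ p k := fun s hs k hk0 hk1 e => by
      rw [hψS s hs] at e
      exact (hclean k hk0 hk1).1 (e ▸ hmemI s hs)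
    rcases hcases s hs with hs | ⟨k, hk0, hk1, rfl⟩ <;>
      rcases hcases t ht with ht | ⟨l, hl0, hl1, rfl⟩
    · rw [hψS s hs, hψS t ht] at e
      exact h.inj hs ht e
    · rw [hψq l hl1.le] at e
      exact absurd e (hne s hs l hl0 hl1)
    · rw [hψq k hk1.le] at e
      exact absurd e.symm (hne t ht k hk0 hk1)
    · rw [hψq k hk1.le, hψq l hl1.le, hp.eq_iff hk1.le hl1.le] at e
      rw [e]
  have hEmem : ∀ s t, E s t ∨ SeqAdj (n - 1) q s t → s ∈ S ∪ (Finset.range n).image q ∧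
      t ∈ S ∪ (Finset.range n).image q := by
    rintro s t (hst | ⟨k, hk, ⟨rfl, rfl⟩ | ⟨rfl, rfl⟩⟩)
    · exact ⟨Finset.mem_union_left _ (h.mem s t hst).1, Finset.mem_union_left _ (h.mem s t hst).2⟩
    · exact ⟨hqmem _ (by omega), hqmem _ (by omega)⟩
    · exact ⟨hqmem _ (by omega), hqmem _ (by omega)⟩
  have hpmem : ∀ s ∈ S ∪ (Finset.range n).image q,
      ψ' s ∈ S.image ψ ∪ (Finset.range (n - 1 + 1)).image p := by
    intro s hs
    rcases hcases s hs with hs | ⟨k, hk0, hk1, rfl⟩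
    · rw [hψS s hs]
      exact Finset.mem_union_left _ (hmemI s hs)
    · rw [hψq k hk1.le]
      exact Finset.mem_union_right _ (Finset.mem_image.2 ⟨k, by rw [Finset.mem_range]; omega, rfl⟩)
  have hnbr : ∀ k, 0 < k → k < n - 1 → ∀ t ∈ S ∪ (Finset.range n).image q,
      (G.Adj (p k) (ψ' t) ↔ t = q (k - 1) ∨ t = q (k + 1)) := by
    intro k hk0 hk1 t ht
    have a1 := hp.adj (k - 1) (by omega)
    rw [show k - 1 + 1 = k by omega] at a1
    have a2 := hp.adj k hk1
    constructor
    · intro hadj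
      have hm : ∀ j ≤ n - 1, p j ∈ S.image ψ ∪ (Finset.range (n - 1 + 1)).image p := fun j hj =>
        Finset.mem_union_right _ (Finset.mem_image.2 ⟨j, by rw [Finset.mem_range]; omega, rfl⟩)
      rcases eq_or_eq_of_dg_le_two (hclean k hk0 hk1).2 (hm (k - 1) (by omega)) (hm (k + 1) hk1)
        (hpmem t ht) (fun e => by rw [hp.eq_iff (by omega) hk1] at e; omega) a1.symm a2 hadj with e | e
      · rw [← hψq (k - 1) (by omega)] at e
        exact Or.inl (hinj' ht (hqmem _ (by omega)) e)
      · rw [← hψq (k + 1) hk1] at e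
        exact Or.inr (hinj' ht (hqmem _ hk1) e)
    · rintro (rfl | rfl)
      · rw [hψq _ (by omega)]
        exact a1.symm
      · rw [hψq _ hk1]
        exact a2
  have hint : ∀ k, 0 < k → k < n - 1 → ∀ t, (E (q k) t ∨ SeqAdj (n - 1) q (q k) t) ↔
      (t = q (k - 1) ∨ t = q (k + 1)) := by
    intro k hk0 hk1 t
    constructor
    · rintro (hst | ⟨l, hl, ⟨e, rfl⟩ | ⟨rfl, e⟩⟩)
      · exact absurd (h.mem _ _ hst).1 (hq k hk0 hk1)
      · have hl0 : l ≠ 0 := by rintro rfl; exact hq k hk0 hk1 (e ▸ h0)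
        rw [hinj k l hk0 hk1 (by omega) hl e]
        exact Or.inr rfl
      · have hl1 : l + 1 ≠ n - 1 := fun hl1 => hq k hk0 hk1 (by rw [e, hl1]; exact h1)
        rw [hinj k (l + 1) hk0 hk1 (by omega) (by omega) e]
        exact Or.inl rfl
    · rintro (rfl | rfl)
      · exact Or.inr ⟨k - 1, by omega, Or.inr ⟨rfl, by rw [show k - 1 + 1 = k by omega]⟩⟩
      · exact Or.inr ⟨k, hk1, Or.inl ⟨rfl, rfl⟩⟩
  have hsymm : ∀ s ∈ S, ∀ t ∈ S, E s t → E t s := fun s hs t ht hst =>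
    (h.adj t ht s hs).1 ((h.adj s hs t ht).2 hst).symm
  have hEsymm : ∀ s t, E s t ∨ SeqAdj (n - 1) q s t → E t s ∨ SeqAdj (n - 1) q t s := by
    rintro s t (hst | ⟨k, hk, hst⟩)
    · exact Or.inl (hsymm s (h.mem s t hst).1 t (h.mem s t hst).2 hst)
    · exact Or.inr ⟨k, hk, hst.symm⟩
  refine ⟨ψ', hψS, hEmem, hinj', fun s hs t ht => ?_, fun s hs t ht => ?_, fun A hA => ?_,
    fun A hA => ?_⟩
  · rcases hcases s hs with hsS | ⟨k, hk0, hk1, rfl⟩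
    · rcases hcases t ht with htS | ⟨l, hl0, hl1, rfl⟩
      · rw [hψS s hsS, hψS t htS, h.adj s hsS t htS]
        refine ⟨Or.inl, ?_⟩
        rintro (hst | ⟨k, hk, hst⟩)
        · exact hst
        · exfalso
          have key : ∀ k, k < n - 1 → q k ∈ S → q (k + 1) ∈ S → False := by
            intro k hk a b
            rcases Nat.eq_zero_or_pos k with rfl | hk0
            · exact hq 1 (by omega) (by omega) b
            · exact hq k hk0 hk a
          rcases hst with ⟨rfl, rfl⟩ | ⟨rfl, rfl⟩
          · exact key k hk hsS htS
          · exact key k hk htS hsS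
      · rw [G.adj_comm, hψq l hl1.le, hnbr l hl0 hl1 s hs, ← hint l hl0 hl1 s]
        exact ⟨hEsymm _ _, hEsymm _ _⟩
    · rw [hψq k hk1.le, hnbr k hk0 hk1 t ht, ← hint k hk0 hk1 t]
  · have key : ∀ s ∈ S ∪ (Finset.range n).image q,
        ∃ w : G.Walk (ψ (q 0)) (ψ' s), w.length % 2 = (π (q 0) + π s) % 2 := by
      intro s hs
      rcases hcases s hs with hsS | ⟨k, hk0, hk1, rfl⟩
      · rw [hψS s hsS]
        exact h.parity _ h0 s hsS
      · obtain ⟨w, hw, -⟩ := exists_walk_of_adj k p fun i hi => hp.adj i (by omega)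
        refine ⟨w.copy e0 (hψq k hk1.le).symm, ?_⟩
        rw [SimpleGraph.Walk.length_copy, hw]
        have := hπ k hk1.le
        omega
    obtain ⟨w, hw⟩ := key s hs
    obtain ⟨w', hw'⟩ := key t ht
    refine ⟨w.reverse.append w', ?_⟩
    rw [SimpleGraph.Walk.length_append, SimpleGraph.Walk.length_reverse]
    omega
  · have e : A = S.image ψ ∪ (Finset.range (n - 1 + 1)).image p := by
      ext x
      rw [hA]
      constructor
      · rintro ⟨s, hs, rfl⟩
        exact hpmem s hs
      · intro hx
        rcases Finset.mem_union.1 hx with hx | hx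
        · obtain ⟨s, hs, rfl⟩ := Finset.mem_image.1 hx
          exact ⟨s, Finset.mem_union_left _ hs, hψS s hs⟩
        · obtain ⟨k, hk, rfl⟩ := Finset.mem_image.1 hx
          rw [Finset.mem_range] at hk
          exact ⟨q k, hqmem k (by omega), hψq k (by omega)⟩
    rw [e]
    exact (defect_union_path_le hn (by omega) hp _ (by rw [e0]; exact hmemI _ h0)
      (by rw [e1]; exact hmemI _ h1)).trans (h.defect_le _ fun x => Finset.mem_image)
  · refine h.le_defect A fun s hs => ?_
    rw [← hψS s hs]
    exact hA s (Finset.mem_union_left _ hs)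

/-- The path `(x₀, …, xₙ₊₃)` of `Γ^{n+3}` as a configuration. -/
theorem config_gammaPath (hn : 3 ≤ n) [DecidableEq ι] {π : ι → ℕ} (x : ℕ → ι) (g : ι → ℕ)
    (hg : ∀ t, g (x t) = t) (hπ : ∀ t ≤ n + 3, π (x t) % 2 = t % 2) :
    Config n (Gamma n (n + 3)) (4 * n + 4) π ((Finset.range (n + 4)).image x)
      (SeqAdj (n + 3) x) (fun s => gammaPath n (g s)) := by
  have hmem : ∀ s ∈ (Finset.range (n + 4)).image x, ∃ t ≤ n + 3, s = x t := by
    intro s hs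
    obtain ⟨t, ht, rfl⟩ := Finset.mem_image.1 hs
    rw [Finset.mem_range] at ht
    exact ⟨t, by omega, rfl⟩
  have hmem' : ∀ t ≤ n + 3, x t ∈ (Finset.range (n + 4)).image x := fun t ht =>
    Finset.mem_image.2 ⟨t, by rw [Finset.mem_range]; omega, rfl⟩
  have hp := isPathSeq_gammaPath hn
  refine ⟨?_, fun s hs t ht e => ?_, fun s hs t ht => ?_, fun s hs t ht => ?_, fun A hA => ?_,
    fun A hA => ?_⟩
  · rintro s t ⟨k, hk, ⟨rfl, rfl⟩ | ⟨rfl, rfl⟩⟩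
    · exact ⟨hmem' _ (by omega), hmem' _ (by omega)⟩
    · exact ⟨hmem' _ (by omega), hmem' _ (by omega)⟩
  · obtain ⟨a, ha, rfl⟩ := hmem s hs
    obtain ⟨b, hb, rfl⟩ := hmem t ht
    simp only [hg] at e
    rw [hp.eq_iff ha hb] at e
    rw [e]
  · obtain ⟨a, ha, rfl⟩ := hmem s hs
    obtain ⟨b, hb, rfl⟩ := hmem t ht
    rw [hg, hg, gamma_adj_gammaPath hn ha hb]
    constructor
    · rintro (rfl | rfl)
      · exact ⟨a, by omega, Or.inl ⟨rfl, rfl⟩⟩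
      · exact ⟨b, by omega, Or.inr ⟨rfl, rfl⟩⟩
    · rintro ⟨k, hk, ⟨h1, h2⟩ | ⟨h1, h2⟩⟩
      · have e1 := congrArg g h1
        have e2 := congrArg g h2
        rw [hg, hg] at e1 e2
        omega
      · have e1 := congrArg g h1
        have e2 := congrArg g h2
        rw [hg, hg] at e1 e2
        omega
  · obtain ⟨a, ha, rfl⟩ := hmem s hs
    obtain ⟨b, hb, rfl⟩ := hmem t ht
    have key : ∀ a ≤ n + 3, ∃ w : (Gamma n (n + 3)).Walk (gammaPath n 0) (gammaPath n a),
        w.length = a := fun a ha => by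
      obtain ⟨w, hw, -⟩ := exists_walk_of_adj a _ fun i hi => hp.adj i (by omega)
      exact ⟨w, hw⟩
    rw [hg, hg]
    obtain ⟨w, hw⟩ := key a ha
    obtain ⟨w', hw'⟩ := key b hb
    refine ⟨w.reverse.append w', ?_⟩
    rw [SimpleGraph.Walk.length_append, SimpleGraph.Walk.length_reverse, hw, hw']
    have := hπ a ha
    have := hπ b hb
    omega
  · have e : A = gammaBase n := by
      ext y
      rw [hA, gammaBase, mem_initialImage]
      constructor
      · rintro ⟨s, hs, rfl⟩
        obtain ⟨a, ha, rfl⟩ := hmem s hs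
        exact ⟨a, ha, by rw [hg]⟩
      · rintro ⟨t, ht, rfl⟩
        exact ⟨x t, hmem' t ht, by rw [hg]⟩
    rw [e]
    exact gammaBase_defect_le hn
  · refine gamma_defect_ge hn fun y hy => ?_
    rw [gammaBase, mem_initialImage] at hy
    obtain ⟨t, ht, rfl⟩ := hy
    have := hA (x t) (hmem' t ht)
    rwa [hg] at this

end Config

/-! ### Proper self-embeddings -/

section SelfEmbedding

variable {n : ℕ}

theorem ends_of_stageArc_zero (hn : 3 ≤ n) {P : ℕ → GammaVertex n (n + 3)}
    (hP : IsStageArc n (SimpleGraph.pathGraph (n + 3 + 1)) 0 P) :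
    ∃ i ≤ 2, (P 0 = gammaPath n i ∧ P (n - 1) = gammaPath n (i + n + 1)) ∨
      (P (n - 1) = gammaPath n i ∧ P 0 = gammaPath n (i + n + 1)) := by
  obtain ⟨s, hs, e0⟩ := exists_gammaPath (hP.ends hn).1
  obtain ⟨t, ht, e1⟩ := exists_gammaPath (hP.ends hn).2
  have key : ∀ s t, s ≤ t → t ≤ n + 3 →
      (freeStage n (SimpleGraph.pathGraph (n + 3 + 1)) 0).spanningCoe.dist (gammaPath n s).1
        (gammaPath n t).1 = n + 1 → t = s + n + 1 := by
    intro s t hst ht hd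
    apply le_antisymm
    · obtain ⟨w, hw⟩ := (SimpleGraph.Reachable.of_dist_ne_zero
        (G := (freeStage n (SimpleGraph.pathGraph (n + 3 + 1)) 0).spanningCoe)
        (by rw [hd]; omega)).exists_walk_length_eq_dist
      rw [hd] at hw
      let f : FreeVertex (Fin (n + 3 + 1)) → ℤ := fun v => match v with
        | .base v => (v : ℕ)
        | .arc _ _ _ => 0
      have h1 := abs_sub_le_length (f := f) (fun a b hab => by
        obtain ⟨v, w, h, rfl, rfl⟩ := hab
        rw [SimpleGraph.pathGraph_adj] at h
        show |((v : ℕ) : ℤ) - ((w : ℕ) : ℤ)| ≤ 1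
        rw [abs_le]
        omega) w
      rw [hw, gammaPath_val n (by omega), gammaPath_val n (by omega)] at h1
      have h2 : |((s : ℕ) : ℤ) - ((t : ℕ) : ℤ)| ≤ (n + 1 : ℕ) := h1
      rw [abs_le] at h2
      omega
    · obtain ⟨w, hw, -⟩ := exists_walk_of_adj
        (G := (freeStage n (SimpleGraph.pathGraph (n + 3 + 1)) 0).spanningCoe) (t - s)
        (fun k => (gammaPath n (s + k)).1) (fun k hk => by
          refine ⟨⟨s + k, by omega⟩, ⟨s + (k + 1), by omega⟩, ?_, ?_, ?_⟩
          · rw [SimpleGraph.pathGraph_adj]; left; rfl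
          · rw [gammaPath_val n (by omega)]; rfl
          · rw [gammaPath_val n (by omega)]; rfl)
      have h1 := SimpleGraph.dist_le w
      rw [hw] at h1
      simp only [Nat.add_zero, show s + (t - s) = t by omega, hd] at h1
      omega
  have hd := hP.dist_eq hn
  rw [e0, e1] at hd
  rcases le_total s t with h | h
  · have := key s t h ht hd
    exact ⟨s, by omega, Or.inl ⟨e0, by rw [e1, this]⟩⟩
  · rw [SimpleGraph.dist_comm] at hd
    have := key t s h hs hd
    exact ⟨t, by omega, Or.inr ⟨e1, by rw [e0, this]⟩⟩

/-- `Z` is what stage 1 becomes under the embedding generated by `y`. It has surplus at least 2; as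
the arcs can be adjoined without raising the defect, every finite set containing `y` has defect at
least 4n+4 and the embedding exists. Were it onto, openness over stage 1 would give a piece of `C`
outside `Z`. -/
theorem exists_proper_embedding_of (hn : 3 ≤ n) {y : ℕ → GammaVertex n (n + 3)}
    (hy : IsPathSeq (Gamma n (n + 3)) (n + 3) y) {r : ℕ → ℕ → GammaVertex n (n + 3)}
    (hr : ∀ i ≤ 2, IsPathSeq (Gamma n (n + 3)) (n - 1) (r i)) (hr0 : ∀ i ≤ 2, r i 0 = y i)
    (hr1 : ∀ i ≤ 2, r i (n - 1) = y (i + n + 1))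
    (hry : ∀ i ≤ 2, ∀ k, 0 < k → k < n - 1 → ∀ t ≤ n + 3, r i k ≠ y t)
    {Z C : Finset (GammaVertex n (n + 3))}
    (hZ : ∀ x, x ∈ Z ↔ (∃ t ≤ n + 3, y t = x) ∨ ∃ i ≤ 2, ∃ k ≤ n - 1, r i k = x)
    (hCZ : ¬ C ⊆ Z) (hC : ¬ HasPiece n (Gamma n (n + 3)) Z C) :
    ∃ φ : Gamma n (n + 3) ↪g Gamma n (n + 3), ¬ Function.Surjective φ := by
  classical
  have hg := gamma_largeGirth hn
  have hyZ : ∀ t ≤ n + 3, y t ∈ Z := fun t ht => (hZ _).2 (Or.inl ⟨t, ht, rfl⟩)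
  have hrZ : ∀ i ≤ 2, ∀ k ≤ n - 1, r i k ∈ Z := fun i hi k hk =>
    (hZ _).2 (Or.inr ⟨i, hi, k, hk, rfl⟩)
  have hradj0 : ∀ i ≤ 2, (Gamma n (n + 3)).Adj (y i) (r i 1) := fun i hi => by
    have := (hr i hi).adj 0 (by omega)
    rwa [hr0 i hi] at this
  have hradj1 : ∀ i ≤ 2, (Gamma n (n + 3)).Adj (y (i + n + 1)) (r i (n - 2)) := fun i hi => by
    have := (hr i hi).adj (n - 2) (by omega)
    rw [show n - 2 + 1 = n - 1 by omega, hr1 i hi] at this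
    exact this.symm
  have hyadj : ∀ t, 0 < t → t ≤ n + 3 → (Gamma n (n + 3)).Adj (y t) (y (t - 1)) := fun t h0 ht => by
    have := hy.adj (t - 1) (by omega)
    rw [show t - 1 + 1 = t by omega] at this
    exact this.symm
  have hdeg2 : ∀ x ∈ Z, 2 ≤ dg (Gamma n (n + 3)) Z x := by
    intro x hx
    rcases (hZ x).1 hx with ⟨t, ht, rfl⟩ | ⟨i, hi, k, hk, rfl⟩
    · rcases Nat.eq_zero_or_pos t with rfl | h0
      · exact two_le_dg (hyZ 1 (by omega)) (hrZ 0 (by omega) 1 (by omega))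
          (hry 0 (by omega) 1 (by omega) (by omega) 1 (by omega)).symm (hy.adj 0 (by omega))
          (hradj0 0 (by omega))
      rcases ht.eq_or_lt with rfl | h1
      · have h2 := hradj1 2 le_rfl
        rw [show 2 + n + 1 = n + 3 by omega] at h2
        exact two_le_dg (hyZ (n + 2) (by omega)) (hrZ 2 (by omega) (n - 2) (by omega))
          (hry 2 (by omega) (n - 2) (by omega) (by omega) (n + 2) (by omega)).symm
          (hyadj (n + 3) (by omega) le_rfl) h2
      · refine two_le_dg (hyZ (t - 1) (by omega)) (hyZ (t + 1) (by omega)) ?_ (hyadj t h0 ht)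
          (hy.adj t h1)
        rw [Ne, hy.eq_iff (by omega) (by omega)]
        omega
    · rcases Nat.eq_zero_or_pos k with rfl | h0
      · have : ∃ t ≤ n + 3, y t = r i 0 := ⟨i, by omega, (hr0 i hi).symm⟩
        obtain ⟨t, ht, e⟩ := this
        have h0 : t = i := by
          rw [hr0 i hi, hy.eq_iff ht (by omega)] at e
          exact e
        subst h0
        rw [← e]
        refine two_le_dg (hyZ (t + 1) (by omega)) (hrZ t hi 1 (by omega))
          (hry t hi 1 (by omega) (by omega) _ (by omega)).symm (hy.adj t (by omega)) (hradj0 t hi)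
      rcases hk.eq_or_lt with rfl | h1
      · rw [hr1 i hi]
        exact two_le_dg (hyZ (i + n + 1 - 1) (by omega)) (hrZ i hi (n - 2) (by omega))
          (hry i hi (n - 2) (by omega) (by omega) _ (by omega)).symm
          (hyadj (i + n + 1) (by omega) (by omega)) (hradj1 i hi)
      · have h2 := (hr i hi).adj (k - 1) (by omega)
        rw [show k - 1 + 1 = k by omega] at h2
        refine two_le_dg (hrZ i hi (k - 1) (by omega)) (hrZ i hi (k + 1) (by omega)) ?_ h2.symm
          ((hr i hi).adj k h1)
        rw [Ne, (hr i hi).eq_iff (by omega) (by omega)]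
        omega
  have hdeg3 : ∀ t, t = 1 ∨ t = 2 ∨ t = n + 1 ∨ t = n + 2 → 3 ≤ dg (Gamma n (n + 3)) Z (y t) := by
    intro t ht
    have hz : ∃ i ≤ 2, ∃ k, 0 < k ∧ k < n - 1 ∧ (Gamma n (n + 3)).Adj (y t) (r i k) := by
      rcases ht with rfl | rfl | rfl | rfl
      · exact ⟨1, by omega, 1, by omega, by omega, hradj0 1 (by omega)⟩
      · exact ⟨2, by omega, 1, by omega, by omega, hradj0 2 (by omega)⟩
      · have := hradj1 0 (by omega)
        rw [Nat.zero_add] at this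
        exact ⟨0, by omega, n - 2, by omega, by omega, this⟩
      · have := hradj1 1 (by omega)
        rw [show 1 + n + 1 = n + 2 by omega] at this
        exact ⟨1, by omega, n - 2, by omega, by omega, this⟩
    obtain ⟨i, hi, k, hk0, hk1, hadj⟩ := hz
    refine three_le_dg (hyZ (t - 1) (by omega)) (hyZ (t + 1) (by omega)) (hrZ i hi k (by omega)) ?_
      (hry i hi k hk0 hk1 _ (by omega)).symm (hry i hi k hk0 hk1 _ (by omega)).symm
      (hyadj t (by omega) (by omega)) (hy.adj t (by omega)) hadj
    rw [Ne, hy.eq_iff (by omega) (by omega)]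
    omega
  -- All valencies in `Z` are at least 2, and the four branching vertices `y 1`, `y 2`, `y (n + 1)`,
  -- `y (n + 2)` contribute one more each.
  have he2 : 2 * Z.card + 4 ≤ e2 (Gamma n (n + 3)) Z := by
    have hB : ({y 1, y 2, y (n + 1), y (n + 2)} : Finset (GammaVertex n (n + 3))).card = 4 := by
      have : ∀ a b, a ≤ n + 3 → b ≤ n + 3 → a ≠ b → y a ≠ y b := fun a b ha hb hab e =>
        hab ((hy.eq_iff ha hb).1 e)
      rw [Finset.card_insert_of_notMem, Finset.card_insert_of_notMem, Finset.card_pair]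
      · exact this _ _ (by omega) (by omega) (by omega)
      · simp only [Finset.mem_insert, Finset.mem_singleton, not_or]
        exact ⟨this _ _ (by omega) (by omega) (by omega), this _ _ (by omega) (by omega) (by omega)⟩
      · simp only [Finset.mem_insert, Finset.mem_singleton, not_or]
        exact ⟨this _ _ (by omega) (by omega) (by omega), this _ _ (by omega) (by omega) (by omega),
          this _ _ (by omega) (by omega) (by omega)⟩
    have hsum : ∑ x ∈ Z, (2 + if x ∈ ({y 1, y 2, y (n + 1), y (n + 2)} :
        Finset (GammaVertex n (n + 3))) then 1 else 0) ≤ e2 (Gamma n (n + 3)) Z := by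
      refine Finset.sum_le_sum fun x hx => ?_
      split_ifs with h
      · simp only [Finset.mem_insert, Finset.mem_singleton] at h
        rcases h with rfl | rfl | rfl | rfl <;> exact hdeg3 _ (by omega)
      · exact hdeg2 x hx
    rw [Finset.sum_add_distrib, Finset.sum_const, Finset.sum_ite_mem, Finset.sum_const,
      Finset.inter_eq_right.2, hB] at hsum
    · simpa [mul_comm] using hsum
    · intro x hx
      simp only [Finset.mem_insert, Finset.mem_singleton] at hx
      rcases hx with rfl | rfl | rfl | rfl <;> exact hyZ _ (by omega)
  have hmin : ∀ A : Finset (GammaVertex n (n + 3)), (∀ t ≤ n + 3, y t ∈ A) →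
      4 * (n : ℤ) + 4 ≤ defect n (Gamma n (n + 3)) A := by
    intro A hA
    have step : ∀ i ≤ 2, ∀ B : Finset (GammaVertex n (n + 3)), A ⊆ B →
        ∃ B', B ⊆ B' ∧ (∀ k ≤ n - 1, r i k ∈ B') ∧
          defect n (Gamma n (n + 3)) B' ≤ defect n (Gamma n (n + 3)) B := by
      intro i hi B hB
      obtain ⟨B', h1, h2, -, h3⟩ := exists_superset_of_isPathSeq hn (show n - 1 + 1 ≤ n by omega)
        (hr i hi) B (by rw [hr0 i hi]; exact hB (hA _ (by omega)))
        (by rw [hr1 i hi]; exact hB (hA _ (by omega)))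
      exact ⟨B', h1, h2, h3⟩
    obtain ⟨B0, a0, b0, c0⟩ := step 0 (by omega) A subset_rfl
    obtain ⟨B1, a1, b1, c1⟩ := step 1 (by omega) B0 a0
    obtain ⟨B2, a2, b2, c2⟩ := step 2 (by omega) B1 (a0.trans a1)
    refine le_trans (defect_ge_of_subset hn hg (gamma_hasPiece hn) (A := B2) (B := Z) ?_ he2)
      (c2.trans (c1.trans c0))
    intro x hx
    rcases (hZ x).1 hx with ⟨t, ht, rfl⟩ | ⟨i, hi, k, hk, rfl⟩
    · exact a2 (a1 (a0 (hA t ht)))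
    · interval_cases i
      · exact a2 (a1 (b0 k hk))
      · exact a2 (b1 k hk)
      · exact b2 k hk
  obtain ⟨φ, hφ⟩ := exists_gamma_embedding hn (gamma_isBipartite hn) (gamma_exists_walk hn) hy hmin
  refine ⟨φ, fun hsurj => ?_⟩
  -- Uniqueness of paths of length n-1 identifies the images of the first-stage arcs with the given
  -- arcs `r i`.
  have harc : ∀ i ≤ 2, ∀ P, IsStageArc n (SimpleGraph.pathGraph (n + 3 + 1)) 0 P →
      P 0 = gammaPath n i → P (n - 1) = gammaPath n (i + n + 1) → ∀ k ≤ n - 1, φ (P k) = r i k := by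
    intro i hi P hP h0 h1
    have := (hg.pathSeq_unique ((hP.isPathSeq hn).map φ) (hr i hi)
      (by rw [h0, hφ _ (by omega), hr0 i hi]) (by rw [h1, hφ _ (by omega), hr1 i hi]) (by omega)).2
    exact this
  have hlev : φ '' lev n (SimpleGraph.pathGraph (n + 3 + 1)) 1 = Z := by
    ext x
    rw [Finset.mem_coe, hZ]
    constructor
    · rintro ⟨a, ha, rfl⟩
      by_cases ha' : a ∈ lev n (SimpleGraph.pathGraph (n + 3 + 1)) 0
      · obtain ⟨t, ht, rfl⟩ := exists_gammaPath ha'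
        exact Or.inl ⟨t, ht, (hφ t ht).symm⟩
      · obtain ⟨P, k, hP, hk0, hk1, rfl⟩ := exists_stageArc_of_mem hn ha ha'
        right
        obtain ⟨i, hi, ⟨h0, h1⟩ | ⟨h0, h1⟩⟩ := ends_of_stageArc_zero hn hP
        · exact ⟨i, hi, k, hk1.le, (harc i hi P hP h0 h1 k hk1.le).symm⟩
        · refine ⟨i, hi, n - 1 - k, by omega, ?_⟩
          rw [← harc i hi _ hP.reverse (by rw [Nat.sub_zero, h0]) (by rw [Nat.sub_self, h1]) _
            (by omega)]
          rw [show n - 1 - (n - 1 - k) = k by omega]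
    · rintro (⟨t, ht, rfl⟩ | ⟨i, hi, k, hk, rfl⟩)
      · exact ⟨gammaPath n t, lev_mono (Nat.zero_le 1) (gammaPath_mem t), hφ t ht⟩
      · obtain ⟨P, hP, h0, h1⟩ := gamma_exists_arc hn hi
        exact ⟨P k, hP.mem hn hk, harc i hi P hP h0 h1 k hk⟩
  have hC' : (C.preimage φ φ.injective.injOn).map φ.toEmbedding = C := by
    ext x
    rw [Finset.mem_map]
    constructor
    · rintro ⟨a, ha, rfl⟩
      exact Finset.mem_preimage.1 ha
    · intro hx
      obtain ⟨a, rfl⟩ := hsurj x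
      exact ⟨a, Finset.mem_preimage.2 hx, rfl⟩
  have hpiece := hasPiece_lev hn 1 (C.preimage φ φ.injective.injOn) (by
    intro hsub
    apply hCZ
    intro x hx
    obtain ⟨a, rfl⟩ := hsurj x
    rw [← Finset.mem_coe, ← hlev]
    exact ⟨a, hsub (Finset.mem_coe.2 (Finset.mem_preimage.2 hx)), rfl⟩)
  have h2 := HasPiece.map φ hpiece
  rw [hC', hlev] at h2
  exact hC h2

end SelfEmbedding

/-! ### A proper self-embedding for `n ≥ 4` -/

section Large

variable {n : ℕ}

/-- The initial vertices of six arcs to be added successively to the path `(x₀, …, xₙ₊₃)`. The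
label `(0, j)` stands for `x_j`, and `(a, j)` for the `j`-th vertex of the `a`-th arc. -/
def arcStart : ℕ → ℕ × ℕ
  | 1 => (0, 0)
  | 2 => (0, 1)
  | 3 => (0, 2)
  | 4 => (1, 1)
  | 5 => (2, 1)
  | _ => (0, 3)

/-- The final vertices of the six arcs. -/
def arcEnd (n : ℕ) : ℕ → ℕ × ℕ
  | 1 => (0, n + 1)
  | 2 => (0, n + 2)
  | 3 => (0, n + 3)
  | 4 => (3, n - 2)
  | 5 => (4, n - 2)
  | _ => (4, n - 3)

/-- The labels of the `a`-th arc. -/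
def arcSeq (n a k : ℕ) : ℕ × ℕ :=
  if k = 0 then arcStart a else if k = n - 1 then arcEnd n a else (a, k)

/-- The labels of the path and of the arcs before the `a`-th. -/
def arcLabels (n a : ℕ) : Finset (ℕ × ℕ) :=
  (Finset.range (n + 4)).image (fun k => (0, k)) ∪ Finset.Ico 1 a ×ˢ Finset.Icc 1 (n - 2)

/-- Adjacency of labels. -/
def ArcAdj (n a : ℕ) (s t : ℕ × ℕ) : Prop :=
  SeqAdj (n + 3) (fun k => (0, k)) s t ∨ ∃ b, 1 ≤ b ∧ b < a ∧ SeqAdj (n - 1) (arcSeq n b) s t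

/-- The parity of the labels. -/
def arcParity : ℕ × ℕ → ℕ
  | (2, j) => 1 + j
  | (4, j) => 1 + j
  | (6, j) => 1 + j
  | (_, j) => j

/-- The distance of a label from the initial vertex of the `a`-th arc, before the latter is
added. -/
def arcDist (n : ℕ) : ℕ → ℕ → ℕ → ℕ
  | 1, _, j => j
  | 2, 0, j => (1 - j) + (j - 1)
  | 2, _, j => 1 + j
  | 3, 0, j => (2 - j) + (j - 2)
  | 3, 1, j => min (2 + j) (n - 1)
  | 3, _, j => 1 + j
  | 4, 0, j => if j ≤ n + 1 then min (j + 1) (2 * n - 1 - j) else j - 3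
  | 4, 1, j => j - 1
  | 4, 2, j => min (2 + j) (2 * n - 2 - j)
  | 4, _, j => min (3 + j) (2 * n - 1 - j)
  | 5, 0, j => if j = 0 then 2 else if j ≤ n + 1 then min j (2 * n - j) else
      if j = n + 2 then n - 2 else n - 1
  | 5, 1, j => min (2 + j) (2 * n - 2 - j)
  | 5, 2, j => j - 1
  | 5, 3, j => min (2 + j) (2 * n - 2 - j)
  | 5, _, j => min (3 + j) (2 * n - 1 - j)
  | _, 0, j => if j ≤ n then (3 - j) + (j - 3) else j - 3
  | _, 1, j => min (3 + j) (2 * n - 3 - j)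
  | _, 2, j => min (2 + j) (n - 1)
  | _, 3, j => min (1 + j) (2 * n - 1 - j)
  | _, 4, j => min (4 + j) (2 * n - 2 - j)
  | _, _, j => min (3 + j) n

theorem mem_arcLabels {a : ℕ} {s : ℕ × ℕ} : s ∈ arcLabels n a ↔
    (s.1 = 0 ∧ s.2 ≤ n + 3) ∨ ((1 ≤ s.1 ∧ s.1 < a) ∧ 1 ≤ s.2 ∧ s.2 ≤ n - 2) := by
  obtain ⟨i, j⟩ := s
  simp only [arcLabels, Finset.mem_union, Finset.mem_image, Finset.mem_range, Prod.mk.injEq,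
    Finset.mem_product, Finset.mem_Ico, Finset.mem_Icc]
  refine or_congr ⟨?_, fun h => ⟨j, by omega, h.1.symm, rfl⟩⟩ Iff.rfl
  rintro ⟨k, hk, h1, h2⟩
  omega

theorem arcSeq_zero (a : ℕ) : arcSeq n a 0 = arcStart a := rfl

theorem arcSeq_last (hn : 4 ≤ n) (a : ℕ) : arcSeq n a (n - 1) = arcEnd n a := by
  simp [arcSeq, show n - 1 ≠ 0 by omega]

theorem arcSeq_interior {a k : ℕ} (h0 : 0 < k) (h1 : k < n - 1) : arcSeq n a k = (a, k) := by
  simp [arcSeq, show k ≠ 0 by omega, show k ≠ n - 1 by omega]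

theorem arcStart_mem (hn : 4 ≤ n) {a : ℕ} (h1 : 1 ≤ a) (h6 : a ≤ 6) :
    arcStart a ∈ arcLabels n a := by
  rw [mem_arcLabels]
  interval_cases a <;> simp [arcStart] <;> omega

theorem arcEnd_mem (hn : 4 ≤ n) {a : ℕ} (h1 : 1 ≤ a) (h6 : a ≤ 6) :
    arcEnd n a ∈ arcLabels n a := by
  rw [mem_arcLabels]
  interval_cases a <;> simp [arcEnd] <;> omega

theorem arcParity_arcSeq (hn : 4 ≤ n) {a : ℕ} (h1 : 1 ≤ a) (h6 : a ≤ 6) {k : ℕ}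
    (hk : k ≤ n - 1) : arcParity (arcSeq n a k) % 2 = (arcParity (arcSeq n a 0) + k) % 2 := by
  rcases Nat.eq_zero_or_pos k with rfl | h0
  · rfl
  rcases hk.eq_or_lt with rfl | hk1
  · rw [arcSeq_zero, arcSeq_last hn]
    interval_cases a <;> simp [arcStart, arcEnd, arcParity] <;> omega
  · rw [arcSeq_zero, arcSeq_interior h0 hk1]
    interval_cases a <;> simp [arcStart, arcParity] <;> omega

/-- Two natural numbers differ by at most one. -/
abbrev Near (a b : ℕ) : Prop := a ≤ b + 1 ∧ b ≤ a + 1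

theorem near_of_arcSeq (hn : 4 ≤ n) {b : ℕ} {f : ℕ × ℕ → ℕ} (h0 : Near (f (arcStart b)) (f (b, 1)))
    (h : ∀ j, 1 ≤ j → j + 1 ≤ n - 2 → Near (f (b, j)) (f (b, j + 1)))
    (h1 : Near (f (b, n - 2)) (f (arcEnd n b))) {k : ℕ} (hk : k < n - 1) :
    Near (f (arcSeq n b k)) (f (arcSeq n b (k + 1))) := by
  rcases Nat.eq_zero_or_pos k with rfl | hk0
  · rw [arcSeq_zero, arcSeq_interior (by omega) (by omega)]
    exact h0
  rcases (show k + 1 ≤ n - 1 from hk).eq_or_lt with h2 | h2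
  · rw [h2, arcSeq_last hn, arcSeq_interior hk0 hk, show k = n - 2 by omega]
    exact h1
  · rw [arcSeq_interior hk0 hk, arcSeq_interior (by omega) h2]
    exact h k hk0 (by omega)

/-- This is the Lipschitz property that `Config.exists_arc` asks of its potential, checked along the
path and along each earlier arc. -/
theorem arcDist_near (hn : 4 ≤ n) {a : ℕ} (h1 : 1 ≤ a) (h6 : a ≤ 6) {s t : ℕ × ℕ}
    (h : ArcAdj n a s t) : Near (arcDist n a s.1 s.2) (arcDist n a t.1 t.2) := by
  have hx : ∀ k < n + 3, Near (arcDist n a 0 k) (arcDist n a 0 (k + 1)) := by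
    intro k hk
    interval_cases a <;> simp only [arcDist] <;> constructor <;>
      (try split_ifs) <;> first | contradiction | omega
  have hq : ∀ b, 1 ≤ b → b < a → ∀ k < n - 1,
      Near (arcDist n a (arcSeq n b k).1 (arcSeq n b k).2)
        (arcDist n a (arcSeq n b (k + 1)).1 (arcSeq n b (k + 1)).2) := by
    intro b hb hba k hk
    refine near_of_arcSeq hn (f := fun s => arcDist n a s.1 s.2) ?_ (fun j h0 h1 => ?_) ?_ hk
    all_goals
      interval_cases a <;> interval_cases b <;> simp only [arcDist, arcStart, arcEnd] <;>
        constructor <;> (try split_ifs) <;> (try dsimp only at *) <;> omega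
  rcases h with ⟨k, hk, ⟨rfl, rfl⟩ | ⟨rfl, rfl⟩⟩ | ⟨b, hb, hba, k, hk, ⟨rfl, rfl⟩ | ⟨rfl, rfl⟩⟩
  · exact hx k hk
  · exact (hx k hk).symm
  · exact hq b hb hba k hk
  · exact (hq b hb hba k hk).symm

theorem arcDist_ends (hn : 4 ≤ n) {a : ℕ} (h1 : 1 ≤ a) (h6 : a ≤ 6) :
    arcDist n a (arcStart a).1 (arcStart a).2 + n ≤
      arcDist n a (arcEnd n a).1 (arcEnd n a).2 := by
  interval_cases a <;> simp only [arcDist, arcStart, arcEnd] <;> (try split_ifs) <;> omega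

/-- Starting from the base path, `Config.exists_arc` adds the six arcs one at a time with the
potential `arcDist`. -/
theorem exists_config (hn : 4 ≤ n) : ∃ ψ : ℕ × ℕ → GammaVertex n (n + 3),
    Config n (Gamma n (n + 3)) (4 * n + 4) arcParity (arcLabels n 7) (ArcAdj n 7) ψ := by
  suffices key : ∀ a, a ≤ 6 → ∃ ψ : ℕ × ℕ → GammaVertex n (n + 3),
      Config n (Gamma n (n + 3)) (4 * n + 4) arcParity (arcLabels n (a + 1)) (ArcAdj n (a + 1)) ψ
    from key 6 le_rfl
  intro a
  induction a with
  | zero =>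
    intro _
    have h := config_gammaPath (n := n) (by omega) (π := arcParity) (fun t => (0, t)) Prod.snd
      (fun _ => rfl) (fun t _ => rfl)
    refine ⟨fun s => gammaPath n s.2, ?_⟩
    convert h using 1
    · ext s
      rw [mem_arcLabels]
      simp only [Finset.mem_image, Finset.mem_range]
      constructor
      · rintro (h | h)
        · exact ⟨s.2, by omega, Prod.ext h.1.symm rfl⟩
        · omega
      · rintro ⟨k, hk, rfl⟩
        exact Or.inl ⟨rfl, by simp only []; omega⟩
    · funext s t
      simp only [ArcAdj, eq_iff_iff, or_iff_left_iff_imp]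
      rintro ⟨b, hb, hb', -⟩
      omega
  | succ a ih =>
    intro ha
    obtain ⟨ψ, h⟩ := ih (by omega)
    have hs := arcStart_mem hn (show 1 ≤ a + 1 by omega) ha
    have he := arcEnd_mem hn (show 1 ≤ a + 1 by omega) ha
    obtain ⟨ψ', -, h'⟩ := h.exists_arc (by omega) (gamma_isBipartite (by omega))
      (gamma_exists_walk (by omega)) (arcSeq n (a + 1)) hs (by rwa [arcSeq_last hn])
      (fun k h0 h1 => by
        rw [arcSeq_interior h0 h1, mem_arcLabels]
        simp only []
        omega)
      (fun k l h0 h1 h2 h3 e => by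
        rw [arcSeq_interior h0 h1, arcSeq_interior h2 h3] at e
        exact (Prod.mk.inj e).2)
      (fun k hk => arcParity_arcSeq hn (by omega) ha hk)
      (fun s => arcDist n (a + 1) s.1 s.2) (fun s t hst => (arcDist_near hn (by omega) ha hst).2)
      (by rw [arcSeq_zero, arcSeq_last hn]; exact arcDist_ends hn (by omega) ha)
    refine ⟨ψ', ?_⟩
    convert h' using 1
    · ext s
      rw [Finset.mem_union, mem_arcLabels, mem_arcLabels, Finset.mem_image]
      rw [mem_arcLabels] at hs he
      constructor
      · intro h
        by_cases hsa : s.1 = a + 1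
        · right
          refine ⟨s.2, by rw [Finset.mem_range]; omega, ?_⟩
          rw [arcSeq_interior (by omega) (by omega), ← hsa]
        · left
          omega
      · rintro (h | ⟨k, hk, rfl⟩)
        · omega
        · rw [Finset.mem_range] at hk
          rcases Nat.eq_zero_or_pos k with rfl | h0
          · rw [arcSeq_zero]
            omega
          rcases (show k ≤ n - 1 by omega).eq_or_lt with rfl | h1
          · rw [arcSeq_last hn]
            omega
          · rw [arcSeq_interior h0 h1]
            simp only []
            omega
    · funext s t
      simp only [ArcAdj, eq_iff_iff]
      constructor
      · rintro (h | ⟨b, hb, hb', h⟩)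
        · exact Or.inl (Or.inl h)
        · by_cases hba : b = a + 1
          · exact Or.inr (hba ▸ h)
          · exact Or.inl (Or.inr ⟨b, hb, by omega, h⟩)
      · rintro ((h | ⟨b, hb, hb', h⟩) | h)
        · exact Or.inl h
        · exact Or.inr ⟨b, hb, by omega, h⟩
        · exact Or.inr ⟨a + 1, by omega, by omega, h⟩

end Large

/-! ### A second path of length n+3 and its three arcs inside the configuration. -/

section Large

variable {n : ℕ}

/-- The labels of a path of length `n + 3` inside the configuration of `exists_config`. -/
def pathLabel (n t : ℕ) : ℕ × ℕ :=
  if t = 0 then (2, 1) else if t = 1 then (0, 1) else if t = 2 then (0, 2) else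
  if t ≤ n then (3, t - 2) else if t = n + 1 then (4, n - 2) else
  if t = n + 2 then (4, n - 3) else (6, n - 2)

/-- The labels of the arcs of the path `pathLabel`. -/
def pathArcLabel (n i k : ℕ) : ℕ × ℕ :=
  if i = 0 then arcSeq n 5 k else
  if i = 1 then (if k = 0 then (0, 1) else if k = 1 then (0, 0) else if k = 2 then (1, 1) else
    (4, k - 2)) else
  if k = 0 then (0, 2) else if k = 1 then (0, 3) else (6, k - 1)

/-- The labels outside the path `pathLabel` and its arcs. -/
def IsOuterLabel (n : ℕ) (s : ℕ × ℕ) : Prop :=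
  (s.1 = 0 ∧ 4 ≤ s.2 ∧ s.2 ≤ n + 3) ∨ ((s.1 = 1 ∨ s.1 = 2) ∧ 2 ≤ s.2 ∧ s.2 ≤ n - 2)

theorem isOuterLabel_mk {a j : ℕ} : IsOuterLabel n (a, j) ↔
    (a = 0 ∧ 4 ≤ j ∧ j ≤ n + 3) ∨ ((a = 1 ∨ a = 2) ∧ 2 ≤ j ∧ j ≤ n - 2) := Iff.rfl

theorem arcSeq_five (n k : ℕ) :
    arcSeq n 5 k = if k = 0 then (2, 1) else if k = n - 1 then (4, n - 2) else (5, k) := rfl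

theorem pathLabel_mem (hn : 4 ≤ n) (t : ℕ) : pathLabel n t ∈ arcLabels n 7 := by
  rw [mem_arcLabels]
  unfold pathLabel
  split_ifs <;> dsimp only <;> first | contradiction | omega

theorem pathLabel_inj (hn : 4 ≤ n) {s t : ℕ} (hs : s ≤ n + 3) (ht : t ≤ n + 3)
    (h : pathLabel n s = pathLabel n t) : s = t := by
  unfold pathLabel at h
  split_ifs at h <;> rw [Prod.mk.injEq] at h <;> omega

theorem pathArcLabel_mem (hn : 4 ≤ n) {i k : ℕ} (hi : i ≤ 2) (hk : k ≤ n - 1) :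
    pathArcLabel n i k ∈ arcLabels n 7 := by
  rw [mem_arcLabels]
  unfold pathArcLabel
  rw [arcSeq_five]
  split_ifs <;> dsimp only <;> first | contradiction | omega

theorem pathArcLabel_inj {i k l : ℕ} (h : pathArcLabel n i k = pathArcLabel n i l) : k = l := by
  unfold pathArcLabel at h
  rw [arcSeq_five, arcSeq_five] at h
  split_ifs at h <;> rw [Prod.mk.injEq] at h <;> omega

theorem pathArcLabel_start (i : ℕ) (hi : i ≤ 2) : pathArcLabel n i 0 = pathLabel n i := by
  interval_cases i <;> rfl

theorem pathArcLabel_end (hn : 4 ≤ n) {i : ℕ} (hi : i ≤ 2) :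
    pathArcLabel n i (n - 1) = pathLabel n (i + n + 1) := by
  unfold pathArcLabel pathLabel
  rw [arcSeq_five]
  split_ifs <;> rw [Prod.mk.injEq] <;> first | contradiction | omega

theorem pathArcLabel_ne (hn : 4 ≤ n) {i : ℕ} (hi : i ≤ 2) {k : ℕ} (h0 : 0 < k) (h1 : k < n - 1)
    (t : ℕ) : pathArcLabel n i k ≠ pathLabel n t := by
  intro h
  unfold pathArcLabel pathLabel at h
  rw [arcSeq_five] at h
  split_ifs at h <;> rw [Prod.mk.injEq] at h <;> omega

theorem not_isOuterLabel_pathLabel (hn : 4 ≤ n) (t : ℕ) : ¬ IsOuterLabel n (pathLabel n t) := by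
  unfold pathLabel
  split_ifs <;> rw [isOuterLabel_mk] <;> omega

theorem not_isOuterLabel_pathArcLabel (hn : 4 ≤ n) (i k : ℕ) :
    ¬ IsOuterLabel n (pathArcLabel n i k) := by
  unfold pathArcLabel
  rw [arcSeq_five]
  split_ifs <;> rw [isOuterLabel_mk] <;> omega

theorem isOuterLabel_of_mem (hn : 4 ≤ n) {s : ℕ × ℕ} (hs : s ∈ arcLabels n 7) :
    IsOuterLabel n s ∨ (∃ t ≤ n + 3, pathLabel n t = s) ∨
      ∃ i ≤ 2, ∃ k ≤ n - 1, pathArcLabel n i k = s := by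
  rw [mem_arcLabels] at hs
  obtain ⟨a, j⟩ := s
  unfold IsOuterLabel
  simp only [] at hs ⊢
  by_cases hD : (a = 0 ∧ 4 ≤ j ∧ j ≤ n + 3) ∨ ((a = 1 ∨ a = 2) ∧ 2 ≤ j ∧ j ≤ n - 2)
  · exact Or.inl hD
  right
  have h : (a = 0 ∧ j ≤ 3) ∨ (a = 1 ∧ j = 1) ∨ (a = 2 ∧ j = 1) ∨ (3 ≤ a ∧ a ≤ 6 ∧ 1 ≤ j ∧ j ≤ n - 2) := by
    omega
  rcases h with ⟨rfl, h⟩ | ⟨rfl, rfl⟩ | ⟨rfl, rfl⟩ | ⟨h3, h6, hj⟩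
  · interval_cases j
    · exact Or.inr ⟨1, by omega, 1, by omega, rfl⟩
    · exact Or.inl ⟨1, by omega, rfl⟩
    · exact Or.inl ⟨2, by omega, rfl⟩
    · exact Or.inr ⟨2, by omega, 1, by omega, rfl⟩
  · exact Or.inr ⟨1, by omega, 2, by omega, rfl⟩
  · exact Or.inl ⟨0, by omega, rfl⟩
  · interval_cases a
    · refine Or.inl ⟨j + 2, by omega, ?_⟩
      simp [pathLabel, show j ≠ 0 by omega, show j + 2 ≤ n by omega]
    · by_cases h1 : j = n - 2
      · refine Or.inl ⟨n + 1, by omega, ?_⟩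
        simp [pathLabel, h1, show n ≠ 0 by omega, show n ≠ 1 by omega]
      by_cases h2 : j = n - 3
      · refine Or.inl ⟨n + 2, by omega, ?_⟩
        simp [pathLabel, h2, show n ≠ 0 by omega]
      · refine Or.inr ⟨1, by omega, j + 2, by omega, ?_⟩
        simp [pathArcLabel, show j ≠ 0 by omega]
    · exact Or.inr ⟨0, by omega, j, by omega, arcSeq_interior (by omega) (by omega)⟩
    · refine Or.inr ⟨2, by omega, j + 1, by omega, ?_⟩
      simp [pathArcLabel, show j ≠ 0 by omega]

theorem arcAdj_path {a j : ℕ} (hj : j < n + 3) : ArcAdj n a (0, j) (0, j + 1) :=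
  Or.inl ⟨j, hj, Or.inl ⟨rfl, rfl⟩⟩

theorem arcAdj_arc (hn : 4 ≤ n) {a b j : ℕ} (hb : 1 ≤ b) (hba : b < a) (hj : 1 ≤ j)
    (hj' : j + 1 ≤ n - 2) : ArcAdj n a (b, j) (b, j + 1) :=
  Or.inr ⟨b, hb, hba, j, by omega, Or.inl ⟨(arcSeq_interior (by omega) (by omega)).symm,
    (arcSeq_interior (by omega) (by omega)).symm⟩⟩

theorem arcAdj_start (hn : 4 ≤ n) {a b : ℕ} (hb : 1 ≤ b) (hba : b < a) :
    ArcAdj n a (arcStart b) (b, 1) :=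
  Or.inr ⟨b, hb, hba, 0, by omega, Or.inl ⟨rfl, (arcSeq_interior (by omega) (by omega)).symm⟩⟩

theorem arcAdj_end (hn : 4 ≤ n) {a b : ℕ} (hb : 1 ≤ b) (hba : b < a) :
    ArcAdj n a (b, n - 2) (arcEnd n b) :=
  Or.inr ⟨b, hb, hba, n - 2, by omega, Or.inl ⟨(arcSeq_interior (by omega) (by omega)).symm, by
    rw [show n - 2 + 1 = n - 1 by omega, arcSeq_last hn]⟩⟩

theorem ArcAdj.symm {a : ℕ} {s t : ℕ × ℕ} (h : ArcAdj n a s t) : ArcAdj n a t s := by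
  rcases h with ⟨k, hk, h⟩ | ⟨b, hb, hba, k, hk, h⟩
  · exact Or.inl ⟨k, hk, h.symm⟩
  · exact Or.inr ⟨b, hb, hba, k, hk, h.symm⟩

theorem pathLabel_adj (hn : 4 ≤ n) {t : ℕ} (ht : t < n + 3) :
    ArcAdj n 7 (pathLabel n t) (pathLabel n (t + 1)) := by
  have h : t = 0 ∨ t = 1 ∨ t = 2 ∨ (3 ≤ t ∧ t < n) ∨ t = n ∨ t = n + 1 ∨ t = n + 2 := by omega
  rcases h with rfl | rfl | rfl | h | rfl | rfl | rfl
  · exact (arcAdj_start hn (b := 2) (by omega) (by omega)).symm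
  · exact arcAdj_path (by omega)
  · have : pathLabel n (2 + 1) = (3, 1) := by simp [pathLabel, show 3 ≤ n by omega]
    rw [this]
    exact arcAdj_start hn (b := 3) (by omega) (by omega)
  · have e1 : pathLabel n t = (3, t - 2) := by
      simp [pathLabel, show t ≠ 0 by omega, show t ≠ 1 by omega, show t ≠ 2 by omega, h.2.le]
    have e2 : pathLabel n (t + 1) = (3, t - 2 + 1) := by
      simp [pathLabel, show t ≠ 0 by omega, show t ≠ 1 by omega, show t + 1 ≤ n by omega]
      omega
    rw [e1, e2]
    exact arcAdj_arc hn (by omega) (by omega) (by omega) (by omega)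
  · have e1 : pathLabel t t = (3, t - 2) := by
      simp [pathLabel, show t ≠ 0 by omega, show t ≠ 1 by omega, show t ≠ 2 by omega]
    have e2 : pathLabel t (t + 1) = (4, t - 2) := by
      simp [pathLabel, show t ≠ 0 by omega, show t ≠ 1 by omega]
    rw [e1, e2]
    exact (arcAdj_end hn (b := 4) (by omega) (by omega)).symm
  · have e1 : pathLabel n (n + 1) = (4, n - 3 + 1) := by
      simp [pathLabel, show n ≠ 0 by omega, show n ≠ 1 by omega]
      omega
    have e2 : pathLabel n (n + 1 + 1) = (4, n - 3) := by
      simp [pathLabel, show n ≠ 0 by omega]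
    rw [e1, e2]
    exact (arcAdj_arc hn (by omega) (by omega) (by omega) (by omega)).symm
  · have e1 : pathLabel n (n + 2) = (4, n - 3) := by
      simp [pathLabel, show n ≠ 0 by omega]
    have e2 : pathLabel n (n + 2 + 1) = (6, n - 2) := by
      simp [pathLabel]
    rw [e1, e2]
    exact (arcAdj_end hn (b := 6) (by omega) (by omega)).symm

theorem pathArcLabel_adj (hn : 4 ≤ n) {i : ℕ} (hi : i ≤ 2) {k : ℕ} (hk : k < n - 1) :
    ArcAdj n 7 (pathArcLabel n i k) (pathArcLabel n i (k + 1)) := by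
  interval_cases i
  · exact Or.inr ⟨5, by omega, by omega, k, hk, Or.inl ⟨rfl, rfl⟩⟩
  · have h : k = 0 ∨ k = 1 ∨ k = 2 ∨ 3 ≤ k := by omega
    rcases h with rfl | rfl | rfl | h
    · exact (arcAdj_path (by omega)).symm
    · exact arcAdj_start hn (b := 1) (by omega) (by omega)
    · exact arcAdj_start hn (b := 4) (by omega) (by omega)
    · have e1 : pathArcLabel n 1 k = (4, k - 2) := by
        simp [pathArcLabel, show k ≠ 0 by omega, show k ≠ 1 by omega, show k ≠ 2 by omega]
      have e2 : pathArcLabel n 1 (k + 1) = (4, k - 2 + 1) := by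
        simp [pathArcLabel, show k ≠ 0 by omega, show k ≠ 1 by omega]
        omega
      rw [e1, e2]
      exact arcAdj_arc hn (by omega) (by omega) (by omega) (by omega)
  · have h : k = 0 ∨ k = 1 ∨ 2 ≤ k := by omega
    rcases h with rfl | rfl | h
    · exact arcAdj_path (by omega)
    · exact arcAdj_start hn (b := 6) (by omega) (by omega)
    · have e1 : pathArcLabel n 2 k = (6, k - 1) := by
        simp [pathArcLabel, show k ≠ 0 by omega, show k ≠ 1 by omega]
      have e2 : pathArcLabel n 2 (k + 1) = (6, k - 1 + 1) := by
        simp [pathArcLabel, show k ≠ 0 by omega]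
        omega
      rw [e1, e2]
      exact arcAdj_arc hn (by omega) (by omega) (by omega) (by omega)

theorem exists_two_arcAdj (hn : 4 ≤ n) {s : ℕ × ℕ} (hs : IsOuterLabel n s) :
    ∃ a b, a ≠ b ∧ ArcAdj n 7 s a ∧ ArcAdj n 7 s b := by
  obtain ⟨i, j⟩ := s
  unfold IsOuterLabel at hs
  simp only [] at hs
  have h : (i = 0 ∧ 4 ≤ j ∧ j < n + 3) ∨ (i = 0 ∧ j = n + 3) ∨
    ((i = 1 ∨ i = 2) ∧ 2 ≤ j ∧ j ≤ n - 2) := by omega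
  rcases h with ⟨rfl, h4, h⟩ | ⟨rfl, rfl⟩ | ⟨hi, h2, h⟩
  · obtain ⟨l, rfl⟩ : ∃ l, j = l + 1 := ⟨j - 1, by omega⟩
    exact ⟨_, _, by rw [Ne, Prod.mk.injEq]; omega, (arcAdj_path (by omega)).symm, arcAdj_path h⟩
  · exact ⟨(0, n + 2), (3, n - 2), by simp, (arcAdj_path (by omega)).symm,
      (arcAdj_end hn (b := 3) (by omega) (by omega)).symm⟩
  · obtain ⟨l, rfl⟩ : ∃ l, j = l + 1 := ⟨j - 1, by omega⟩
    have h1 := (arcAdj_arc (a := 7) hn (show 1 ≤ i by omega) (by omega) (show 1 ≤ l by omega) h).symm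
    rcases h.eq_or_lt with h3 | h3
    · refine ⟨(i, l), arcEnd n i, ?_, h1, ?_⟩
      · rcases hi with rfl | rfl <;> simp [arcEnd]
      · have := arcAdj_end (a := 7) hn (b := i) (by omega) (by omega)
        rwa [← h3] at this
    · exact ⟨_, _, by rw [Ne, Prod.mk.injEq]; omega, h1, arcAdj_arc hn (by omega) (by omega) (by omega) h3⟩

theorem exists_three_arcAdj (hn : 4 ≤ n) {j : ℕ} (hj : j = n + 1 ∨ j = n + 2) :
    ∃ a b c, a ≠ b ∧ a ≠ c ∧ b ≠ c ∧ ArcAdj n 7 (0, j) a ∧ ArcAdj n 7 (0, j) b ∧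
      ArcAdj n 7 (0, j) c := by
  obtain ⟨l, rfl⟩ : ∃ l, j = l + 1 := ⟨j - 1, by omega⟩
  refine ⟨(0, l), (0, l + 1 + 1), (l + 1 - n, n - 2), by rw [Ne, Prod.mk.injEq]; omega, ?_, ?_,
    (arcAdj_path (by omega)).symm, arcAdj_path (by omega), ?_⟩
  · rw [Ne, Prod.mk.injEq]; omega
  · rw [Ne, Prod.mk.injEq]; omega
  · have := (arcAdj_end (a := 7) hn (b := l + 1 - n) (by omega) (by omega)).symm
    have e : arcEnd n (l + 1 - n) = (0, l + 1) := by
      rcases hj with h | h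
      · rw [h, show n + 1 - n = 1 by omega]; rfl
      · rw [h, show n + 2 - n = 2 by omega]; rfl
    rwa [e] at this

/-- Within the outer labels, arcs 1 and 2 are attached to the path only at xₙ₊₁ and xₙ₊₂. Without
these two vertices the outer part falls into x₄, …, xₙ, the single vertex xₙ₊₃ and the remaining
segments of the two arcs. -/
theorem ArcAdj.outer (hn : 4 ≤ n) {s t : ℕ × ℕ} (h : ArcAdj n 7 s t) (hs : IsOuterLabel n s)
    (ht : IsOuterLabel n t) (hs' : s ≠ (0, n + 1) ∧ s ≠ (0, n + 2))
    (ht' : t ≠ (0, n + 1) ∧ t ≠ (0, n + 2)) :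
    s.1 = t.1 ∧ (s.1 = 0 → (s.2 ≤ n ∧ t.2 ≤ n)) := by
  suffices key : ∀ s t, IsOuterLabel n s → IsOuterLabel n t → (s ≠ (0, n + 1) ∧ s ≠ (0, n + 2)) →
      (t ≠ (0, n + 1) ∧ t ≠ (0, n + 2)) → ((∃ k < n + 3, s = (0, k) ∧ t = (0, k + 1)) ∨
        ∃ b, 1 ≤ b ∧ b < 7 ∧ ∃ k < n - 1, s = arcSeq n b k ∧ t = arcSeq n b (k + 1)) →
      s.1 = t.1 ∧ (s.1 = 0 → (s.2 ≤ n ∧ t.2 ≤ n)) by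
    rcases h with ⟨k, hk, h | h⟩ | ⟨b, hb, hba, k, hk, h | h⟩
    · exact key s t hs ht hs' ht' (Or.inl ⟨k, hk, h⟩)
    · have := key t s ht hs ht' hs' (Or.inl ⟨k, hk, h⟩)
      exact ⟨this.1.symm, fun e => (this.2 (this.1.trans e)).symm⟩
    · exact key s t hs ht hs' ht' (Or.inr ⟨b, hb, hba, k, hk, h⟩)
    · have := key t s ht hs ht' hs' (Or.inr ⟨b, hb, hba, k, hk, h⟩)
      exact ⟨this.1.symm, fun e => (this.2 (this.1.trans e)).symm⟩
  clear h hs ht hs' ht' s t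
  intro s t hs ht hs' ht' h
  rcases h with ⟨k, hk, rfl, rfl⟩ | ⟨b, hb, hba, k, hk, rfl, rfl⟩
  · simp only [Ne, Prod.mk.injEq, true_and] at hs' ht'
    rw [isOuterLabel_mk] at hs ht
    dsimp only
    omega
  · rcases Nat.eq_zero_or_pos k with rfl | h0
    · exfalso
      rw [arcSeq_zero] at hs
      unfold IsOuterLabel at hs
      interval_cases b <;> simp [arcStart] at hs
    rw [arcSeq_interior h0 hk] at hs hs' ⊢
    rcases (show k + 1 ≤ n - 1 from hk).eq_or_lt with h1 | h1
    · exfalso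
      rw [h1, arcSeq_last hn] at ht ht'
      unfold IsOuterLabel at hs ht
      interval_cases b <;> simp [arcEnd] at hs ht ht'
    · rw [arcSeq_interior (by omega) h1]
      exact ⟨rfl, fun e => by simp only [] at e; omega⟩

/-- All vertices outside `Z` have valency at least two, so none is a loose end. A clean arc with
interior outside `Z` would avoid xₙ₊₁ and xₙ₊₂, which have valency at least three; but what then
remains consists of segments of at most n-3 vertices, too short for n-2 interior vertices. -/
theorem exists_proper_embedding_of_four_le (hn : 4 ≤ n) :
    ∃ φ : Gamma n (n + 3) ↪g Gamma n (n + 3), ¬ Function.Surjective φ := by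
  classical
  obtain ⟨ψ, h⟩ := exists_config hn
  have hadj : ∀ s t, ArcAdj n 7 s t → (Gamma n (n + 3)).Adj (ψ s) (ψ t) := fun s t hst =>
    (h.adj s (h.mem s t hst).1 t (h.mem s t hst).2).2 hst
  have hinj : ∀ s ∈ arcLabels n 7, ∀ t ∈ arcLabels n 7, ψ s = ψ t → s = t := fun s hs t ht e =>
    h.inj hs ht e
  let Z : Finset (GammaVertex n (n + 3)) :=
    initialImage (n + 3) (fun t => ψ (pathLabel n t)) ∪
      (Finset.range 3).biUnion fun i => initialImage (n - 1) (fun k => ψ (pathArcLabel n i k))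
  let C : Finset (GammaVertex n (n + 3)) := (arcLabels n 7).image ψ
  have hZ : ∀ x, x ∈ Z ↔ (∃ t ≤ n + 3, ψ (pathLabel n t) = x) ∨
      ∃ i ≤ 2, ∃ k ≤ n - 1, ψ (pathArcLabel n i k) = x := by
    intro x
    rw [Finset.mem_union, mem_initialImage, Finset.mem_biUnion]
    refine or_congr Iff.rfl (exists_congr fun i => ?_)
    rw [mem_initialImage, Finset.mem_range, Nat.lt_succ_iff]
  have hC : ∀ {s}, s ∈ arcLabels n 7 → ψ s ∈ C := fun hs => Finset.mem_image_of_mem ψ hs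
  have hout : ∀ x ∈ C, x ∉ Z → ∃ s ∈ arcLabels n 7, IsOuterLabel n s ∧ ψ s = x := by
    intro x hx hxZ
    obtain ⟨s, hs, rfl⟩ := Finset.mem_image.1 hx
    rcases isOuterLabel_of_mem hn hs with hs' | ⟨t, ht, rfl⟩ | ⟨i, hi, k, hk, rfl⟩
    · exact ⟨s, hs, hs', rfl⟩
    · exact absurd ((hZ _).2 (Or.inl ⟨t, ht, rfl⟩)) hxZ
    · exact absurd ((hZ _).2 (Or.inr ⟨i, hi, k, hk, rfl⟩)) hxZ
  refine exists_proper_embedding_of (by omega) (y := fun t => ψ (pathLabel n t))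
    ⟨fun t ht => hadj _ _ (pathLabel_adj hn ht), fun a ha b hb e =>
      pathLabel_inj hn ha hb (hinj _ (pathLabel_mem hn a) _ (pathLabel_mem hn b) e)⟩
    (r := fun i k => ψ (pathArcLabel n i k))
    (fun i hi => ⟨fun k hk => hadj _ _ (pathArcLabel_adj hn hi hk), fun a ha b hb e =>
      pathArcLabel_inj (hinj _ (pathArcLabel_mem hn hi ha) _ (pathArcLabel_mem hn hi hb) e)⟩)
    (fun i hi => by rw [pathArcLabel_start i hi])
    (fun i hi => by rw [pathArcLabel_end hn hi])
    (fun i hi k h0 h1 t ht e => pathArcLabel_ne hn hi h0 h1 t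
      (hinj _ (pathArcLabel_mem hn hi h1.le) _ (pathLabel_mem hn t) e))
    (Z := Z) (C := C) hZ ?_ ?_
  · intro hsub
    have hm : ((0, 4) : ℕ × ℕ) ∈ arcLabels n 7 := by
      rw [mem_arcLabels]
      left
      exact ⟨rfl, by simp only []; omega⟩
    have ho : IsOuterLabel n (0, 4) := Or.inl ⟨rfl, le_rfl, by simp only []; omega⟩
    rcases (hZ _).1 (hsub (hC hm)) with ⟨t, ht, e⟩ | ⟨i, hi, k, hk, e⟩
    · exact not_isOuterLabel_pathLabel hn t (by rwa [hinj _ (pathLabel_mem hn t) _ hm e])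
    · exact not_isOuterLabel_pathArcLabel hn i k
        (by rwa [hinj _ (pathArcLabel_mem hn hi hk) _ hm e])
  · have hnbr : ∀ {s a}, ArcAdj n 7 s a → ψ a ∈ C ∧ (Gamma n (n + 3)).Adj (ψ s) (ψ a) :=
      fun {s a} hsa => ⟨hC (h.mem s a hsa).2, hadj s a hsa⟩
    have hne : ∀ {s a b}, ArcAdj n 7 s a → ArcAdj n 7 s b → a ≠ b → ψ a ≠ ψ b :=
      fun {s a b} ha hb hab e => hab (hinj _ (h.mem s a ha).2 _ (h.mem s b hb).2 e)
    rintro (⟨z, hz, hzZ, hd⟩ | ⟨p, hp, hpC, hpi⟩)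
    · obtain ⟨s, hs, hso, rfl⟩ := hout z hz hzZ
      obtain ⟨a, b, hab, ha, hb⟩ := exists_two_arcAdj hn hso
      have := two_le_dg (hnbr ha).1 (hnbr hb).1 (hne ha hb hab) (hnbr ha).2 (hnbr hb).2
      omega
    · have hex : ∀ i, 0 < i → i < n - 1 → ∃ s ∈ arcLabels n 7, IsOuterLabel n s ∧ ψ s = p i ∧
          s ≠ (0, n + 1) ∧ s ≠ (0, n + 2) := by
        intro i h0 h1
        obtain ⟨s, hs, hso, e⟩ := hout _ (hpC i h1.le) (hpi i h0 h1).1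
        refine ⟨s, hs, hso, e, ?_⟩
        have h3 : ∀ j, j = n + 1 ∨ j = n + 2 → s ≠ (0, j) := by
          rintro j hj rfl
          obtain ⟨a, b, c, hab, hac, hbc, ha, hb, hc⟩ := exists_three_arcAdj hn hj
          have := three_le_dg (hnbr ha).1 (hnbr hb).1 (hnbr hc).1 (hne ha hb hab) (hne ha hc hac)
            (hne hb hc hbc) (hnbr ha).2 (hnbr hb).2 (hnbr hc).2
          have := (hpi i h0 h1).2
          rw [e] at *
          omega
        exact ⟨h3 _ (Or.inl rfl), h3 _ (Or.inr rfl)⟩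
      choose! s hs hso hsp hsb using hex
      have hstep : ∀ i, 0 < i → i + 1 < n - 1 → (s i).1 = (s (i + 1)).1 ∧
          ((s i).1 = 0 → (s i).2 ≤ n ∧ (s (i + 1)).2 ≤ n) := by
        intro i h0 h1
        have hi : i < n - 1 := by omega
        have h2 := hp.adj i hi
        rw [← hsp i h0 hi, ← hsp (i + 1) (by omega) h1,
          h.adj _ (hs i h0 hi) _ (hs (i + 1) (by omega) h1)] at h2
        exact h2.outer hn (hso i h0 hi) (hso (i + 1) (by omega) h1) (hsb i h0 hi)
          (hsb (i + 1) (by omega) h1)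
      -- Here n ≥ 4 matters: there are at least two interior vertices, so the isolated xₙ₊₃ is not
      -- among them.
      have hfst : ∀ i, 0 < i → i < n - 1 → (s i).1 = (s 1).1 ∧ ((s 1).1 = 0 → (s i).2 ≤ n) := by
        intro i h0
        induction i, h0 using Nat.le_induction with
        | base => exact fun h1 => ⟨rfl, fun e => ((hstep 1 (by omega) (by omega)).2 e).1⟩
        | succ i h0 ih =>
          intro h1
          have h2 := ih (by omega)
          have h3 := hstep i h0 h1
          exact ⟨h3.1.symm.trans h2.1, fun e => (h3.2 (h2.1.trans e)).2⟩
      -- The n-2 interior vertices inject into an interval of n-3 indices.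
      have hcard := Finset.card_le_card_of_injOn (s := Finset.Ioo 0 (n - 1))
        (t := if (s 1).1 = 0 then Finset.Icc 4 n else Finset.Icc 2 (n - 2)) (fun i => (s i).2)
        (fun i hi => by
          rw [Finset.mem_coe, Finset.mem_Ioo] at hi
          have h1 := hfst i hi.1 hi.2
          have h2 := hso i hi.1 hi.2
          unfold IsOuterLabel at h2
          rw [Finset.mem_coe]
          split_ifs with h0
          · have := h1.2 h0
            exact Finset.mem_Icc.2 (show 4 ≤ (s i).2 ∧ (s i).2 ≤ n by omega)
          · exact Finset.mem_Icc.2 (show 2 ≤ (s i).2 ∧ (s i).2 ≤ n - 2 by omega))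
        (fun i hi j hj e => by
          rw [Finset.mem_coe, Finset.mem_Ioo] at hi hj
          have e' : s i = s j := Prod.ext ((hfst i hi.1 hi.2).1.trans (hfst j hj.1 hj.2).1.symm) e
          rw [← hp.eq_iff hi.2.le hj.2.le, ← hsp i hi.1 hi.2, ← hsp j hj.1 hj.2, e'])
      split_ifs at hcard
      · rw [Nat.card_Ioo, Nat.card_Icc] at hcard
        omega
      · rw [Nat.card_Ioo, Nat.card_Icc] at hcard
        omega

end Large

/-! ### A proper self-embedding for `n = 3` -/

section Three

/-- The end vertices of eleven vertices `7, …, 17` to be added successively to the path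
`(0, …, 6)`, each joined to two vertices at distance `4`. -/
def planeEnds (k : ℕ) : ℕ × ℕ :=
  [(0, 4), (1, 5), (2, 6), (6, 0), (9, 7), (10, 3), (11, 8), (12, 8), (13, 3), (15, 6),
    (14, 9)].getD (k - 7) (0, 0)

/-- The arc `(a, k, b)` added with the vertex `k`. -/
def planeSeq (k j : ℕ) : ℕ :=
  if j = 0 then (planeEnds k).1 else if j = 2 then (planeEnds k).2 else k

/-- Adjacency of the vertices preceding `k`. -/
def PlaneAdj (k s t : ℕ) : Prop :=
  SeqAdj 6 id s t ∨ ∃ b < k, 7 ≤ b ∧ SeqAdj 2 (planeSeq b) s t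

instance (m : ℕ) (q : ℕ → ℕ) : DecidableRel (SeqAdj m q) := fun s t =>
  inferInstanceAs (Decidable (∃ k < m, (s = q k ∧ t = q (k + 1)) ∨ (t = q k ∧ s = q (k + 1))))

instance (k : ℕ) : DecidableRel (PlaneAdj k) := fun s t =>
  inferInstanceAs (Decidable (SeqAdj 6 id s t ∨ ∃ b < k, 7 ≤ b ∧ SeqAdj 2 (planeSeq b) s t))

/-- The side of a vertex in the bipartition. -/
def planeParity (s : ℕ) : ℕ :=
  [0, 1, 0, 1, 0, 1, 0, 1, 0, 1, 1, 0, 0, 1, 1, 0, 1, 0].getD s 0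

/-- The minimum of `3` and the distance from the first end vertex of `k`, before `k` is added. -/
def planeDist (k s : ℕ) : ℕ :=
  ([ [0, 1, 2, 3, 3, 3, 3],
    [1, 0, 1, 2, 3, 3, 3, 2],
    [2, 1, 0, 1, 2, 3, 3, 3, 2],
    [3, 3, 2, 3, 2, 1, 0, 3, 2, 1],
    [3, 2, 1, 2, 3, 2, 1, 3, 3, 0, 2],
    [1, 2, 3, 3, 3, 2, 1, 2, 3, 2, 0, 3],
    [2, 3, 2, 3, 2, 3, 2, 1, 3, 1, 3, 0, 3],
    [2, 3, 2, 1, 2, 3, 2, 3, 3, 3, 1, 3, 0, 3],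
    [3, 2, 3, 3, 3, 2, 3, 2, 1, 2, 3, 1, 3, 0, 2],
    [3, 3, 2, 1, 2, 3, 3, 3, 2, 3, 3, 2, 2, 1, 3, 0],
    [3, 2, 3, 2, 3, 2, 3, 3, 1, 3, 2, 3, 1, 2, 0, 3, 3] ].getD (k - 7) []).getD s 3

theorem planeEnds_lt : ∀ k < 18, 7 ≤ k → (planeEnds k).1 < k ∧ (planeEnds k).2 < k := by decide

theorem planeParity_planeSeq : ∀ k < 18, 7 ≤ k → ∀ j < 3,
    planeParity (planeSeq k j) % 2 = (planeParity (planeSeq k 0) + j) % 2 := by decide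

theorem planeDist_ends : ∀ k < 18, 7 ≤ k →
    planeDist k (planeEnds k).1 + 3 ≤ planeDist k (planeEnds k).2 := by decide

set_option synthInstance.maxSize 1024 in
set_option synthInstance.maxHeartbeats 200000 in
theorem planeDist_near {k s t : ℕ} (hk : k < 18) (hk7 : 7 ≤ k) (h : PlaneAdj k s t) :
    planeDist k t ≤ planeDist k s + 1 := by
  have h1 : ∀ k < 18, 7 ≤ k → ∀ j < 6, Near (planeDist k j) (planeDist k (j + 1)) := by decide
  have h2 : ∀ k < 18, 7 ≤ k → ∀ b < 18, 7 ≤ b → b < k → ∀ j < 2,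
      Near (planeDist k (planeSeq b j)) (planeDist k (planeSeq b (j + 1))) := by decide
  rcases h with ⟨j, hj, ⟨h, h'⟩ | ⟨h, h'⟩⟩ | ⟨b, hb, hb7, j, hj, ⟨rfl, rfl⟩ | ⟨rfl, rfl⟩⟩
  · rw [h, h']
    exact (h1 k hk hk7 j hj).2
  · rw [h, h']
    exact (h1 k hk hk7 j hj).1
  · exact (h2 k hk hk7 b (hb.trans hk) hb7 hb j hj).2
  · exact (h2 k hk hk7 b (hb.trans hk) hb7 hb j hj).1

/-- Each of the eleven vertices is the interior of an arc of length 2 given by `Config.exists_arc`.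
Distances truncated at 3 serve as potential, since only a gap of n = 3 is needed. -/
theorem exists_plane_config : ∃ ψ : ℕ → GammaVertex 3 (3 + 3),
    Config 3 (Gamma 3 (3 + 3)) (4 * 3 + 4) planeParity (Finset.range 18) (PlaneAdj 18) ψ := by
  suffices key : ∀ a ≤ 11, ∃ ψ : ℕ → GammaVertex 3 (3 + 3), Config 3 (Gamma 3 (3 + 3)) (4 * 3 + 4)
      planeParity (Finset.range (a + 7)) (PlaneAdj (a + 7)) ψ from key 11 le_rfl
  intro a
  induction a with
  | zero =>
    intro _
    have h := config_gammaPath (n := 3) le_rfl (π := planeParity) id id (fun _ => rfl) (by decide)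
    refine ⟨fun s => gammaPath 3 s, ?_⟩
    convert h using 1
    · norm_num
    · rw [Finset.image_id]
    · funext s t
      simp only [PlaneAdj, eq_iff_iff]
      refine or_iff_left ?_
      rintro ⟨b, hb, hb', -⟩
      omega
    · rfl
  | succ a ih =>
    intro ha
    obtain ⟨ψ, h⟩ := ih (by omega)
    have hk : a + 7 < 18 := by omega
    have hk7 : 7 ≤ a + 7 := by omega
    rw [show a + 1 + 7 = a + 7 + 1 by omega]
    clear ih ha
    generalize a + 7 = k at *
    obtain ⟨he0, he1⟩ := planeEnds_lt k hk hk7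
    have hq : ∀ j, 0 < j → j < 3 - 1 → planeSeq k j = k := by
      intro j h0 h1
      obtain rfl : j = 1 := by omega
      rfl
    obtain ⟨ψ', -, h'⟩ := h.exists_arc le_rfl (gamma_isBipartite le_rfl)
      (gamma_exists_walk le_rfl) (planeSeq k) (Finset.mem_range.2 he0) (Finset.mem_range.2 he1)
      (fun j h0 h1 => by rw [hq j h0 h1, Finset.mem_range]; omega)
      (fun j l h0 h1 h2 h3 _ => by omega)
      (fun j hj => planeParity_planeSeq k hk hk7 j (by omega))
      (planeDist k) (fun s t hst => planeDist_near hk hk7 hst) (planeDist_ends k hk hk7)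
    refine ⟨ψ', ?_⟩
    convert h' using 1
    · ext s
      rw [Finset.mem_union, Finset.mem_range, Finset.mem_range, Finset.mem_image]
      constructor
      · intro hs
        rcases Nat.lt_succ_iff_lt_or_eq.1 hs with hs | rfl
        · exact Or.inl hs
        · exact Or.inr ⟨1, by decide, rfl⟩
      · rintro (hs | ⟨j, hj, rfl⟩)
        · omega
        · rw [Finset.mem_range] at hj
          interval_cases j
          · exact Nat.lt_succ_of_lt he0
          · exact Nat.lt_succ_self k
          · exact Nat.lt_succ_of_lt he1
    · funext s t
      simp only [PlaneAdj, eq_iff_iff]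
      constructor
      · rintro (h | ⟨b, hb, hb', h⟩)
        · exact Or.inl (Or.inl h)
        · rcases Nat.lt_succ_iff_lt_or_eq.1 hb with hb | hbk
          · exact Or.inl (Or.inr ⟨b, hb, hb', h⟩)
          · exact Or.inr (hbk ▸ h)
      · rintro ((h | ⟨b, hb, hb', h⟩) | h)
        · exact Or.inl h
        · exact Or.inr ⟨b, by omega, hb', h⟩
        · exact Or.inr ⟨k, by omega, hk7, h⟩

/-- A path of length `6` inside the configuration of `exists_plane_config`. -/
def planePath (t : ℕ) : ℕ := [15, 3, 12, 10, 6, 9, 17].getD t 0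

/-- The arcs of the path `planePath`. -/
def planeArc (i k : ℕ) : ℕ := ([ [15, 16, 6], [3, 2, 9], [12, 14, 17] ].getD i []).getD k 0

/-- Three neighbours of each vertex outside of the path `planePath` and its arcs. -/
def planeNbrs : ℕ → ℕ × ℕ × ℕ
  | 0 => (1, 7, 10)
  | 1 => (0, 2, 8)
  | 4 => (3, 5, 7)
  | 5 => (4, 6, 8)
  | 7 => (0, 4, 11)
  | 8 => (1, 5, 13)
  | 11 => (9, 7, 13)
  | _ => (11, 8, 15)

-- For n = 3 a clean arc has a single interior vertex, so valency two outside `Z` is not allowed.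
-- The configuration is larger, and every vertex outside `Z` has three neighbours in it.
set_option synthInstance.maxSize 1024 in
set_option synthInstance.maxHeartbeats 200000 in
theorem exists_proper_embedding_three :
    ∃ φ : Gamma 3 (3 + 3) ↪g Gamma 3 (3 + 3), ¬ Function.Surjective φ := by
  obtain ⟨ψ, h⟩ := exists_plane_config
  have hadj : ∀ s t, PlaneAdj 18 s t → (Gamma 3 (3 + 3)).Adj (ψ s) (ψ t) := fun s t hst =>
    (h.adj s (h.mem s t hst).1 t (h.mem s t hst).2).2 hst
  have hinj : ∀ s < 18, ∀ t < 18, ψ s = ψ t → s = t := fun s hs t ht e =>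
    h.inj (by simpa using hs) (by simpa using ht) e
  have hpath : ∀ t ≤ 6, planePath t < 18 := by decide
  have harc : ∀ i ≤ 2, ∀ k ≤ 2, planeArc i k < 18 := by decide
  have hpathInj : ∀ a ≤ 6, ∀ b ≤ 6, planePath a = planePath b → a = b := by decide
  have harcInj : ∀ i ≤ 2, ∀ a ≤ 2, ∀ b ≤ 2, planeArc i a = planeArc i b → a = b := by decide
  have hpathAdj : ∀ t < 6, PlaneAdj 18 (planePath t) (planePath (t + 1)) := by decide
  have harcAdj : ∀ i ≤ 2, ∀ k < 2, PlaneAdj 18 (planeArc i k) (planeArc i (k + 1)) := by decide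
  have hne : ∀ i ≤ 2, ∀ t ≤ 6, planeArc i 1 ≠ planePath t := by decide
  have hout : ∀ s < 18, (∀ t ≤ 6, planePath t ≠ s) → (∀ i ≤ 2, ∀ k ≤ 2, planeArc i k ≠ s) →
      PlaneAdj 18 s (planeNbrs s).1 ∧ PlaneAdj 18 s (planeNbrs s).2.1 ∧
      PlaneAdj 18 s (planeNbrs s).2.2 ∧ (planeNbrs s).1 ≠ (planeNbrs s).2.1 ∧
      (planeNbrs s).1 ≠ (planeNbrs s).2.2 ∧ (planeNbrs s).2.1 ≠ (planeNbrs s).2.2 := by decide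
  classical
  let Z : Finset (GammaVertex 3 (3 + 3)) :=
    initialImage (3 + 3) (fun t => ψ (planePath t)) ∪
      (Finset.range 3).biUnion fun i => initialImage (3 - 1) (fun k => ψ (planeArc i k))
  let C : Finset (GammaVertex 3 (3 + 3)) := (Finset.range 18).image ψ
  have hZ : ∀ x, x ∈ Z ↔ (∃ t ≤ 3 + 3, ψ (planePath t) = x) ∨
      ∃ i ≤ 2, ∃ k ≤ 3 - 1, ψ (planeArc i k) = x := by
    intro x
    rw [Finset.mem_union, mem_initialImage, Finset.mem_biUnion]
    refine or_congr Iff.rfl (exists_congr fun i => ?_)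
    rw [mem_initialImage, Finset.mem_range, Nat.lt_succ_iff]
  have hC : ∀ {s}, s < 18 → ψ s ∈ C := fun hs => Finset.mem_image_of_mem ψ (Finset.mem_range.2 hs)
  have hdeg : ∀ x ∈ C, x ∉ Z → 3 ≤ dg (Gamma 3 (3 + 3)) C x := by
    intro x hx hxZ
    obtain ⟨s, hs, rfl⟩ := Finset.mem_image.1 hx
    obtain ⟨h1, h2, h3, h12, h13, h23⟩ := hout s (Finset.mem_range.1 hs)
      (fun t ht e => hxZ ((hZ _).2 (Or.inl ⟨t, ht, by rw [e]⟩)))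
      (fun i hi k hk e => hxZ ((hZ _).2 (Or.inr ⟨i, hi, k, hk, by rw [e]⟩)))
    have hm : ∀ {t}, PlaneAdj 18 s t → t < 18 := fun ht => Finset.mem_range.1 (h.mem _ _ ht).2
    exact three_le_dg (hC (hm h1)) (hC (hm h2)) (hC (hm h3))
      (fun e => h12 (hinj _ (hm h1) _ (hm h2) e)) (fun e => h13 (hinj _ (hm h1) _ (hm h3) e))
      (fun e => h23 (hinj _ (hm h2) _ (hm h3) e)) (hadj _ _ h1) (hadj _ _ h2) (hadj _ _ h3)
  refine exists_proper_embedding_of le_rfl (y := fun t => ψ (planePath t))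
    ⟨fun t ht => hadj _ _ (hpathAdj t ht), fun a ha b hb e =>
      hpathInj a ha b hb (hinj _ (hpath a ha) _ (hpath b hb) e)⟩
    (r := fun i k => ψ (planeArc i k))
    (fun i hi => ⟨fun k hk => hadj _ _ (harcAdj i hi k hk), fun a ha b hb e =>
      harcInj i hi a ha b hb (hinj _ (harc i hi a ha) _ (harc i hi b hb) e)⟩)
    (fun i hi => by interval_cases i <;> rfl)
    (fun i hi => by interval_cases i <;> rfl)
    (fun i hi k h0 h1 t ht e => by
      obtain rfl : k = 1 := by omega
      exact hne i hi t ht (hinj _ (harc i hi 1 (by omega)) _ (hpath t ht) e))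
    (Z := Z) (C := C) hZ ?_ ?_
  · intro hsub
    have h0 : ∀ t ≤ 6, planePath t ≠ 0 := by decide
    have h1 : ∀ i ≤ 2, ∀ k ≤ 2, planeArc i k ≠ 0 := by decide
    rcases (hZ _).1 (hsub (hC (show 0 < 18 by omega))) with ⟨t, ht, e⟩ | ⟨i, hi, k, hk, e⟩
    · exact h0 t ht (hinj _ (hpath t ht) _ (by omega) e)
    · exact h1 i hi k hk (hinj _ (harc i hi k hk) _ (by omega) e)
  · rintro (⟨z, hz, hzZ, hd⟩ | ⟨p, hp, hpC, hpi⟩)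
    · have := hdeg z hz hzZ
      omega
    · have h1 := hpi 1 (by omega) (by omega)
      have := hdeg _ (hpC 1 (by omega)) h1.1
      omega

theorem exists_proper_embedding {n : ℕ} (hn : 3 ≤ n) :
    ∃ φ : Gamma n (n + 3) ↪g Gamma n (n + 3), ¬ Function.Surjective φ := by
  rcases hn.eq_or_lt with rfl | hn
  · exact exists_proper_embedding_three
  · exact exists_proper_embedding_of_four_le hn

end Three

/-! ### Existence of strictly increasing chains -/

section ChainExistence

variable {W : Type} {K : SimpleGraph W} (φ : K ↪g K)

theorem iterate_adj (k : ℕ) {a b : W} : K.Adj (φ^[k] a) (φ^[k] b) ↔ K.Adj a b := by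
  induction k with
  | zero => rfl
  | succ k ih => rw [Function.iterate_succ_apply', Function.iterate_succ_apply', φ.map_adj_iff, ih]

/-- The vertices of the direct limit of `K → K → K → ⋯`, all maps being `φ`: each is represented
by the first stage at which it occurs and its name in this stage. -/
abbrev LimitVertex : Type := {p : ℕ × W // p.1 = 0 ∨ p.2 ∉ Set.range φ}

/-- The direct limit of `K → K → K → ⋯`, all maps being `φ`. -/
def limitGraph : SimpleGraph (LimitVertex φ) where
  Adj p q := K.Adj (φ^[q.1.1] p.1.2) (φ^[p.1.1] q.1.2)
  symm := ⟨fun _ _ h => h.symm⟩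
  loopless := ⟨fun _ h => K.loopless.irrefl _ h⟩

/-- If representatives from different stages were identified, the later one would lie in the range
of `φ`, contrary to its being new at its stage. -/
theorem limit_injective {m : ℕ} {p q : LimitVertex φ} (hp : p.1.1 ≤ m) (hq : q.1.1 ≤ m)
    (h : φ^[m - p.1.1] p.1.2 = φ^[m - q.1.1] q.1.2) : p = q := by
  wlog hpq : p.1.1 ≤ q.1.1 generalizing p q
  · exact (this hq hp h.symm (le_of_not_ge hpq)).symm
  obtain ⟨⟨i, a⟩, hia⟩ := p
  obtain ⟨⟨j, b⟩, hjb⟩ := q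
  dsimp only at *
  rw [show m - i = (m - j) + (j - i) by omega, Function.iterate_add_apply] at h
  have h' := (φ.injective.iterate (m - j)) h
  rcases hpq.eq_or_lt with rfl | hlt
  · rw [Nat.sub_self] at h'
    obtain rfl : a = b := h'
    rfl
  · exfalso
    rcases hjb with hjb | hjb
    · omega
    · apply hjb
      rw [show j - i = (j - i - 1) + 1 by omega, Function.iterate_succ_apply'] at h'
      exact ⟨_, h'⟩

theorem limit_surjective (m : ℕ) (x : W) :
    ∃ p : LimitVertex φ, p.1.1 ≤ m ∧ φ^[m - p.1.1] p.1.2 = x := by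
  induction m generalizing x with
  | zero => exact ⟨⟨(0, x), Or.inl rfl⟩, le_rfl, rfl⟩
  | succ m ih =>
    by_cases hx : x ∈ Set.range φ
    · obtain ⟨x', rfl⟩ := hx
      obtain ⟨p, hp, hpx⟩ := ih x'
      refine ⟨p, hp.trans (Nat.le_succ m), ?_⟩
      rw [show m + 1 - p.1.1 = (m - p.1.1) + 1 by omega, Function.iterate_succ_apply', hpx]
    · refine ⟨⟨(m + 1, x), Or.inr hx⟩, le_rfl, ?_⟩
      dsimp only
      rw [Nat.sub_self]
      rfl

/-- The first `m + 1` stages of the direct limit form a copy of `K`. -/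
noncomputable def limitIso (m : ℕ) : (limitGraph φ).induce {p | p.1.1 ≤ m} ≃g K where
  toEquiv := Equiv.ofBijective (fun p => φ^[m - p.1.1.1] p.1.1.2)
    ⟨fun p q h => Subtype.ext (limit_injective φ p.2 q.2 h), fun x => by
      obtain ⟨p, hp, hpx⟩ := limit_surjective φ m x
      exact ⟨⟨p, hp⟩, hpx⟩⟩
  map_rel_iff' := by
    rintro ⟨⟨⟨i, a⟩, hia⟩, hi⟩ ⟨⟨⟨j, b⟩, hjb⟩, hj⟩
    have hi : i ≤ m := hi
    have hj : j ≤ m := hj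
    show K.Adj (φ^[m - i] a) (φ^[m - j] b) ↔ K.Adj (φ^[j] a) (φ^[i] b)
    -- Applying `φ` i+j times on the left and m times on the right turns both sides into the same
    -- adjacency.
    rw [← iterate_adj φ (i + j), ← iterate_adj φ m (a := φ^[j] a)]
    simp only [← Function.iterate_add_apply]
    rw [show i + j + (m - i) = m + j by omega, show i + j + (m - j) = m + i by omega]

end ChainExistence

theorem exists_isGammaPrime {n : ℕ} (hn : 3 ≤ n) :
    ∃ (V : Type) (G : SimpleGraph V), IsGammaPrime n G := by
  obtain ⟨φ, hφ⟩ := exists_proper_embedding hn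
  obtain ⟨b, hb⟩ := not_forall.1 hφ
  refine ⟨LimitVertex φ, limitGraph φ, fun m => {p | p.1.1 ≤ m}, fun m => ⟨?_, ?_⟩, ?_, fun m =>
    ⟨limitIso φ m⟩⟩
  · exact fun p (hp : p.1.1 ≤ m) => hp.trans (Nat.le_succ m)
  -- The vertex `b` outside the range of `φ` represents a new vertex at every stage.
  · intro h
    have : m + 1 ≤ m := h (a := (⟨(m + 1, b), Or.inr hb⟩ : LimitVertex φ)) (by simp)
    omega
  · rw [Set.eq_univ_iff_forall]
    exact fun p => Set.mem_iUnion.2 ⟨p.1.1, by simp⟩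

/-! ### Unions of chains -/

section Chain

variable {V : Type u} {G : SimpleGraph V} {n : ℕ}

theorem exists_walk_map_eq {W : Type*} {K : SimpleGraph W} (f : K ↪g G) {x y : V} (w : G.Walk x y)
    (hw : ∀ z ∈ w.support, z ∈ Set.range f) :
    ∀ a b (ha : f a = x) (hb : f b = y), ∃ w' : K.Walk a b, (w'.map f.toHom).copy ha hb = w := by
  induction w with
  | nil =>
    intro a b ha hb
    obtain rfl : b = a := f.injective (hb.trans ha.symm)
    subst ha
    exact ⟨.nil, rfl⟩
  | @cons x z y h w ih =>
    intro a b ha hb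
    obtain ⟨c, rfl⟩ := hw z (by simp)
    obtain ⟨w', hw'⟩ := ih (fun z hz => hw z (by simp [hz])) c b rfl hb
    subst ha hb
    refine ⟨.cons (f.map_adj_iff.1 h) w', ?_⟩
    rw [← hw']
    rfl

/-- `G` is the union of the strictly increasing chain of the images of the embeddings `f i` of
`Γ^{n+3}`. -/
structure IsGammaChain (n : ℕ) (G : SimpleGraph V) (f : ℕ → Gamma n (n + 3) ↪g G) : Prop where
  strict : ∀ i, Set.range (f i) ⊂ Set.range (f (i + 1))
  cover : ∀ x, ∃ i, x ∈ Set.range (f i)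

theorem IsGammaPrime.exists_chain (h : IsGammaPrime n G) : ∃ f, IsGammaChain n G f := by
  obtain ⟨S, hS, hcov, hiso⟩ := h
  have hr : ∀ i, Set.range ((SimpleGraph.Embedding.induce (S i)).comp (hiso i).some.symm.toEmbedding)
      = S i := by
    intro i
    ext x
    constructor
    · rintro ⟨a, rfl⟩
      exact ((hiso i).some.symm a).2
    · intro hx
      refine ⟨(hiso i).some ⟨x, hx⟩, ?_⟩
      simp
  refine ⟨fun i => (SimpleGraph.Embedding.induce (S i)).comp (hiso i).some.symm.toEmbedding,
    fun i => ?_, fun x => ?_⟩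
  · rw [hr, hr]
    exact hS i
  · have : x ∈ ⋃ i, S i := hcov ▸ Set.mem_univ x
    obtain ⟨i, hi⟩ := Set.mem_iUnion.1 this
    exact ⟨i, by rwa [hr]⟩

theorem IsGammaChain.map {W : Type u} {K : SimpleGraph W} {f : ℕ → Gamma n (n + 3) ↪g G}
    (h : IsGammaChain n G f) (e : G ≃g K) :
    IsGammaChain n K (fun i => e.toEmbedding.comp (f i)) := by
  have hr : ∀ i, Set.range (e.toEmbedding.comp (f i)) = e '' Set.range (f i) := fun i => by
    rw [← Set.range_comp]
    rfl
  refine ⟨fun i => ?_, fun x => ?_⟩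
  · rw [hr, hr]
    exact e.injective.image_strictMono (h.strict i)
  · obtain ⟨i, hi⟩ := h.cover (e.symm x)
    exact ⟨i, by rw [hr]; exact ⟨_, hi, e.apply_symm_apply x⟩⟩

namespace IsGammaChain

variable {f : ℕ → Gamma n (n + 3) ↪g G} (h : IsGammaChain n G f)

include h

theorem mono : Monotone fun i => Set.range (f i) :=
  monotone_nat_of_le_succ fun i => (h.strict i).1

theorem exists_subset (F : Finset V) : ∃ i, (F : Set V) ⊆ Set.range (f i) := by
  classical
  induction F using Finset.induction with
  | empty => exact ⟨0, by simp⟩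
  | insert a C _ ih =>
    obtain ⟨i, hi⟩ := ih
    obtain ⟨j, hj⟩ := h.cover a
    refine ⟨max i j, ?_⟩
    rw [Finset.coe_insert, Set.insert_subset_iff]
    exact ⟨h.mono (le_max_right i j) hj, hi.trans (h.mono (le_max_left i j))⟩

theorem exists_map_eq (F : Finset V) : ∃ i, ∃ F' : Finset (GammaVertex n (n + 3)), F'.map (f i).toEmbedding = F := by
  obtain ⟨i, hi⟩ := h.exists_subset F
  refine ⟨i, F.preimage (f i) (f i).injective.injOn, ?_⟩
  ext x
  rw [Finset.mem_map]
  constructor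
  · rintro ⟨a, ha, rfl⟩
    exact Finset.mem_preimage.1 ha
  · intro hx
    obtain ⟨a, rfl⟩ := hi hx
    exact ⟨a, Finset.mem_preimage.2 hx, rfl⟩

/-- A closed walk is finite and so lives in one member of the chain; this passes bipartiteness and
girth on to the union. -/
theorem exists_loop {x : V} (w : G.Walk x x) : ∃ i a, ∃ w' : (Gamma n (n + 3)).Walk a a,
    ∃ ha : f i a = x, (w'.map (f i).toHom).copy ha ha = w := by
  classical
  obtain ⟨i, hi⟩ := h.exists_subset w.support.toFinset
  have hi' : ∀ z ∈ w.support, z ∈ Set.range (f i) := fun z hz => hi (by simpa using hz)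
  obtain ⟨a, ha⟩ := hi' x w.start_mem_support
  obtain ⟨w', hw'⟩ := exists_walk_map_eq (f i) w hi' a a ha ha
  exact ⟨i, a, w', ha, hw'⟩

theorem isBipartite (hn : 3 ≤ n) : G.IsBipartite := by
  refine SimpleGraph.two_colorable_iff_forall_loop_even.2 fun x w => ?_
  obtain ⟨i, a, w', rfl, rfl⟩ := h.exists_loop w
  have := SimpleGraph.two_colorable_iff_forall_loop_even.1 (gamma_isBipartite hn) a w'
  simpa using this

theorem largeGirth (hn : 3 ≤ n) : LargeGirth n G := by
  intro x w hw
  obtain ⟨i, a, w', rfl, rfl⟩ := h.exists_loop w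
  have := gamma_largeGirth hn a w' (hw.of_map (f := (f i).toHom))
  simpa using this

theorem exists_walk (hn : 3 ≤ n) (x y : V) : ∃ w : G.Walk x y, w.length ≤ n := by
  classical
  obtain ⟨i, hi⟩ := h.exists_subset {x, y}
  obtain ⟨a, rfl⟩ := hi (show x ∈ _ by simp)
  obtain ⟨b, rfl⟩ := hi (show y ∈ _ by simp)
  obtain ⟨w, hw⟩ := gamma_exists_walk hn a b
  exact ⟨w.map (f i).toHom, by simpa using hw⟩

theorem thick (hn : 3 ≤ n) (v : V) : 3 ≤ (G.neighborSet v).encard := by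
  obtain ⟨i, a, rfl⟩ := h.cover v
  refine (gamma_thick hn a).trans ?_
  rw [← (f i).injective.encard_image]
  refine Set.encard_le_encard ?_
  rintro _ ⟨b, hb, rfl⟩
  exact (f i).map_adj_iff.2 hb

theorem hasPiece (hn : 3 ≤ n) (A : Finset V) (hA : A.Nonempty) : HasPiece n G ∅ A := by
  obtain ⟨i, F, rfl⟩ := h.exists_map_eq A
  have := (gamma_hasPiece hn F (Finset.map_nonempty.1 hA)).map (f i)
  rwa [Set.image_empty] at this

theorem exists_superset (hn : 3 ≤ n) (F : Finset V) :
    ∃ C, F ⊆ C ∧ defect n G C ≤ 4 * n + 4 := by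
  obtain ⟨i, F, rfl⟩ := h.exists_map_eq F
  obtain ⟨C, -, hF, hC⟩ := gamma_exists_superset hn F
  exact ⟨C.map (f i).toEmbedding, Finset.map_subset_map.2 hF, by rwa [defect_map]⟩

theorem isOpenPolygon (hn : 3 ≤ n) : IsOpenPolygon n G := by
  have : Nonempty V := ⟨f 0 (gammaPath n 0)⟩
  exact ⟨isGeneralizedPolygon_of hn (h.isBipartite hn) (h.exists_walk hn) (h.largeGirth hn)
    (h.thick hn), isOpenGraph_of_hasPiece (h.hasPiece hn) hn⟩

/-- A path of length `n - 1` with ends in one of the images lies in this image. -/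
theorem mem_range_of_isPathSeq (hn : 3 ≤ n) {p : ℕ → V} (hp : IsPathSeq G (n - 1) p) {i : ℕ}
    (h0 : p 0 ∈ Set.range (f i)) (h1 : p (n - 1) ∈ Set.range (f i)) {k : ℕ} (hk : k ≤ n - 1) :
    p k ∈ Set.range (f i) := by
  obtain ⟨a, ha⟩ := h0
  obtain ⟨b, hb⟩ := h1
  obtain ⟨w, -⟩ := gamma_exists_walk hn a b
  obtain ⟨w₁, -, hw₁, -⟩ := hp.exists_walk
  obtain ⟨w', hw', hwl⟩ := exists_short_path (gamma_isBipartite hn) (gamma_exists_walk hn) w (by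
    have := SimpleGraph.two_colorable_iff_forall_loop_even.1 (h.isBipartite hn) _
      (((w.map (f i).toHom).copy ha hb).append w₁.reverse)
    simp only [SimpleGraph.Walk.length_append, SimpleGraph.Walk.length_copy,
      SimpleGraph.Walk.length_map, SimpleGraph.Walk.length_reverse] at this
    rw [Nat.even_iff] at this
    rw [Nat.odd_iff]
    omega)
  have := (h.largeGirth hn).pathSeq_unique ((isPathSeq_getVert hw').map (f i)) hp (by simp [ha])
    (by simp [hb]) (by omega)
  rw [← this.2 k (by omega)]
  exact ⟨_, rfl⟩

end IsGammaChain

/-- A hat has only one neighbour; if `C` contains no hat, its vertex of least index on the path is a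
loose end. -/
theorem IsHatRack.exists_dg_le_one {W : Type u} {H : SimpleGraph W} {k : ℕ} (h : IsHatRack k H)
    (C : Finset W) (hne : C.Nonempty) : ∃ z ∈ C, dg H C z ≤ 1 := by
  classical
  obtain ⟨x, hx⟩ := h
  by_cases hC : ∃ z ∈ C, z ∉ Set.range x
  · obtain ⟨z, hz, hzx⟩ := hC
    obtain ⟨i, -, -, hi⟩ := hx z hzx
    refine ⟨z, hz, (Finset.card_le_card (t := {x i}) ?_).trans (by simp)⟩
    intro w hw
    rw [Finset.mem_singleton]
    exact (hi w).1 (Finset.mem_filter.1 hw).2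
  · push Not at hC
    have hex : ∃ t, ∃ ht : t < k + 1, x ⟨t, ht⟩ ∈ C := by
      obtain ⟨z, hz⟩ := hne
      obtain ⟨i, rfl⟩ := hC z hz
      exact ⟨i, i.2, hz⟩
    obtain ⟨h1, h2⟩ := Nat.find_spec hex
    refine ⟨_, h2, ?_⟩
    by_cases h3 : Nat.find hex + 1 < k + 1
    · refine (Finset.card_le_card (t := {x ⟨Nat.find hex + 1, h3⟩}) ?_).trans (by simp)
      intro w hw
      rw [Finset.mem_filter] at hw
      obtain ⟨i, rfl⟩ := hC w hw.1
      have h4 := Nat.find_min' hex ⟨i.2, hw.1⟩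
      have h5 := x.map_adj_iff.1 hw.2
      rw [SimpleGraph.pathGraph_adj] at h5
      dsimp only at h5
      rw [Finset.mem_singleton]
      congr 1
      apply Fin.ext
      dsimp only
      omega
    · refine (Finset.card_le_card (t := ∅) ?_).trans (by simp)
      intro w hw
      rw [Finset.mem_filter] at hw
      obtain ⟨i, rfl⟩ := hC w hw.1
      have h4 := Nat.find_min' hex ⟨i.2, hw.1⟩
      have h5 := x.map_adj_iff.1 hw.2
      rw [SimpleGraph.pathGraph_adj] at h5
      dsimp only at h5
      omega

/-- A nonempty finite subset of a hat-rack has fewer edges than vertices, so |C| + n - 2 ≤ δ(C) ≤ 2n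
+ 2. -/
theorem card_le_of_isHatRack {W : Type u} {H : SimpleGraph W} {k : ℕ} (hn : 3 ≤ n)
    (h : IsHatRack k H) {C : Finset W} (hC : defect n H C ≤ 4 * n + 4) : C.card ≤ n + 4 := by
  rcases C.eq_empty_or_nonempty with rfl | hne
  · simp
  have h1 := e2_le_of_looseEnds C hne fun D _ hD => h.exists_dg_le_one D hD
  unfold defect at hC
  have h2 : (e2 H C : ℤ) + 2 ≤ 2 * C.card := by exact_mod_cast h1
  have h3 : (3 : ℤ) ≤ n := by exact_mod_cast hn
  have h4 : (C.card : ℤ) ≤ n + 4 := by nlinarith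
  exact_mod_cast h4

/-- A finite part of the hat-rack lies in a set of defect at most 4n+4. Stripping this set down to
stage 0 keeps the bound, so the hat-rack is finite and lies in one member of the chain. That member
contains all later arcs, since they have length n-1, and so it is everything. -/
theorem IsGammaChain.not_hatRack {W : Type u} {H : SimpleGraph W} {k : ℕ} (hn : 3 ≤ n)
    (hH : IsHatRack k H) {f : ℕ → Gamma n (n + 3) ↪g freeCompletion n H}
    (h : IsGammaChain n (freeCompletion n H) f) : False := by
  classical
  have hcard : ∀ F : Finset W, F.card ≤ n + 4 := by
    intro F
    obtain ⟨C, hF, hC⟩ := h.exists_superset hn (F.map (baseEmbedding hn H).toEmbedding)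
    have h1 := defect_filter_le (G := freeCompletion n H) hn (T := lev n H 0) C
      fun C' _ hC' => hasPiece_lev hn 0 C' hC'
    have h2 : C.filter (· ∈ lev n H 0) = (C.preimage (baseEmbedding hn H)
        (baseEmbedding hn H).injective.injOn).map (baseEmbedding hn H).toEmbedding := by
      ext x
      rw [Finset.mem_filter, Finset.mem_map]
      constructor
      · rintro ⟨hx, hx0⟩
        obtain ⟨v, rfl⟩ := exists_baseVertex hx0
        exact ⟨v, Finset.mem_preimage.2 hx, rfl⟩
      · rintro ⟨v, hv, rfl⟩
        exact ⟨Finset.mem_preimage.1 hv, baseVertex_mem v⟩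
    rw [h2, defect_map] at h1
    refine le_trans (Finset.card_le_card fun v hv => ?_) (card_le_of_isHatRack hn hH (h1.trans hC))
    exact Finset.mem_preimage.2 (hF (Finset.mem_map_of_mem _ hv))
  have hfin : Finite W := by
    by_contra hinf
    rw [not_finite_iff_infinite] at hinf
    obtain ⟨F, hF⟩ := Infinite.exists_subset_card_eq W (n + 5)
    have := hcard F
    omega
  have := Fintype.ofFinite W
  obtain ⟨m, hm⟩ := h.exists_subset (Finset.univ.map (baseEmbedding hn H).toEmbedding)
  have hlev : ∀ i, lev n H i ⊆ Set.range (f m) := by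
    intro i
    induction i with
    | zero =>
      intro x hx
      obtain ⟨v, rfl⟩ := exists_baseVertex hx
      exact hm (Finset.mem_coe.2 (Finset.mem_map_of_mem _ (Finset.mem_univ v)))
    | succ i ih =>
      intro x hx
      by_cases hx' : x ∈ lev n H i
      · exact ih hx'
      · obtain ⟨p, k, hp, h0, h1, rfl⟩ := exists_stageArc_of_mem hn hx hx'
        exact h.mem_range_of_isPathSeq hn (hp.isPathSeq hn) (ih (hp.ends hn).1)
          (ih (hp.ends hn).2) h1.le
  refine (h.strict m).2 fun x _ => ?_
  obtain ⟨i, hi⟩ := exists_mem_lev x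
  exact hlev i hi

theorem IsGammaPrime.not_isFreePolygon (hn : 3 ≤ n) (h : IsGammaPrime n G) :
    ¬ IsFreePolygon n G := by
  rintro ⟨k, -, W, H, hH, ⟨e⟩⟩
  obtain ⟨f, hf⟩ := h.exists_chain
  exact (hf.map e).not_hatRack hn hH

theorem isFreePolygon_gamma (n : ℕ) : IsFreePolygon n (Gamma n (n + 3)) := by
  refine ⟨n + 3, le_rfl, _, SimpleGraph.pathGraph (n + 3 + 1), ⟨SimpleGraph.Embedding.refl, ?_⟩,
    ⟨SimpleGraph.Iso.refl⟩⟩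
  exact fun v hv => absurd ⟨v, rfl⟩ hv

theorem IsFreePolygon.of_iso {W : Type u} {K : SimpleGraph W} (h : IsFreePolygon n K)
    (e : G ≃g K) : IsFreePolygon n G := by
  obtain ⟨k, hk, W', H, hH, ⟨e'⟩⟩ := h
  exact ⟨k, hk, W', H, hH, ⟨e.trans e'⟩⟩

end Chain

/-! ### Models of the theory -/

section Models

open FirstOrder.Language

variable {n : ℕ}

theorem surjective_of_minimal {L : Language} {M N : Type*} [L.Structure M] [L.Structure N]
    (h : ∀ S : L.ElementarySubstructure N, S = ⊤) (f : M ↪ₑ[L] N) : Function.Surjective f := by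
  have hS : f.toEmbedding.toHom.range.IsElementary := by
    intro k φ x
    choose y hy using fun i => (x i).2
    have h1 : ((↑) : _ → N) ∘ x = f ∘ y := funext fun i => (hy i).symm
    have h2 : x = f.toEmbedding.equivRange ∘ y := funext fun i => Subtype.ext (hy i).symm
    rw [h1, f.map_formula, h2, StrongHomClass.realize_formula]
  intro b
  have hb : b ∈ (⟨_, hS⟩ : L.ElementarySubstructure N) := by
    rw [h ⟨_, hS⟩]
    trivial
  exact hb

theorem model_openPolygonTheory {V : Type} {G : SimpleGraph V} (c : G.Coloring Bool)
    (h : IsOpenPolygon n G) : letI := polygonStructure G c; V ⊨ openPolygonTheory n :=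
  let _ := polygonStructure G c
  ⟨fun _ hφ => hφ V G c h⟩

/-- Primeness quantifies over models in the universe of `M`, so the model `N` is first lifted there.
-/
theorem IsPrimeModel.exists_embedding {M : Type u} [polygonLang.Structure M]
    {T : polygonLang.Theory} (h : IsPrimeModel T M) (N : Type) [polygonLang.Structure N] [N ⊨ T] :
    Nonempty (M ↪ₑ[polygonLang] N) := by
  let e : N ≃ ULift.{u} N := Equiv.ulift.symm
  let _ : polygonLang.Structure (ULift.{u} N) := e.inducedStructure
  let e' : N ≃[polygonLang] ULift.{u} N := e.inducedStructureEquiv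
  obtain ⟨f⟩ := h.2 (ULift.{u} N) (StrongHomClass.theory_model e')
  exact ⟨e'.symm.toElementaryEmbedding.comp f⟩

theorem adj_iff_of_embedding {M : Type*} [polygonLang.Structure M] {V : Type*} (G : SimpleGraph V)
    (c : G.Coloring Bool) : letI := polygonStructure G c
    ∀ (f : M ↪ₑ[polygonLang] V) (a b : M),
      G.Adj (f a) (f b) ↔ Structure.RelMap (L := polygonLang) PolygonRel.adj ![a, b] := by
  let _ := polygonStructure G c
  intro f a b
  exact f.map_rel PolygonRel.adj ![a, b]

/-- An elementary embedding of the prime model into a minimal model is onto, because its range is an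
elementary substructure. -/
theorem nonempty_iso_of_minimal {V W : Type} {G : SimpleGraph V} {K : SimpleGraph W}
    (c : G.Coloring Bool) (d : K.Coloring Bool)
    (hG : letI := polygonStructure G c; IsMinimalModel (openPolygonTheory n) V)
    (hK : letI := polygonStructure K d; IsMinimalModel (openPolygonTheory n) W)
    {M : Type u} [polygonLang.Structure M] (hM : IsPrimeModel (openPolygonTheory n) M) :
    Nonempty (G ≃g K) := by
  let _ := polygonStructure G c
  let _ := polygonStructure K d
  have := hG.1
  have := hK.1
  obtain ⟨f⟩ := hM.exists_embedding V
  obtain ⟨g⟩ := hM.exists_embedding W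
  let ef := Equiv.ofBijective f ⟨f.injective, surjective_of_minimal hG.2 f⟩
  let eg := Equiv.ofBijective g ⟨g.injective, surjective_of_minimal hK.2 g⟩
  refine ⟨⟨ef.symm.trans eg, ?_⟩⟩
  intro x y
  obtain ⟨a, rfl⟩ := ef.surjective x
  obtain ⟨b, rfl⟩ := ef.surjective y
  simp only [Equiv.trans_apply, Equiv.symm_apply_apply]
  exact (adj_iff_of_embedding K d g a b).trans (adj_iff_of_embedding G c f a b).symm

theorem exists_coloring {V : Type*} {G : SimpleGraph V} (h : G.IsBipartite) :
    Nonempty (G.Coloring Bool) := by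
  obtain ⟨c⟩ := h
  exact ⟨G.recolorOfEquiv finTwoEquiv c⟩

theorem gamma_isMinimalModel (hn : 3 ≤ n) (c : (Gamma n (n + 3)).Coloring Bool) :
    letI := polygonStructure (Gamma n (n + 3)) c
    IsMinimalModel (openPolygonTheory n) (GammaVertex n (n + 3)) := by
  have := gamma_infinite hn
  refine ⟨model_openPolygonTheory c (gamma_isOpenPolygon hn), ?_⟩
  exact elementarySubstructure_eq_top hn (gamma_largeGirth hn) (gamma_hasPiece hn)
    (fun F => (gamma_exists_superset hn F).imp fun C h => h.2) c

theorem IsGammaPrime.isMinimalModel (hn : 3 ≤ n) {V : Type} {G : SimpleGraph V}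
    (h : IsGammaPrime n G) (c : G.Coloring Bool) : letI := polygonStructure G c
    IsMinimalModel (openPolygonTheory n) V := by
  obtain ⟨f, hf⟩ := h.exists_chain
  have : Nonempty V := ⟨f 0 (gammaPath n 0)⟩
  have := infinite_of_thick hn (hf.thick hn) (hf.hasPiece hn)
  refine ⟨model_openPolygonTheory c (hf.isOpenPolygon hn), ?_⟩
  exact elementarySubstructure_eq_top hn (hf.largeGirth hn) (hf.hasPiece hn)
    (hf.exists_superset hn) c

theorem IsGammaPrime.isEmpty_iso (hn : 3 ≤ n) {V : Type} {G : SimpleGraph V}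
    (h : IsGammaPrime n G) : IsEmpty (G ≃g Gamma n (n + 3)) :=
  ⟨fun e => h.not_isFreePolygon hn ((isFreePolygon_gamma n).of_iso e)⟩

theorem not_isPrimeModel (hn : 3 ≤ n) (M : Type u) [polygonLang.Structure M] :
    ¬ IsPrimeModel (openPolygonTheory n) M := by
  intro hM
  obtain ⟨V, G, hG⟩ := exists_isGammaPrime hn
  obtain ⟨f, hf⟩ := hG.exists_chain
  obtain ⟨c⟩ := exists_coloring (hf.isBipartite hn)
  obtain ⟨d⟩ := exists_coloring (gamma_isBipartite hn)
  obtain ⟨e⟩ := nonempty_iso_of_minimal c d (hG.isMinimalModel hn c) (gamma_isMinimalModel hn d) hM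
  exact (hG.isEmpty_iso hn).false e

end Models

end OpenPolygon

theorem mainTheorem6 (n : ℕ) (hn : 3 ≤ n) :
    -- `T_n` has no prime model
    (∀ (M : Type u) [OpenPolygon.polygonLang.Structure M],
      ¬ OpenPolygon.IsPrimeModel (OpenPolygon.openPolygonTheory n) M) ∧
    -- `Γ^{n+3}` is an open generalized `n`-gon and, with either bipartition, a minimal model
    OpenPolygon.IsOpenPolygon n (OpenPolygon.Gamma n (n + 3)) ∧
    (∀ c : (OpenPolygon.Gamma n (n + 3)).Coloring Bool,
      letI := OpenPolygon.polygonStructure (OpenPolygon.Gamma n (n + 3)) c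
      OpenPolygon.IsMinimalModel (OpenPolygon.openPolygonTheory n)
        (OpenPolygon.GammaVertex n (n + 3))) ∧
    -- a union `Γ'` of a strictly increasing chain of copies of `Γ^{n+3}` exists
    (∃ (V : Type) (G : SimpleGraph V), OpenPolygon.IsGammaPrime n G) ∧
    -- every such `Γ'` is an open, non-free generalized `n`-gon, is a minimal model, and is not
    -- isomorphic to `Γ^{n+3}` (not even as a graph)
    (∀ (V : Type) (G : SimpleGraph V), OpenPolygon.IsGammaPrime n G →
      OpenPolygon.IsOpenPolygon n G ∧
      ¬ OpenPolygon.IsFreePolygon n G ∧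
      (∀ c : G.Coloring Bool,
        letI := OpenPolygon.polygonStructure G c
        OpenPolygon.IsMinimalModel (OpenPolygon.openPolygonTheory n) V) ∧
      IsEmpty (G ≃g OpenPolygon.Gamma n (n + 3))) := by
  refine ⟨fun M _ => OpenPolygon.not_isPrimeModel hn M, OpenPolygon.gamma_isOpenPolygon hn,
    OpenPolygon.gamma_isMinimalModel hn, OpenPolygon.exists_isGammaPrime hn, fun V G hG => ?_⟩
  obtain ⟨f, hf⟩ := hG.exists_chain
  exact ⟨hf.isOpenPolygon hn, hG.not_isFreePolygon hn, hG.isMinimalModel hn, hG.isEmpty_iso hn⟩
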